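/- Let $\mathbb B=\{x\in\mathbb R^3:|x|\le 1\}$, let $\alpha>-1$ and $c\ge 0$ be real, and put $\varpi_\alpha(x)=(1-|x|^2)^\alpha$. For every $n\in\mathbb N_0$ let $Y^n_\ell$, $1\le\ell\le 2n+1$, be real homogeneous harmonic polynomials of degree $n$ on $\mathbb R^3$ that are orthonormal in $L^2(\mathbb S^2)$. Let $\mathscr F_c^{(\alpha)}[f](x)=\int_{\mathbb B}e^{-\mathrm i c\langle x,\tau\rangle}f(\tau)\varpi_\alpha(\tau)\,d\tau$ be the weighted finite Fourier transform, and let $$\mathscr L^{(\alpha)}_{c,x}=-(1-|x|^2)^{-\alpha}\,\nabla\cdot\big((1-|x|^2)^{\alpha+1}\nabla\big)-\Delta_0+c^2|x|^2,\qquad \Delta_0=(x\times\nabla)\cdot(x\times\nabla),$$ which acts on vector fields componentwise in Cartesian coordinates. Let $\psi^{\alpha,n}_{k,\ell}(\cdot\,;c)$, $k,n\in\mathbb N_0$, $1\le\ell\le 2n+1$, be the scalar ball prolate spheroidal wave functions (ball PSWFs). That is, if $c>0$, they are real, nonzero functions in $L^2_{\varpi_\alpha}(\mathbb B)$ of the form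 $\psi^{\alpha,n}_{k,\ell}(x;c)=\phi_{n,k}(2|x|^2-1)\,Y^n_\ell(x)$ with $$\mathscr F_c^{(\alpha)}[\psi^{\alpha,n}_{k,\ell}]=(-\mathrm i)^{n+2k}\lambda_{n,k}\,\psi^{\alpha,n}_{k,\ell}\ \text{ on }\mathbb B,\qquad \lambda_{n,k}>0;$$ for each fixed $n$ the eigenvalues $(-\mathrm i)^{n+2k}\lambda_{n,k}$, $k\in\mathbb N_0$, are pairwise distinct (for instance, $\lambda_{n,0}>\lambda_{n,1}>\cdots$); and for fixed $n,\ell$ the functions $\psi^{\alpha,n}_{k,\ell}$, $k\in\mathbb N_0$, are complete among the functions $f(2|x|^2-1)Y^n_\ell(x)$ in $L^2_{\varpi_\alpha}(\mathbb B)$. If $c=0$, they are the ball polynomials $\psi^{\alpha,n}_{k,\ell}(x;0)=J_k^{(\alpha,n+1/2)}(2|x|^2-1)\,Y^n_\ell(x)$, where $J_k^{(\alpha,\beta)}$ are the Jacobi polynomials normalized by $\int_{-1}^1J_kJ_l(1-\eta)^\alpha(1+\eta)^\beta\,d\eta=2^{\alpha+\beta+2}\delta_{kl}$. For $n\ge1$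 the divergence free ball PSWFs are the vector fields $\boldsymbol\psi^{\alpha,n}_{k,\ell}=(x\times\nabla)\psi^{\alpha,n}_{k,\ell}$. Then there are positive real numbers $\chi^{(\alpha)}_{n,k}(c)$, $n\ge1$, $k\ge 0$, which for each fixed $n$ are pairwise distinct and can be arranged as a strictly increasing sequence, such that for all $n\ge1$, $k\ge0$, $1\le\ell\le 2n+1$ the scalar function $\psi^{\alpha,n}_{k,\ell}$ is smooth in the open unit ball and satisfies there $\mathscr L^{(\alpha)}_{c,x}\psi^{\alpha,n}_{k,\ell}=\chi^{(\alpha)}_{n,k}(c)\,\psi^{\alpha,n}_{k,\ell}$, and the vector field $\boldsymbol\psi^{\alpha,n}_{k,\ell}$ is divergence free, not identically zero, and an eigenfunction of $\mathscr L^{(\alpha)}_{c,x}$ with the same eigenvalue: $$\mathscr L^{(\alpha)}_{c,x}\boldsymbol\psi^{\alpha,n}_{k,\ell}(x;c)=\chi^{(\alpha)}_{n,k}(c)\,\boldsymbol\psi^{\alpha,n}_{k,\ell}(x;c),\qquad |x|<1 .$$ Moreover, if $c>0$, then $\mathscr L^{(\alpha)}_{c,x}$ has no eigenfunction of the form $\nabla\times(x\times\nabla)E$: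 if $E$ is a real function of class $C^5$ in the open unit ball and $\mathscr L^{(\alpha)}_{c,x}\big[\nabla\times(x\times\nabla)E\big]=\mu\,\nabla\times(x\times\nabla)E$ there for some real $\mu$, then $\nabla\times(x\times\nabla)E=0$ in the open unit ball. -/

import Mathlib

open MeasureTheory
open scoped ContDiff

noncomputable section

namespace BallPSWF

/-- Euclidean three-space. -/
abbrev E3 : Type := EuclideanSpace ℝ (Fin 3)

/-- The closed unit ball of `ℝ³`. -/
def cball : Set E3 := Metric.closedBall 0 1

/-- The open unit ball of `ℝ³`. -/
def oball : Set E3 := Metric.ball 0 1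

/-! ### Vector calculus on `ℝ³`

Scalar fields are functions `E3 → ℝ`, vector fields are functions `E3 → Fin 3 → ℝ`. -/

/-- The partial derivative `∂f/∂xᵢ`. -/
def pd (i : Fin 3) (f : E3 → ℝ) (x : E3) : ℝ :=
  fderiv ℝ f x (EuclideanSpace.single i 1)

/-- The gradient `∇f`. -/
def grad (f : E3 → ℝ) (x : E3) : Fin 3 → ℝ := fun i => pd i f x

/-- The operator `x × ∇` applied to a scalar field. -/
def crossGrad (f : E3 → ℝ) (x : E3) : Fin 3 → ℝ :=
  crossProduct (fun i => x i) (grad f x)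

/-- The divergence `∇ · V`. -/
def divergence (V : E3 → Fin 3 → ℝ) (x : E3) : ℝ :=
  ∑ i, pd i (fun y => V y i) x

/-- The curl `∇ × V`. -/
def curl (V : E3 → Fin 3 → ℝ) (x : E3) : Fin 3 → ℝ :=
  ![pd 1 (fun y => V y 2) x - pd 2 (fun y => V y 1) x,
    pd 2 (fun y => V y 0) x - pd 0 (fun y => V y 2) x,
    pd 0 (fun y => V y 1) x - pd 1 (fun y => V y 0) x]

/-- The Laplace-Beltrami operator `Δ₀ = (x × ∇) · (x × ∇)`. -/
def laplaceBeltrami (f : E3 → ℝ) (x : E3) : ℝ :=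
  ∑ i, crossGrad (fun y => crossGrad f y i) x i

/-- The Sturm-Liouville operator
`-(1-|x|²)^(-α) ∇ · ((1-|x|²)^(α+1) ∇) - Δ₀ + c²|x|²` on scalar fields. -/
def sturmLiouville (α c : ℝ) (f : E3 → ℝ) (x : E3) : ℝ :=
  -((1 - ‖x‖ ^ 2) ^ (-α)) *
      divergence (fun y => (1 - ‖y‖ ^ 2) ^ (α + 1) • grad f y) x
    - laplaceBeltrami f x + c ^ 2 * ‖x‖ ^ 2 * f x

/-- The same operator on vector fields, acting on each Cartesian component. -/
def vecSturmLiouville (α c : ℝ) (V : E3 → Fin 3 → ℝ) (x : E3) : Fin 3 → ℝ :=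
  fun i => sturmLiouville α c (fun y => V y i) x

/-! ### Spherical harmonics, Jacobi and ball polynomials -/

/-- The value of a polynomial in three variables at a point of `ℝ³`. -/
def evalAt (p : MvPolynomial (Fin 3) ℝ) (x : E3) : ℝ := MvPolynomial.eval (fun i => x i) p

/-- For every degree `n`, the `2n+1` polynomials `Y n ℓ` are homogeneous harmonic polynomials of
degree `n`, orthonormal in `L²` of the unit sphere (hence a basis of the space of spherical
harmonics of degree `n`). -/
structure IsSphericalHarmonics (Y : (n : ℕ) → Fin (2 * n + 1) → MvPolynomial (Fin 3) ℝ) :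
    Prop where
  homogeneous : ∀ n ℓ, (Y n ℓ).IsHomogeneous n
  harmonic : ∀ n ℓ, ∑ i, MvPolynomial.pderiv i (MvPolynomial.pderiv i (Y n ℓ)) = 0
  orthonormal : ∀ n (ℓ ι : Fin (2 * n + 1)),
    ∫ s : Metric.sphere (0 : E3) 1, evalAt (Y n ℓ) s * evalAt (Y n ι) s
      ∂(volume : Measure E3).toSphere = if ℓ = ι then 1 else 0

/-- The classical Jacobi polynomial `P_k^{(a,b)}` (for `a > -1`, `a + b + 1 > 0`). -/
def classicalJacobi (k : ℕ) (a b η : ℝ) : ℝ :=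
  Real.Gamma (k + a + 1) / (k.factorial * Real.Gamma (k + a + b + 1)) *
    ∑ s ∈ Finset.range (k + 1),
      (k.choose s : ℝ) * (Real.Gamma (k + a + b + s + 1) / Real.Gamma (a + s + 1)) *
        ((η - 1) / 2) ^ s

/-- The Jacobi polynomial normalized by
`∫_{-1}^1 J_k J_l (1-η)^a (1+η)^b dη = 2^(a+b+2) δ_{kl}`. -/
def normalizedJacobi (k : ℕ) (a b η : ℝ) : ℝ :=
  classicalJacobi k a b η /
    Real.sqrt (Real.Gamma (k + a + 1) * Real.Gamma (k + b + 1) /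
      (2 * (2 * k + a + b + 1) * Real.Gamma (k + 1) * Real.Gamma (k + a + b + 1)))

/-- The ball polynomial `J_k^{(α,n+1/2)}(2|x|²-1) Y(x)`, where `Y` is homogeneous harmonic of
degree `n`. -/
def ballPolynomial (α : ℝ) (n k : ℕ) (Y : MvPolynomial (Fin 3) ℝ) (x : E3) : ℝ :=
  normalizedJacobi k α (n + 1 / 2) (2 * ‖x‖ ^ 2 - 1) * evalAt Y x

/-! ### Scalar and divergence free ball prolate spheroidal wave functions -/

/-- The measure `(1-|x|²)^α dx` on the unit ball. -/
def ballMeasure (α : ℝ) : Measure E3 :=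
  (volume.restrict cball).withDensity fun x => ENNReal.ofReal ((1 - ‖x‖ ^ 2) ^ α)

/-- The finite Fourier transform
`F_c^{(α)}[f](x) = ∫_B exp(-i c ⟨x, τ⟩) f(τ) (1-|τ|²)^α dτ`. -/
def finiteFourier (α c : ℝ) (f : E3 → ℝ) (x : E3) : ℂ :=
  ∫ τ, Complex.exp (-Complex.I * c * (inner ℝ x τ : ℝ)) * (f τ : ℂ) ∂(ballMeasure α)

/-- For `c > 0`: `ψ n k ℓ` are eigenfunctions of the finite Fourier transform with eigenvalues
`(-i)^(n+2k) lam n k`, `lam n k > 0`. They have the separated form `φ_{n,k}(2|x|²-1) Y n ℓ x`, and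
for fixed `n`, `ℓ` they exhaust the square integrable functions of the form `f(2|x|²-1) Y n ℓ x`.
For fixed `n` different `k` belong to different eigenvalues (`-i` to the power `n+2k` is `(-i)^n`
times `(-1)^k`), as is the case when `lam n 0 > lam n 1 > ⋯`. -/
structure IsFourierEigensystem (α c : ℝ)
    (Y : (n : ℕ) → Fin (2 * n + 1) → MvPolynomial (Fin 3) ℝ)
    (lam : ℕ → ℕ → ℝ) (ψ : (n : ℕ) → ℕ → Fin (2 * n + 1) → E3 → ℝ) : Prop where
  memLp : ∀ n k ℓ, MemLp (ψ n k ℓ) 2 (ballMeasure α)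
  ne_zero : ∀ n k ℓ, ∃ x ∈ cball, ψ n k ℓ x ≠ 0
  separated : ∀ n k, ∃ φ : ℝ → ℝ, ∀ ℓ, ∀ x ∈ cball,
    ψ n k ℓ x = φ (2 * ‖x‖ ^ 2 - 1) * evalAt (Y n ℓ) x
  eigen : ∀ n k ℓ, ∀ x ∈ cball,
    finiteFourier α c (ψ n k ℓ) x = (-Complex.I) ^ (n + 2 * k) * (lam n k : ℂ) * (ψ n k ℓ x : ℂ)
  lam_pos : ∀ n k, 0 < lam n k
  distinct : ∀ n, Function.Injective fun k => (-1 : ℝ) ^ k * lam n k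
  complete : ∀ n ℓ (f : ℝ → ℝ),
    MemLp (fun x => f (2 * ‖x‖ ^ 2 - 1) * evalAt (Y n ℓ) x) 2 (ballMeasure α) →
    (∀ k, ∫ x, f (2 * ‖x‖ ^ 2 - 1) * evalAt (Y n ℓ) x * ψ n k ℓ x ∂(ballMeasure α) = 0) →
    (fun x => f (2 * ‖x‖ ^ 2 - 1) * evalAt (Y n ℓ) x) =ᵐ[ballMeasure α] 0

/-- The scalar ball prolate spheroidal wave functions with bandwidth parameter `c ≥ 0`: the
eigenfunctions of the finite Fourier transform if `c > 0`, and the ball polynomials if `c = 0`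
(where the finite Fourier transform degenerates to an operator of rank one). -/
def IsBallPSWF (α c : ℝ)
    (Y : (n : ℕ) → Fin (2 * n + 1) → MvPolynomial (Fin 3) ℝ)
    (lam : ℕ → ℕ → ℝ) (ψ : (n : ℕ) → ℕ → Fin (2 * n + 1) → E3 → ℝ) : Prop :=
  (0 < c → IsFourierEigensystem α c Y lam ψ) ∧
  (c = 0 → ∀ n k ℓ, ∀ x ∈ cball, ψ n k ℓ x = ballPolynomial α n k (Y n ℓ) x)

/-- The divergence free ball prolate spheroidal wave function `(x × ∇)ψ` attached to a scalar
ball prolate spheroidal wave function `ψ`. -/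
def divFreePSWF (ψ : E3 → ℝ) : E3 → Fin 3 → ℝ := crossGrad ψ

end BallPSWF

end

namespace BallPSWF

open scoped Topology

/-! ### Partial derivatives -/

/-! Write L for the Sturm-Liouville operator and X = x × ∇. In expanded form (`expandedSL`) L has
polynomial coefficients, since the terms -(1-|x|²)Δ and -|x|²Δ combine to -Δ. L commutes with X
(`expandedSL_crossGrad`), so X carries scalar eigenfunctions to vector ones with the same
eigenvalue. Divergence-freeness is an identity, and Xψ ≠ 0 because X·X acts on ψ as -n(n+1) ≠ 0.

Scalar case, c > 0. Multiplying the finite Fourier transform by iⁿ and taking real parts gives a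
symmetric real transform T with Tψ_k = (-1)^k λ_k ψ_k. As T has a smooth kernel, ψ_k is the
restriction of a smooth function Ψ_k to the ball. L is symmetric for the weight
(`integral_expandedSL_mul`), and applying L to the kernel in x or in τ gives the same result, so LT
= TL (`expandedSL_trigTransform`). Hence LΨ_k is a T-eigenfunction with the eigenvalue of Ψ_k and is
orthogonal to all other Ψ_j. Subtracting the right multiple of Ψ_k leaves a function f(2|x|²-1)Y
orthogonal to every ψ_j, which vanishes by completeness (`IsFourierEigensystem.exists_eigenvalue`).

Along rays the equation becomes a singular ODE on (0,1). Its flux weight r²(1-r²)^(α+1) vanishes at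
both ends, so integration by parts leaves no boundary terms. This gives positivity, orthogonality,
and, through a Wronskian, simplicity: equal eigenvalues of L would force proportional radial parts
and hence equal eigenvalues of T, contrary to hypothesis.

The eigenvalues can be listed increasingly because only finitely many lie below any M
(`finite_setOf_radial_eigenvalue_le`). Functions vanishing at suitable finitely many nodes satisfy a
Poincaré inequality with a small constant, obtained from a weighted Hardy inequality between
successive nodes; near the origin the term n(n+1)|f|² does the same work. If more eigenvalues than
nodes lay below M, some nonzero combination of eigenfunctions would vanish at all nodes,
contradicting its energy bound.

For c = 0 the Jacobi equation gives the eigenvalues (n+2k)(n+2k+2α+3) directly.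

Nonexistence, c > 0. If div A = 0, then div(LA) = 2c² x·A (`divergence_expandedSL`). Thus LA = μA
forces x·A = 0. For A = ∇×XE the radial component x·A is (X·X)E, so (X·X)E = 0. Integrating this
against E times a radial cutoff gives XE = 0, hence A = 0. -/

theorem pd_eventuallyEq {i : Fin 3} {f g : E3 → ℝ} {x : E3} (h : f =ᶠ[𝓝 x] g) :
    pd i f =ᶠ[𝓝 x] pd i g := by
  filter_upwards [h.eventuallyEq_nhds] with y hy
  simp only [pd, hy.fderiv_eq]

theorem pd_add {i : Fin 3} {f g : E3 → ℝ} (hf : Differentiable ℝ f) (hg : Differentiable ℝ g) :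
    pd i (fun y => f y + g y) = fun y => pd i f y + pd i g y := by
  funext x
  simp [pd, fderiv_fun_add (hf x) (hg x)]

theorem pd_sub {i : Fin 3} {f g : E3 → ℝ} (hf : Differentiable ℝ f) (hg : Differentiable ℝ g) :
    pd i (fun y => f y - g y) = fun y => pd i f y - pd i g y := by
  funext x
  simp [pd, fderiv_fun_sub (hf x) (hg x)]

theorem pd_neg {i : Fin 3} {f : E3 → ℝ} :
    pd i (fun y => -f y) = fun y => -pd i f y := by
  funext x
  simp [pd]

theorem pd_mul_apply {i : Fin 3} {f g : E3 → ℝ} {x : E3} (hf : DifferentiableAt ℝ f x)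
    (hg : DifferentiableAt ℝ g x) :
    pd i (fun y => f y * g y) x = pd i f x * g x + f x * pd i g x := by
  simp [pd, fderiv_fun_mul hf hg]; ring

theorem pd_mul {i : Fin 3} {f g : E3 → ℝ} (hf : Differentiable ℝ f) (hg : Differentiable ℝ g) :
    pd i (fun y => f y * g y) = fun y => pd i f y * g y + f y * pd i g y :=
  funext fun x => pd_mul_apply (hf x) (hg x)

theorem pd_const {i : Fin 3} (a : ℝ) : pd i (fun _ => a) = fun _ => 0 := by
  funext x
  simp [pd]

theorem pd_coord (i j : Fin 3) :
    pd i (fun y => y j) = fun _ => if j = i then 1 else 0 := by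
  funext x
  have : (fun y : E3 => y j) = (EuclideanSpace.proj j : E3 →L[ℝ] ℝ) := by ext; rfl
  rw [pd, this, ContinuousLinearMap.fderiv]
  simp

/-- Chain rule for partial derivatives. -/
theorem pd_comp {i : Fin 3} {g : E3 → ℝ} {h : ℝ → ℝ} {h' : ℝ} {x : E3}
    (hh : HasDerivAt h h' (g x)) (hg : DifferentiableAt ℝ g x) :
    pd i (fun y => h (g y)) x = h' * pd i g x := by
  have := (hh.comp_hasFDerivAt x hg.hasFDerivAt).fderiv
  simp only [Function.comp_def] at this
  simp [pd, this]

theorem contDiff_pd {n : WithTop ℕ∞} {f : E3 → ℝ} (hf : ContDiff ℝ (n + 1) f) (i : Fin 3) :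
    ContDiff ℝ n (pd i f) :=
  (hf.fderiv_right le_rfl).clm_apply contDiff_const

theorem contDiff_top_pd {f : E3 → ℝ} (hf : ContDiff ℝ ∞ f) (i : Fin 3) :
    ContDiff ℝ ∞ (pd i f) :=
  contDiff_pd (by simpa using hf) i

theorem contDiff_two_pd {f : E3 → ℝ} (hf : ContDiff ℝ 3 f) (i : Fin 3) :
    ContDiff ℝ 2 (pd i f) :=
  contDiff_pd (by norm_num; exact hf) i

theorem contDiff_one_pd {f : E3 → ℝ} (hf : ContDiff ℝ 2 f) (i : Fin 3) :
    ContDiff ℝ 1 (pd i f) :=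
  contDiff_pd (by norm_num; exact hf) i

theorem pd_comm {f : E3 → ℝ} (hf : ContDiff ℝ 2 f) (i j : Fin 3) :
    pd i (pd j f) = pd j (pd i f) := by
  funext x
  have hd : Differentiable ℝ (fderiv ℝ f) :=
    (hf.fderiv_right (m := 1) (by norm_num)).differentiable one_ne_zero
  have key : ∀ a b : Fin 3, pd a (pd b f) x =
      fderiv ℝ (fderiv ℝ f) x (EuclideanSpace.single a 1) (EuclideanSpace.single b 1) := by
    intro a b
    have : pd b f = fun y => fderiv ℝ f y (EuclideanSpace.single b 1) := rfl
    rw [this, pd, fderiv_clm_apply (hd x) (by fun_prop)]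
    simp
  rw [key, key]
  exact (hf.contDiffAt.isSymmSndFDerivAt (by simp)) _ _

theorem norm_sq_eq (x : E3) : ‖x‖ ^ 2 = x 0 ^ 2 + x 1 ^ 2 + x 2 ^ 2 := by
  simp [EuclideanSpace.real_norm_sq_eq, Fin.sum_univ_three]

theorem pd_norm_sq (i : Fin 3) : pd i (fun y => ‖y‖ ^ 2) = fun y => 2 * y i := by
  have : (fun y : E3 => ‖y‖ ^ 2) = fun y => y 0 * y 0 + y 1 * y 1 + y 2 * y 2 := by
    funext y; rw [norm_sq_eq]; ring
  rw [this]
  simp (disch := fun_prop) only [pd_add, pd_mul, pd_coord]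
  fin_cases i <;> simp <;> funext y <;> ring

theorem crossGrad_zero (f : E3 → ℝ) (x : E3) :
    crossGrad f x 0 = x 1 * pd 2 f x - x 2 * pd 1 f x := by
  simp [crossGrad, grad, cross_apply]

theorem crossGrad_one (f : E3 → ℝ) (x : E3) :
    crossGrad f x 1 = x 2 * pd 0 f x - x 0 * pd 2 f x := by
  simp [crossGrad, grad, cross_apply]

theorem crossGrad_two (f : E3 → ℝ) (x : E3) :
    crossGrad f x 2 = x 0 * pd 1 f x - x 1 * pd 0 f x := by
  simp [crossGrad, grad, cross_apply]

theorem contDiff_crossGrad {n : WithTop ℕ∞} {f : E3 → ℝ} (hf : ContDiff ℝ (n + 1) f)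
    (i : Fin 3) : ContDiff ℝ n (fun y => crossGrad f y i) := by
  have h := contDiff_pd hf
  have hc : ∀ j : Fin 3, ContDiff ℝ n (fun y : E3 => y j) := fun j => by fun_prop
  fin_cases i
  · simp only [Fin.zero_eta, crossGrad_zero]
    exact ((hc 1).mul (h 2)).sub ((hc 2).mul (h 1))
  · simp only [Fin.mk_one, crossGrad_one]
    exact ((hc 2).mul (h 0)).sub ((hc 0).mul (h 2))
  · simp only [Fin.reduceFinMk, crossGrad_two]
    exact ((hc 0).mul (h 1)).sub ((hc 1).mul (h 0))

theorem crossGrad_eventuallyEq {f g : E3 → ℝ} {x : E3} (h : f =ᶠ[𝓝 x] g) :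
    crossGrad f =ᶠ[𝓝 x] crossGrad g := by
  filter_upwards [pd_eventuallyEq (i := 0) h, pd_eventuallyEq (i := 1) h,
    pd_eventuallyEq (i := 2) h] with y h0 h1 h2
  ext i
  fin_cases i <;> simp [crossGrad_zero, crossGrad_one, crossGrad_two, h0, h1, h2]

theorem crossGrad_apply_eventuallyEq {f g : E3 → ℝ} {x : E3} (h : f =ᶠ[𝓝 x] g) (i : Fin 3) :
    (fun y => crossGrad f y i) =ᶠ[𝓝 x] fun y => crossGrad g y i := by
  filter_upwards [crossGrad_eventuallyEq h] with y hy
  rw [hy]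

theorem divergence_congr {V U : E3 → Fin 3 → ℝ} {x : E3} (h : V =ᶠ[𝓝 x] U) :
    divergence V x = divergence U x := by
  unfold divergence
  refine Finset.sum_congr rfl fun i _ => (pd_eventuallyEq ?_).self_of_nhds
  filter_upwards [h] with y hy
  rw [hy]

theorem curl_eventuallyEq {V U : E3 → Fin 3 → ℝ} {x : E3} (h : V =ᶠ[𝓝 x] U) :
    curl V =ᶠ[𝓝 x] curl U := by
  have h' : ∀ i j : Fin 3, pd i (fun y => V y j) =ᶠ[𝓝 x] pd i (fun y => U y j) := fun i j =>
    pd_eventuallyEq (h.mono fun y hy => congrFun hy j)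
  filter_upwards [h' 1 2, h' 2 1, h' 2 0, h' 0 2, h' 0 1, h' 1 0] with y h1 h2 h3 h4 h5 h6
  simp only [curl, h1, h2, h3, h4, h5, h6]

theorem laplaceBeltrami_congr {f g : E3 → ℝ} {x : E3} (h : f =ᶠ[𝓝 x] g) :
    laplaceBeltrami f x = laplaceBeltrami g x := by
  unfold laplaceBeltrami
  refine Finset.sum_congr rfl fun i _ => ?_
  rw [(crossGrad_eventuallyEq (crossGrad_apply_eventuallyEq h i)).self_of_nhds]

theorem sturmLiouville_congr {α c : ℝ} {f g : E3 → ℝ} {x : E3} (h : f =ᶠ[𝓝 x] g) :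
    sturmLiouville α c f x = sturmLiouville α c g x := by
  unfold sturmLiouville
  rw [laplaceBeltrami_congr h, h.self_of_nhds, divergence_congr (U := fun y =>
    (1 - ‖y‖ ^ 2) ^ (α + 1) • grad g y)]
  have h' := fun i => pd_eventuallyEq (i := i) h
  filter_upwards [h' 0, h' 1, h' 2] with y h0 h1 h2
  congr 1
  ext i
  fin_cases i
  exacts [h0, h1, h2]

/-! ### The open and closed ball, and localization -/

theorem mem_oball_iff {x : E3} : x ∈ oball ↔ ‖x‖ < 1 := by
  simp [oball]

theorem mem_cball_iff {x : E3} : x ∈ cball ↔ ‖x‖ ≤ 1 := by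
  simp [cball]

theorem oball_subset_cball : oball ⊆ cball := Metric.ball_subset_closedBall

theorem isOpen_oball : IsOpen oball := Metric.isOpen_ball

theorem one_sub_norm_sq_pos {x : E3} (hx : x ∈ oball) : 0 < 1 - ‖x‖ ^ 2 := by
  rw [mem_oball_iff] at hx
  nlinarith [norm_nonneg x]

/-- A function of class `C^n` in the open ball agrees on each smaller ball with a global one. -/
theorem exists_contDiff_eqOn {n : WithTop ℕ∞} (hn : n ≤ ∞) {f : E3 → ℝ}
    (hf : ContDiffOn ℝ n f oball) {R : ℝ} (hR : 0 < R) (hR1 : R < 1) :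
    ∃ g : E3 → ℝ, ContDiff ℝ n g ∧ ∀ x, ‖x‖ < R → g x = f x := by
  let b : ContDiffBump (0 : E3) := ⟨R, (1 + R) / 2, hR, by linarith⟩
  refine ⟨fun y => b y * f y, ?_, ?_⟩
  · refine contDiff_iff_contDiffAt.2 fun y => ?_
    by_cases hy : y ∈ tsupport fun y => b y * f y
    swap
    · exact contDiffAt_const.congr_of_eventuallyEq (notMem_tsupport_iff_eventuallyEq.1 hy)
    have hy' : y ∈ oball := by
      have := tsupport_mul_subset_left hy
      rw [b.tsupport_eq] at this
      exact Metric.closedBall_subset_ball (by change (1 + R) / 2 < 1; linarith) this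
    exact (b.contDiff.of_le hn).contDiffAt.mul ((hf y hy').contDiffAt (isOpen_oball.mem_nhds hy'))
  · intro x hx
    have : b x = 1 := b.one_of_mem_closedBall (by simpa using hx.le)
    simp [this]

theorem exists_contDiff_eventuallyEq {n : WithTop ℕ∞} (hn : n ≤ ∞) {f : E3 → ℝ}
    (hf : ContDiffOn ℝ n f oball) {x : E3} (hx : x ∈ oball) :
    ∃ g : E3 → ℝ, ContDiff ℝ n g ∧ g =ᶠ[𝓝 x] f := by
  obtain ⟨R, hxR, hR1⟩ := exists_between (mem_oball_iff.1 hx)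
  obtain ⟨g, hg, hgf⟩ := exists_contDiff_eqOn hn hf ((norm_nonneg x).trans_lt hxR) hR1
  refine ⟨g, hg, ?_⟩
  filter_upwards [(isOpen_lt continuous_norm continuous_const).mem_nhds hxR] with z hz
  exact hgf z hz

/-! ### The Sturm-Liouville operator in expanded form -/

/-- The expanded form of the Sturm-Liouville operator; it has polynomial coefficients. -/
noncomputable def expandedSL (α c : ℝ) (f : E3 → ℝ) (x : E3) : ℝ :=
  -(∑ i, pd i (pd i f) x) + ∑ i, ∑ j, x i * x j * pd i (pd j f) x
    + (2 * α + 4) * ∑ i, x i * pd i f x + c ^ 2 * ‖x‖ ^ 2 * f x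

theorem laplaceBeltrami_eq {f : E3 → ℝ} (hf : ContDiff ℝ 2 f) (x : E3) :
    laplaceBeltrami f x = ‖x‖ ^ 2 * (∑ i, pd i (pd i f) x)
      - ∑ i, ∑ j, x i * x j * pd i (pd j f) x - 2 * ∑ i, x i * pd i f x := by
  have h1 : ∀ i, Differentiable ℝ (pd i f) := fun i =>
    (contDiff_one_pd hf i).differentiable one_ne_zero
  simp only [laplaceBeltrami, Fin.sum_univ_three, crossGrad_zero, crossGrad_one, crossGrad_two]
  simp (disch := fun_prop) only [pd_sub, pd_mul, pd_coord]
  simp only [pd_comm hf 1 0, pd_comm hf 2 0, pd_comm hf 2 1, norm_sq_eq]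
  simp
  ring

theorem pd_rpow_weight (α : ℝ) {x : E3} (hx : x ∈ oball) (i : Fin 3) :
    pd i (fun y => (1 - ‖y‖ ^ 2) ^ α) x = -(2 * α) * x i * (1 - ‖x‖ ^ 2) ^ (α - 1) := by
  have hpos := one_sub_norm_sq_pos hx
  have hd : Differentiable ℝ fun y : E3 => ‖y‖ ^ 2 := (contDiff_norm_sq ℝ (n := 1)).differentiable
    one_ne_zero
  rw [pd_comp (g := fun y => 1 - ‖y‖ ^ 2) (h := fun s => s ^ α)
    (Real.hasDerivAt_rpow_const (Or.inl hpos.ne')) ((hd x).const_sub 1)]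
  simp (disch := fun_prop) only [pd_sub, pd_const, pd_norm_sq]
  ring

theorem differentiableAt_rpow_weight (α : ℝ) {x : E3} (hx : x ∈ oball) :
    DifferentiableAt ℝ (fun y : E3 => (1 - ‖y‖ ^ 2) ^ α) x := by
  have hpos := one_sub_norm_sq_pos hx
  have hd : Differentiable ℝ fun y : E3 => ‖y‖ ^ 2 := (contDiff_norm_sq ℝ (n := 1)).differentiable
    one_ne_zero
  exact DifferentiableAt.rpow_const ((hd x).const_sub 1) (Or.inl hpos.ne')

/-- Inside the ball the factor (1-|x|²)^α is positive and cancels. The remaining second-order terms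
-(1-|x|²)Δ and -|x|²Δ add up to -Δ, so no singularity at the sphere survives. All later computations
use this form, which makes sense on the whole space. -/
theorem sturmLiouville_eq {α c : ℝ} {f : E3 → ℝ} (hf : ContDiff ℝ 2 f) {x : E3}
    (hx : x ∈ oball) : sturmLiouville α c f x = expandedSL α c f x := by
  have h1 : ∀ i, Differentiable ℝ (pd i f) := fun i =>
    (contDiff_one_pd hf i).differentiable one_ne_zero
  have hpos := one_sub_norm_sq_pos hx
  have hdiv : divergence (fun y => (1 - ‖y‖ ^ 2) ^ (α + 1) • grad f y) x =
      (1 - ‖x‖ ^ 2) ^ α * ((1 - ‖x‖ ^ 2) * ∑ i, pd i (pd i f) x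
        - 2 * (α + 1) * ∑ i, x i * pd i f x) := by
    have key : ∀ i : Fin 3,
        pd i (fun y => (((1 - ‖y‖ ^ 2) ^ (α + 1)) • grad f y) i) x =
        (1 - ‖x‖ ^ 2) ^ α * ((1 - ‖x‖ ^ 2) * pd i (pd i f) x - 2 * (α + 1) * (x i * pd i f x)) := by
      intro i
      have : (fun y => (((1 - ‖y‖ ^ 2) ^ (α + 1)) • grad f y) i) =
        fun y => (1 - ‖y‖ ^ 2) ^ (α + 1) * pd i f y := rfl
      rw [this, pd_mul_apply (differentiableAt_rpow_weight _ hx) (h1 i x), pd_rpow_weight _ hx,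
        Real.rpow_add hpos, Real.rpow_one, add_sub_cancel_right]
      ring
    simp only [divergence, key, ← Finset.mul_sum, Finset.sum_sub_distrib]
  have hne : (1 - ‖x‖ ^ 2) ^ α ≠ 0 := (Real.rpow_pos_of_pos hpos _).ne'
  rw [sturmLiouville, hdiv, laplaceBeltrami_eq hf, Real.rpow_neg hpos.le, expandedSL]
  field_simp
  ring

theorem continuous_expandedSL {α c : ℝ} {f : E3 → ℝ} (hf : ContDiff ℝ 2 f) :
    Continuous (expandedSL α c f) := by
  have h0 : Continuous f := hf.continuous
  have h1 : ∀ i, Continuous (pd i f) := fun i => (contDiff_one_pd hf i).continuous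
  have h2 : ∀ i j, Continuous (pd i (pd j f)) := fun i j =>
    (contDiff_pd (n := 0) (by simpa using contDiff_one_pd hf j) i).continuous
  unfold expandedSL
  fun_prop

/-! ### Identities for divergence, curl and x × ∇ -/

theorem divergence_crossGrad {f : E3 → ℝ} (hf : ContDiff ℝ 2 f) (x : E3) :
    divergence (crossGrad f) x = 0 := by
  have h1 : ∀ i, Differentiable ℝ (pd i f) := fun i =>
    (contDiff_one_pd hf i).differentiable one_ne_zero
  simp only [divergence, Fin.sum_univ_three, crossGrad_zero, crossGrad_one, crossGrad_two]
  simp (disch := fun_prop) only [pd_sub, pd_mul, pd_coord]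
  simp only [pd_comm hf 1 0, pd_comm hf 2 0, pd_comm hf 2 1]
  simp

theorem curl_zero (V : E3 → Fin 3 → ℝ) (x : E3) :
    curl V x 0 = pd 1 (fun y => V y 2) x - pd 2 (fun y => V y 1) x := rfl

theorem curl_one (V : E3 → Fin 3 → ℝ) (x : E3) :
    curl V x 1 = pd 2 (fun y => V y 0) x - pd 0 (fun y => V y 2) x := rfl

theorem curl_two (V : E3 → Fin 3 → ℝ) (x : E3) :
    curl V x 2 = pd 0 (fun y => V y 1) x - pd 1 (fun y => V y 0) x := rfl

theorem contDiff_curl {n : WithTop ℕ∞} {V : E3 → Fin 3 → ℝ}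
    (hV : ∀ i, ContDiff ℝ (n + 1) fun y => V y i) (i : Fin 3) :
    ContDiff ℝ n (fun y => curl V y i) := by
  have h : ∀ i j, ContDiff ℝ n (pd i fun y => V y j) := fun i j => contDiff_pd (hV j) i
  fin_cases i
  exacts [(h _ _).sub (h _ _), (h _ _).sub (h _ _), (h _ _).sub (h _ _)]

theorem divergence_curl {V : E3 → Fin 3 → ℝ} (hV : ∀ i, ContDiff ℝ 2 fun y => V y i) (x : E3) :
    divergence (curl V) x = 0 := by
  have h1 : ∀ i j, Differentiable ℝ (pd i fun y => V y j) := fun i j =>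
    (contDiff_one_pd (hV j) i).differentiable one_ne_zero
  simp only [divergence, Fin.sum_univ_three, curl_zero, curl_one, curl_two]
  simp (disch := fun_prop) only [pd_sub]
  simp only [pd_comm (hV _) 1 0, pd_comm (hV _) 2 0, pd_comm (hV _) 2 1]
  ring

/-- The radial component of `∇ × (x × ∇)f` is `Δ₀ f`. -/
theorem radial_curl_crossGrad (f : E3 → ℝ) (x : E3) :
    ∑ i, x i * curl (crossGrad f) x i = laplaceBeltrami f x := by
  simp only [Fin.sum_univ_three, curl_zero, curl_one, curl_two, laplaceBeltrami, crossGrad_zero,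
    crossGrad_one, crossGrad_two]
  ring

/-! ### Commutators of the Sturm-Liouville operator -/

theorem expandedSL_expand {α c : ℝ} {f : E3 → ℝ} (hf : ContDiff ℝ 2 f) :
    expandedSL α c f = fun x => -(pd 0 (pd 0 f) x + pd 1 (pd 1 f) x + pd 2 (pd 2 f) x)
      + (x 0 * x 0 * pd 0 (pd 0 f) x + x 1 * x 1 * pd 1 (pd 1 f) x + x 2 * x 2 * pd 2 (pd 2 f) x
        + 2 * (x 0 * x 1 * pd 0 (pd 1 f) x) + 2 * (x 0 * x 2 * pd 0 (pd 2 f) x)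
        + 2 * (x 1 * x 2 * pd 1 (pd 2 f) x))
      + (2 * α + 4) * (x 0 * pd 0 f x + x 1 * pd 1 f x + x 2 * pd 2 f x)
      + c ^ 2 * (x 0 * x 0 + x 1 * x 1 + x 2 * x 2) * f x := by
  funext x
  simp only [expandedSL, Fin.sum_univ_three, norm_sq_eq, pd_comm hf 1 0, pd_comm hf 2 0,
    pd_comm hf 2 1]
  ring

/-- The commutator of ∂ᵢ with L comes from differentiating the polynomial coefficients. Its term in
xᵢ f is the only one that depends on c and the source of the obstruction for curls. -/
theorem pd_expandedSL {α c : ℝ} {f : E3 → ℝ} (hf : ContDiff ℝ 3 f) (i : Fin 3) (x : E3) :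
    pd i (expandedSL α c f) x = expandedSL α c (pd i f) x + 2 * (∑ j, x j * pd j (pd i f) x)
      + (2 * α + 4) * pd i f x + 2 * c ^ 2 * (x i * f x) := by
  have hf2 : ContDiff ℝ 2 f := hf.of_le (by norm_num)
  have h0 : Differentiable ℝ f := hf.differentiable (by norm_num)
  have h1 : ∀ i, Differentiable ℝ (pd i f) := fun i =>
    (contDiff_two_pd hf i).differentiable two_ne_zero
  have h2 : ∀ i j, Differentiable ℝ (pd i (pd j f)) := fun i j =>
    (contDiff_one_pd (contDiff_two_pd hf j) i).differentiable one_ne_zero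
  have c2 : ∀ i j, pd i (pd j f) = pd j (pd i f) := fun i j => pd_comm hf2 i j
  have c3 : ∀ i j k, pd i (pd j (pd k f)) = pd j (pd i (pd k f)) := fun i j k =>
    pd_comm (contDiff_two_pd hf k) i j
  fin_cases i
  all_goals
    simp only [Fin.zero_eta, Fin.mk_one, Fin.reduceFinMk, expandedSL_expand hf2]
    simp only [expandedSL, Fin.sum_univ_three]
    simp (disch := fun_prop) only [pd_add, pd_neg, pd_mul, pd_coord, pd_const]
    simp only [c2 1 0, c2 2 0, c2 2 1, c3 1 0, c3 2 0, c3 2 1, norm_sq_eq]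
    simp
    ring

theorem expandedSL_sub {α c : ℝ} {f g : E3 → ℝ} (hf : ContDiff ℝ 2 f) (hg : ContDiff ℝ 2 g)
    (x : E3) :
    expandedSL α c (fun y => f y - g y) x = expandedSL α c f x - expandedSL α c g x := by
  have f0 : Differentiable ℝ f := hf.differentiable two_ne_zero
  have g0 : Differentiable ℝ g := hg.differentiable two_ne_zero
  have f1 : ∀ i, Differentiable ℝ (pd i f) := fun i =>
    (contDiff_one_pd hf i).differentiable one_ne_zero
  have g1 : ∀ i, Differentiable ℝ (pd i g) := fun i =>
    (contDiff_one_pd hg i).differentiable one_ne_zero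
  simp only [expandedSL, Fin.sum_univ_three]
  simp (disch := fun_prop) only [pd_sub]
  ring

theorem expandedSL_coord_mul {α c : ℝ} {g : E3 → ℝ} (hg : ContDiff ℝ 2 g) (j : Fin 3) (x : E3) :
    expandedSL α c (fun y => y j * g y) x = x j * expandedSL α c g x - 2 * pd j g x
      + 2 * x j * (∑ i, x i * pd i g x) + (2 * α + 4) * (x j * g x) := by
  have g0 : Differentiable ℝ g := hg.differentiable two_ne_zero
  have g1 : ∀ i, Differentiable ℝ (pd i g) := fun i =>
    (contDiff_one_pd hg i).differentiable one_ne_zero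
  simp only [expandedSL, Fin.sum_univ_three]
  simp (disch := fun_prop) only [pd_add, pd_mul, pd_coord, pd_const]
  fin_cases j <;> simp <;> ring

/-- The rotation fields commute with the Sturm-Liouville operator. -/
theorem expandedSL_crossGrad {α c : ℝ} {f : E3 → ℝ} (hf : ContDiff ℝ 3 f) (i : Fin 3) (x : E3) :
    expandedSL α c (fun y => crossGrad f y i) x = crossGrad (expandedSL α c f) x i := by
  have hf2 : ContDiff ℝ 2 f := hf.of_le (by norm_num)
  have h2 : ∀ i, ContDiff ℝ 2 (pd i f) := contDiff_two_pd hf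
  have h3 : ∀ i j : Fin 3, ContDiff ℝ 2 (fun y => y i * pd j f y) := fun i j =>
    (by fun_prop : ContDiff ℝ 2 fun y : E3 => y i).mul (h2 j)
  have c2 : ∀ i j, pd i (pd j f) = pd j (pd i f) := fun i j => pd_comm hf2 i j
  fin_cases i
  all_goals
    simp only [Fin.zero_eta, Fin.mk_one, Fin.reduceFinMk, crossGrad_zero, crossGrad_one,
      crossGrad_two]
    -- For one product xⱼ∂ₖf the defect L(xⱼ∂ₖf) - xⱼ∂ₖ(Lf) is -2∂ⱼ∂ₖf - 2c²xⱼxₖf. It is symmetric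
    -- in j and k, so it cancels in xⱼ∂ₖ - xₖ∂ⱼ.
    rw [expandedSL_sub (h3 _ _) (h3 _ _), expandedSL_coord_mul (h2 _),
      expandedSL_coord_mul (h2 _), pd_expandedSL hf, pd_expandedSL hf]
    simp only [c2 1 0, c2 2 0, c2 2 1, Fin.sum_univ_three]
    ring

/-- The divergence of the Sturm-Liouville operator applied to a solenoidal field. -/
theorem divergence_expandedSL {α c : ℝ} {A : E3 → Fin 3 → ℝ}
    (hA : ∀ i, ContDiff ℝ 3 fun y => A y i) (hdiv : ∀ x, divergence A x = 0) (x : E3) :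
    ∑ i, pd i (expandedSL α c fun y => A y i) x = 2 * c ^ 2 * ∑ i, x i * A x i := by
  set B : Fin 3 → E3 → ℝ := fun i => pd i fun y => A y i with hB
  have hBc : ∀ i, ContDiff ℝ 2 (B i) := fun i => contDiff_two_pd (hA i) i
  have hB0 : ∀ i, Differentiable ℝ (B i) := fun i => (hBc i).differentiable two_ne_zero
  have hB1 : ∀ i j, Differentiable ℝ (pd j (B i)) := fun i j =>
    (contDiff_one_pd (hBc i) j).differentiable one_ne_zero
  -- Summing the commutator formula over i leaves L, x·∇ and the identity applied to div A, plus 2c²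
  -- x·A. Eliminating ∂₂A₂ makes the former vanish algebraically.
  have hsum : B 2 = fun y => -(B 0 y + B 1 y) := by
    funext y
    have := hdiv y
    simp only [divergence, Fin.sum_univ_three] at this
    simp only [hB]
    linarith
  have hp : ∀ i, pd i (fun y => A y i) = B i := fun i => rfl
  simp only [pd_expandedSL (hA _), hp, Fin.sum_univ_three]
  rw [hsum]
  simp only [expandedSL, Fin.sum_univ_three]
  simp (disch := fun_prop) only [pd_neg, pd_add]
  ring

/-! ### Rotation-invariant functions -/

theorem hasCompactSupport_pd {g : E3 → ℝ} (hs : HasCompactSupport g) (i : Fin 3) :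
    HasCompactSupport (pd i g) :=
  (hs.fderiv ℝ).mono fun x hx h0 => hx (by simp [pd, h0])

theorem integral_pd_eq_zero {g : E3 → ℝ} (hg : ContDiff ℝ 1 g) (hs : HasCompactSupport g)
    (i : Fin 3) : ∫ x, pd i g x = 0 := by
  have h1 : Integrable (pd i g) := Continuous.integrable_of_hasCompactSupport
    (contDiff_pd (n := 0) (by simpa using hg) i).continuous (hasCompactSupport_pd hs i)
  have h0 : Integrable g := hg.continuous.integrable_of_hasCompactSupport hs
  have := integral_mul_fderiv_eq_neg_fderiv_mul_of_integrable (μ := (volume : Measure E3))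
    (f := fun _ : E3 => (1 : ℝ)) (g := g) (v := EuclideanSpace.single i 1)
    (by simp) (by simpa [pd] using! h1) (by simpa using h0) (by simp)
    (fun x _ => hg.differentiable one_ne_zero x)
  simpa [pd] using this

/-- Rotation fields are divergence free: xⱼ∂ₖg - xₖ∂ⱼg = ∂ₖ(xⱼg) - ∂ⱼ(xₖg) is a difference of
derivatives of compactly supported functions. -/
theorem integral_crossGrad_eq_zero {g : E3 → ℝ} (hg : ContDiff ℝ 1 g) (hs : HasCompactSupport g)
    (i : Fin 3) : ∫ x, crossGrad g x i = 0 := by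
  have hd : Differentiable ℝ g := hg.differentiable one_ne_zero
  have hxg : ∀ j, ContDiff ℝ 1 fun y : E3 => y j * g y := fun j =>
    (by fun_prop : ContDiff ℝ 1 fun y : E3 => y j).mul hg
  have hsg : ∀ j, HasCompactSupport fun y : E3 => y j * g y := fun j => hs.mul_left
  have hintegr : ∀ i j, Integrable (pd i fun y : E3 => y j * g y) := fun i j =>
    Continuous.integrable_of_hasCompactSupport
      (contDiff_pd (n := 0) (by simpa using hxg j) i).continuous (hasCompactSupport_pd (hsg j) i)
  have key : ∀ j k : Fin 3, j ≠ k →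
      ∫ x : E3, (x j * pd k g x - x k * pd j g x) = 0 := by
    intro j k hjk
    have : (fun x : E3 => x j * pd k g x - x k * pd j g x) =
        fun x => pd k (fun y => y j * g y) x - pd j (fun y => y k * g y) x := by
      funext x
      simp (disch := fun_prop) only [pd_mul, pd_coord]
      simp [hjk, hjk.symm]
    rw [this, integral_sub (hintegr _ _) (hintegr _ _), integral_pd_eq_zero (hxg _) (hsg _),
      integral_pd_eq_zero (hxg _) (hsg _), sub_zero]
  fin_cases i
  · simpa only [Fin.zero_eta, crossGrad_zero] using key 1 2 (by decide)
  · simpa only [Fin.mk_one, crossGrad_one] using key 2 0 (by decide)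
  · simpa only [Fin.reduceFinMk, crossGrad_two] using key 0 1 (by decide)

theorem crossGrad_mul {f g : E3 → ℝ} (hf : Differentiable ℝ f) (hg : Differentiable ℝ g)
    (x : E3) (i : Fin 3) :
    crossGrad (fun y => f y * g y) x i = crossGrad f x i * g x + f x * crossGrad g x i := by
  fin_cases i
  all_goals
    simp only [Fin.zero_eta, Fin.mk_one, Fin.reduceFinMk, crossGrad_zero, crossGrad_one,
      crossGrad_two]
    simp (disch := fun_prop) only [pd_mul]
    ring

theorem differentiable_norm_sq : Differentiable ℝ fun y : E3 => ‖y‖ ^ 2 :=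
  (contDiff_norm_sq ℝ (n := 1)).differentiable one_ne_zero

/-- Rotation fields annihilate radial functions. -/
theorem crossGrad_radial {h : ℝ → ℝ} {x : E3} (hh : DifferentiableAt ℝ h (‖x‖ ^ 2)) (i : Fin 3) :
    crossGrad (fun y => h (‖y‖ ^ 2)) x i = 0 := by
  have key : ∀ i, pd i (fun y : E3 => h (‖y‖ ^ 2)) x = deriv h (‖x‖ ^ 2) * (2 * x i) := fun i => by
    rw [pd_comp (g := fun y => ‖y‖ ^ 2) hh.hasDerivAt (differentiable_norm_sq x), pd_norm_sq]
  fin_cases i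
  all_goals
    simp only [Fin.zero_eta, Fin.mk_one, Fin.reduceFinMk, crossGrad_zero, crossGrad_one,
      crossGrad_two, key]
    ring

/-- If `Δ₀ f = 0` in the open ball then `f` is invariant under rotations. -/
theorem crossGrad_eq_zero_of_laplaceBeltrami {f : E3 → ℝ} (hf : ContDiffOn ℝ 2 f oball)
    (h0 : ∀ x ∈ oball, laplaceBeltrami f x = 0) : ∀ x ∈ oball, crossGrad f x = 0 := by
  intro x hx
  rw [mem_oball_iff] at hx
  obtain ⟨R, hxR, hR1⟩ := exists_between hx
  have hR : 0 < R := (norm_nonneg x).trans_lt hxR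
  obtain ⟨g, hg, hgf⟩ := exists_contDiff_eqOn ENat.LEInfty.out hf hR hR1
  have hev : ∀ y : E3, ‖y‖ < R → g =ᶠ[𝓝 y] f := fun y hy => by
    filter_upwards [(isOpen_lt continuous_norm continuous_const).mem_nhds hy] with z hz
    exact hgf z hz
  have hg0 : ∀ y : E3, ‖y‖ < R → laplaceBeltrami g y = 0 := fun y hy => by
    rw [laplaceBeltrami_congr (hev y hy), h0 y (mem_oball_iff.2 (hy.trans hR1))]
  -- A radial cutoff, positive exactly for |y| < R. Being radial, it is killed by the rotation
  -- fields and contributes no derivative terms below.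
  let h : ℝ → ℝ := fun t => Real.smoothTransition (R ^ 2 - t)
  have hh : ContDiff ℝ ∞ h := Real.smoothTransition.contDiff.comp (by fun_prop)
  let η : E3 → ℝ := fun y => h (‖y‖ ^ 2)
  have hη : ContDiff ℝ ∞ η := hh.comp (contDiff_norm_sq ℝ)
  have hη0 : ∀ y, R ≤ ‖y‖ → η y = 0 := fun y hy =>
    Real.smoothTransition.zero_of_nonpos (by nlinarith)
  have hηs : HasCompactSupport η := by
    refine HasCompactSupport.intro (isCompact_closedBall (0 : E3) R) fun y hy => hη0 y ?_
    simp only [Metric.mem_closedBall, dist_zero_right, not_le] at hy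
    exact hy.le
  have hX : ∀ i, ContDiff ℝ 1 fun y => crossGrad g y i := fun i =>
    contDiff_crossGrad (n := 1) (by norm_num; exact hg) i
  have hXd : ∀ i, Differentiable ℝ fun y => crossGrad g y i := fun i =>
    (hX i).differentiable one_ne_zero
  have hgd : Differentiable ℝ g := hg.differentiable two_ne_zero
  have hηd : Differentiable ℝ η := hη.differentiable (by simp)
  -- Σ Xᵢ(η g Xᵢg) = η Σ (Xᵢg)² + η g Δ₀g. The left side integrates to zero and the last term
  -- vanishes on the support of η, so the nonnegative middle term is zero.
  let G : Fin 3 → E3 → ℝ := fun i y => η y * (g y * crossGrad g y i)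
  have hG : ∀ i, ContDiff ℝ 1 (G i) := fun i =>
    (hη.of_le (by exact_mod_cast le_top)).mul ((hg.of_le (by norm_num)).mul (hX i))
  have hGs : ∀ i, HasCompactSupport (G i) := fun i => hηs.mul_right
  have hXG : ∀ y, ∑ i, crossGrad (G i) y i = η y * ∑ i, crossGrad g y i ^ 2 := by
    intro y
    have e : ∀ i, crossGrad (G i) y i = η y * crossGrad g y i ^ 2 +
        η y * g y * crossGrad (fun z => crossGrad g z i) y i := by
      intro i
      have := hXd i
      rw [crossGrad_mul hηd (by fun_prop), crossGrad_radial (hh.differentiable (by simp) _),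
        crossGrad_mul hgd (hXd i)]
      ring
    simp only [e, Finset.sum_add_distrib, ← Finset.mul_sum]
    have : η y * g y * ∑ i, crossGrad (fun z => crossGrad g z i) y i = 0 := by
      rcases lt_or_ge ‖y‖ R with hy | hy
      · have := hg0 y hy
        rw [laplaceBeltrami] at this
        rw [this, mul_zero]
      · rw [hη0 y hy, zero_mul, zero_mul]
    rw [this, add_zero]
  have hintegr : ∫ y, η y * ∑ i, crossGrad g y i ^ 2 = 0 := by
    simp only [← hXG]
    rw [integral_finsetSum]
    · exact Finset.sum_eq_zero fun i _ => integral_crossGrad_eq_zero (hG i) (hGs i) i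
    · intro i _
      refine Continuous.integrable_of_hasCompactSupport
        (contDiff_crossGrad (n := 0) (by simpa using hG i) i).continuous ?_
      refine HasCompactSupport.intro (isCompact_closedBall (0 : E3) R) fun y hy => ?_
      simp only [Metric.mem_closedBall, dist_zero_right, not_le] at hy
      have hev0 : G i =ᶠ[𝓝 y] fun _ => 0 := by
        filter_upwards [(isOpen_lt continuous_const continuous_norm).mem_nhds hy] with z hz
        simp only [G, hη0 z (le_of_lt hz), zero_mul]
      rw [(crossGrad_eventuallyEq hev0).self_of_nhds]
      have : pd 0 (fun _ : E3 => (0 : ℝ)) y = 0 ∧ pd 1 (fun _ : E3 => (0 : ℝ)) y = 0 ∧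
        pd 2 (fun _ : E3 => (0 : ℝ)) y = 0 := by simp [pd_const]
      fin_cases i <;> simp [crossGrad_zero, crossGrad_one, crossGrad_two, this]
  have hcont : Continuous fun y => η y * ∑ i, crossGrad g y i ^ 2 := by
    have h1 := hη.continuous
    have h2 : ∀ i, Continuous fun y => crossGrad g y i := fun i => (hX i).continuous
    fun_prop
  have hnonneg : (0 : E3 → ℝ) ≤ fun y => η y * ∑ i, crossGrad g y i ^ 2 := fun y =>
    mul_nonneg (Real.smoothTransition.nonneg _) (Finset.sum_nonneg fun i _ => sq_nonneg _)
  rw [integral_eq_zero_iff_of_nonneg hnonneg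
    (hcont.integrable_of_hasCompactSupport hηs.mul_right)] at hintegr
  replace hintegr := (hcont.ae_eq_iff_eq volume continuous_zero).1 hintegr
  have hx0 := congrFun hintegr x
  have hηx : 0 < η x := Real.smoothTransition.pos_of_pos (by
    have := norm_nonneg x; nlinarith)
  have hs : ∑ i, crossGrad g x i ^ 2 = 0 := by
    simpa [hηx.ne'] using hx0
  rw [Finset.sum_eq_zero_iff_of_nonneg fun i _ => sq_nonneg _] at hs
  rw [← (crossGrad_eventuallyEq (hev x hxR)).self_of_nhds]
  ext i
  simpa using hs i (Finset.mem_univ i)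

/-- If `c ≠ 0`, no nonzero field `∇ × (x × ∇)E` is an eigenfunction. -/
theorem curl_crossGrad_eq_zero {α c : ℝ} (hc : c ≠ 0) {E : E3 → ℝ} {μ : ℝ}
    (hE : ContDiffOn ℝ 5 E oball)
    (heig : ∀ x ∈ oball, vecSturmLiouville α c (curl (crossGrad E)) x = μ • curl (crossGrad E) x) :
    ∀ x ∈ oball, curl (crossGrad E) x = 0 := by
  have hLB : ∀ x ∈ oball, laplaceBeltrami E x = 0 := by
    intro x hx
    -- Of the five derivatives of E, two go into A = ∇ × (x × ∇)E and three into the divergence of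
    -- LA.
    obtain ⟨g, hg, hgE⟩ := exists_contDiff_eventuallyEq ENat.LEInfty.out hE hx
    let A := curl (crossGrad g)
    have hX : ∀ i, ContDiff ℝ 4 fun y => crossGrad g y i := fun i =>
      contDiff_crossGrad (by norm_num; exact hg) i
    have hA : ∀ i, ContDiff ℝ 3 fun y => A y i := fun i =>
      contDiff_curl (fun j => by norm_num; exact hX j) i
    have hdiv : ∀ y, divergence A y = 0 :=
      divergence_curl fun i => (hX i).of_le (by norm_num)
    have hev : ∀ i, (expandedSL α c fun y => A y i) =ᶠ[𝓝 x] fun y => μ * A y i := by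
      intro i
      filter_upwards [hgE.eventuallyEq_nhds, isOpen_oball.mem_nhds hx] with y hy hyb
      have hc := curl_eventuallyEq (crossGrad_eventuallyEq hy)
      have h1 := congrFun (heig y hyb) i
      rw [vecSturmLiouville, ← sturmLiouville_congr (f := fun z => A z i)
        (hc.mono fun z hz => congrFun hz i),
        sturmLiouville_eq ((hA i).of_le (by norm_num)) hyb] at h1
      rw [h1, ← hc.self_of_nhds]
      rfl
    have hAd : ∀ i, Differentiable ℝ fun y => A y i := fun i =>
      (hA i).differentiable three_ne_zero
    have h1 := divergence_expandedSL (α := α) (c := c) hA hdiv x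
    have h2 : ∑ i, pd i (expandedSL α c fun y => A y i) x = 0 := by
      have : ∀ i, pd i (expandedSL α c fun y => A y i) x = μ * pd i (fun y => A y i) x := by
        intro i
        rw [(pd_eventuallyEq (hev i)).self_of_nhds]
        have := hAd i
        simp (disch := fun_prop) only [pd_mul, pd_const]
        ring
      simp only [this, ← Finset.mul_sum]
      rw [show ∑ i, pd i (fun y => A y i) x = 0 from hdiv x, mul_zero]
    rw [h2, radial_curl_crossGrad] at h1
    rw [← laplaceBeltrami_congr hgE]
    have : 2 * c ^ 2 ≠ 0 := by positivity
    simpa [this, hc] using h1.symm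
  have hX0 := crossGrad_eq_zero_of_laplaceBeltrami (hE.of_le (by norm_num)) hLB
  intro x hx
  have hev : crossGrad E =ᶠ[𝓝 x] fun _ => 0 := by
    filter_upwards [isOpen_oball.mem_nhds hx] with y hy
    exact hX0 y hy
  rw [(curl_eventuallyEq hev).self_of_nhds]
  ext i
  fin_cases i <;> simp [curl, pd_const]

/-! ### The weighted measure on the ball -/

/-- The factor (1-r)^α carries the singularity at 1 and is integrable exactly because α > -1;
(1+r)^α is continuous on [0,1]. -/
theorem intervalIntegrable_weight {α : ℝ} (hα : -1 < α) :
    IntervalIntegrable (fun r : ℝ => (1 - r ^ 2) ^ α) volume 0 1 := by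
  have h1 : IntervalIntegrable (fun r : ℝ => (1 - r) ^ α) volume 0 1 := by
    have := (intervalIntegral.intervalIntegrable_rpow' hα (a := 0) (b := 1)).comp_sub_left 1
    simpa using this.symm
  have h2 : ContinuousOn (fun r : ℝ => (1 + r) ^ α) (Set.uIcc 0 1) := by
    refine ContinuousOn.rpow_const (by fun_prop) fun r hr => Or.inl ?_
    rw [Set.uIcc_of_le zero_le_one] at hr
    linarith [hr.1]
  refine (h1.mul_continuousOn h2).congr fun r hr => ?_
  rw [Set.uIoc_of_le zero_le_one] at hr
  rw [← Real.mul_rpow (by linarith [hr.2]) (by linarith [hr.1])]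
  congr 1
  ring

theorem integrableOn_ball_weight {α : ℝ} (hα : -1 < α) :
    IntegrableOn (fun x : E3 => (1 - ‖x‖ ^ 2) ^ α) cball := by
  have hb : IntegrableOn (fun x : E3 => (1 - ‖x‖ ^ 2) ^ α) oball := by
    rw [oball, integrableOn_fun_norm_addHaar volume (f := fun r => (1 - r ^ 2) ^ α)]
    have h := (intervalIntegrable_weight hα).continuousOn_mul
      (g := fun y : ℝ => y ^ (Module.finrank ℝ E3 - 1)) (by fun_prop)
    rw [intervalIntegrable_iff_integrableOn_Ioo_of_le zero_le_one] at h
    exact h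
  refine hb.congr_set_ae ?_
  have h0 : volume (Metric.sphere (0 : E3) 1) = 0 := Measure.addHaar_sphere _ _ _
  have : cball = oball ∪ Metric.sphere 0 1 := Metric.ball_union_sphere.symm
  rw [this]
  exact union_ae_eq_left_of_ae_eq_empty (ae_eq_empty.2 h0)

theorem isFiniteMeasure_ballMeasure {α : ℝ} (hα : -1 < α) : IsFiniteMeasure (ballMeasure α) :=
  isFiniteMeasure_withDensity_ofReal (integrableOn_ball_weight hα).2

theorem measurable_weight (α : ℝ) : Measurable fun x : E3 => (1 - ‖x‖ ^ 2) ^ α := by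
  fun_prop

theorem integral_ballMeasure (α : ℝ) (f : E3 → ℝ) :
    ∫ x, f x ∂(ballMeasure α) = ∫ x in cball, (1 - ‖x‖ ^ 2) ^ α * f x := by
  rw [ballMeasure, integral_withDensity_eq_integral_toReal_smul
    (measurable_weight α).ennreal_ofReal (by simp)]
  refine setIntegral_congr_fun Metric.isClosed_closedBall.measurableSet fun x hx => ?_
  have hx' : ‖x‖ ≤ 1 := mem_cball_iff.1 hx
  have : 0 ≤ (1 - ‖x‖ ^ 2) ^ α := Real.rpow_nonneg (by nlinarith [norm_nonneg x]) _
  simp only [ENNReal.toReal_ofReal this, smul_eq_mul]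

theorem ballMeasure_absolutelyContinuous (α : ℝ) : ballMeasure α ≪ volume :=
  (withDensity_absolutelyContinuous _ _).trans Measure.restrict_le_self.absolutelyContinuous

theorem ae_mem_oball (α : ℝ) : ∀ᵐ x ∂(ballMeasure α), x ∈ oball := by
  have h1 : ∀ᵐ x ∂(ballMeasure α), x ∈ cball :=
    (withDensity_absolutelyContinuous _ _).ae_le
      (ae_restrict_mem Metric.isClosed_closedBall.measurableSet)
  have h2 : ∀ᵐ x ∂(volume : Measure E3), x ∉ Metric.sphere (0 : E3) 1 :=
    measure_eq_zero_iff_ae_notMem.1 (Measure.addHaar_sphere _ _ _)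
  filter_upwards [h1, (ballMeasure_absolutelyContinuous α).ae_le h2] with x hx hx'
  rw [mem_cball_iff] at hx
  rw [mem_sphere_zero_iff_norm] at hx'
  exact mem_oball_iff.2 (lt_of_le_of_ne hx hx')

theorem ae_ne_zero (α : ℝ) : ∀ᵐ x ∂(ballMeasure α), x ≠ 0 := by
  have h2 : ∀ᵐ x ∂(volume : Measure E3), x ∉ ({0} : Set E3) :=
    measure_eq_zero_iff_ae_notMem.1 (measure_singleton 0)
  exact (ballMeasure_absolutelyContinuous α).ae_le h2

/-- The density is positive inside the ball, so there the weighted measure and Lebesgue measure have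
the same null sets, and continuity upgrades almost everywhere to everywhere. -/
theorem eqOn_zero_of_ae_eq_zero {α : ℝ} {f : E3 → ℝ} (hf : Continuous f)
    (h : f =ᵐ[ballMeasure α] 0) : ∀ x ∈ oball, f x = 0 := by
  have h1 : f =ᵐ[volume.restrict oball] 0 := by
    have h2 := (ae_withDensity_iff (measurable_weight α).ennreal_ofReal).1 h
    have h3 : ∀ᵐ x ∂(volume.restrict oball), _ :=
      (Measure.restrict_mono oball_subset_cball le_rfl).absolutelyContinuous.ae_le h2
    filter_upwards [h3, ae_restrict_mem isOpen_oball.measurableSet] with x hx hxb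
    refine hx ?_
    simpa using Real.rpow_pos_of_pos (one_sub_norm_sq_pos hxb) _
  exact Measure.eqOn_open_of_ae_eq h1 isOpen_oball hf.continuousOn continuousOn_const

theorem exists_bound_cball {f : E3 → ℝ} (hf : Continuous f) : ∃ C, ∀ x ∈ cball, |f x| ≤ C :=
  (isCompact_closedBall (0 : E3) 1).exists_bound_of_continuousOn hf.continuousOn

theorem memLp_ballMeasure {α : ℝ} (hα : -1 < α) {f : E3 → ℝ} (hf : Continuous f) (p : ENNReal) :
    MemLp f p (ballMeasure α) := by
  have := isFiniteMeasure_ballMeasure hα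
  obtain ⟨C, hC⟩ := exists_bound_cball hf
  refine MemLp.of_bound hf.aestronglyMeasurable C ?_
  filter_upwards [ae_mem_oball α] with x hx
  exact hC x (oball_subset_cball hx)

theorem integrable_ballMeasure {α : ℝ} (hα : -1 < α) {f : E3 → ℝ} (hf : Continuous f) :
    Integrable f (ballMeasure α) :=
  memLp_one_iff_integrable.1 (memLp_ballMeasure hα hf 1)

/-! ### Green's formula -/

/-- The divergence theorem for the field `m(|x|²) (ν - x ⟨x, ν⟩)`. -/
theorem integral_divergence_radial {m : ℝ → ℝ} (hm : ContDiff ℝ 1 m) {R : ℝ}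
    (hm0 : ∀ t, R ≤ t → m t = 0) {ν : Fin 3 → E3 → ℝ} (hν : ∀ i, ContDiff ℝ 1 (ν i)) :
    ∫ x : E3, (m (‖x‖ ^ 2) * (∑ i, pd i (ν i) x - ∑ i, ∑ j, x i * x j * pd i (ν j) x
      - 4 * ∑ i, x i * ν i x)
      + 2 * deriv m (‖x‖ ^ 2) * (1 - ‖x‖ ^ 2) * ∑ i, x i * ν i x) = 0 := by
  let M : E3 → ℝ := fun x => m (‖x‖ ^ 2)
  have hM : ContDiff ℝ 1 M := hm.comp (contDiff_norm_sq ℝ)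
  have hMd : Differentiable ℝ M := hM.differentiable one_ne_zero
  have hMs : HasCompactSupport M := by
    -- The maximum with 1 ensures |y|² ≥ |y| > R outside the ball.
    refine HasCompactSupport.intro (isCompact_closedBall (0 : E3) (max R 1)) fun y hy => hm0 _ ?_
    simp only [Metric.mem_closedBall, dist_zero_right, not_le] at hy
    have h1 := lt_of_le_of_lt (le_max_left _ _) hy
    have h2 := lt_of_le_of_lt (le_max_right _ _) hy
    nlinarith
  have hpM : ∀ i, pd i M = fun x => deriv m (‖x‖ ^ 2) * (2 * x i) := fun i => by
    funext x
    rw [pd_comp (g := fun y => ‖y‖ ^ 2) (hm.differentiable one_ne_zero _).hasDerivAt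
      (differentiable_norm_sq x), pd_norm_sq]
  have hνd : ∀ i, Differentiable ℝ (ν i) := fun i => (hν i).differentiable one_ne_zero
  -- The matrix 1 - xxᵀ is the principal part of -L. Its radial component carries the factor 1-|x|²,
  -- which multiplies m' in the divergence and tames the weight at the sphere.
  let Z : Fin 3 → E3 → ℝ := fun i x =>
    M x * (ν i x - x i * (x 0 * ν 0 x + x 1 * ν 1 x + x 2 * ν 2 x))
  have hc : ∀ j : Fin 3, ContDiff ℝ 1 (fun y : E3 => y j) := fun j => by fun_prop
  have hZ : ∀ i, ContDiff ℝ 1 (Z i) := fun i => by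
    have := hν 0
    have := hν 1
    have := hν 2
    have := hν i
    fun_prop
  have hZs : ∀ i, HasCompactSupport (Z i) := fun i => hMs.mul_right
  have h0 : ∫ x, ∑ i, pd i (Z i) x = 0 := by
    rw [integral_finsetSum]
    · exact Finset.sum_eq_zero fun i _ => integral_pd_eq_zero (hZ i) (hZs i) i
    · intro i _
      exact Continuous.integrable_of_hasCompactSupport
        (contDiff_pd (n := 0) (by simpa using hZ i) i).continuous (hasCompactSupport_pd (hZs i) i)
  rw [← h0]
  congr 1
  funext x
  simp only [Fin.sum_univ_three, Z]
  simp (disch := fun_prop) only [pd_mul, pd_sub, pd_add, pd_coord, hpM]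
  simp only [norm_sq_eq, M]
  simp
  ring

/-- With y = K(1-|x|²) this is the error that the cutoff at scale 1/K produces in Green's formula:
the large factor K from the derivative meets the factor 1-|x|² of the flux. The bound does not
depend on K, which permits dominated convergence. -/
theorem exists_cutoff_bound :
    ∃ C, ∀ y : ℝ, |y * deriv Real.smoothTransition (y - 1)| ≤ C := by
  have hcont : Continuous fun y : ℝ => y * deriv Real.smoothTransition (y - 1) := by
    have : Continuous (deriv Real.smoothTransition) :=
      (Real.smoothTransition.contDiff (n := 1)).continuous_deriv le_rfl
    fun_prop
  have hs : HasCompactSupport fun y : ℝ => y * deriv Real.smoothTransition (y - 1) := by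
    refine HasCompactSupport.intro (isCompact_Icc (a := (0 : ℝ)) (b := 3)) fun y hy => ?_
    simp only [Set.mem_Icc, not_and_or, not_le] at hy
    rcases hy with hy | hy
    · have : Real.smoothTransition =ᶠ[𝓝 (y - 1)] fun _ => 0 := by
        filter_upwards [Iio_mem_nhds (show y - 1 < 0 by linarith)] with z hz
        exact Real.smoothTransition.zero_of_nonpos (le_of_lt hz)
      simp [this.deriv_eq]
    · have : Real.smoothTransition =ᶠ[𝓝 (y - 1)] fun _ => 1 := by
        filter_upwards [Ioi_mem_nhds (show 1 < y - 1 by linarith)] with z hz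
        exact Real.smoothTransition.one_of_one_le (le_of_lt hz)
      simp [this.deriv_eq]
  obtain ⟨C, hC⟩ := hs.exists_bound_of_continuous hcont
  exact ⟨C, hC⟩

/-- Green's formula with a cutoff near the unit sphere. -/
theorem integral_green_cutoff (α : ℝ) {ν : Fin 3 → E3 → ℝ} (hν : ∀ i, ContDiff ℝ 1 (ν i))
    {K : ℝ} (hK : 0 < K) :
    ∫ x, (Real.smoothTransition (K * (1 - ‖x‖ ^ 2) - 1) *
        (∑ i, pd i (ν i) x - ∑ i, ∑ j, x i * x j * pd i (ν j) x
          - (2 * α + 4) * ∑ i, x i * ν i x)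
      - 2 * (K * (1 - ‖x‖ ^ 2) * deriv Real.smoothTransition (K * (1 - ‖x‖ ^ 2) - 1))
        * ∑ i, x i * ν i x) ∂(ballMeasure α) = 0 := by
  -- The cutoff is 1 where K(1-t) ≥ 2 and 0 where K(1-t) ≤ 1, so m = S(t)(1-t)^α is C¹ although
  -- (1-t)^α may be singular at t = 1.
  let S : ℝ → ℝ := fun t => Real.smoothTransition (K * (1 - t) - 1)
  let m : ℝ → ℝ := fun t => S t * (1 - t) ^ α
  have hS : ContDiff ℝ 1 S := (Real.smoothTransition.contDiff (n := 1)).comp (by fun_prop)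
  have hS0 : ∀ t, 1 - 1 / K ≤ t → S t = 0 := fun t ht => by
    refine Real.smoothTransition.zero_of_nonpos ?_
    have : K * (1 - t) ≤ K * (1 / K) := by gcongr; linarith
    rw [mul_one_div_cancel hK.ne'] at this
    linarith
  have hm0 : ∀ t, 1 - 1 / K ≤ t → m t = 0 := fun t ht => by simp only [m, hS0 t ht, zero_mul]
  have hK' : 0 < 1 / K := by positivity
  have hev : ∀ t, 1 - 1 / K < t → m =ᶠ[𝓝 t] fun _ => 0 := fun t ht => by
    filter_upwards [Ioi_mem_nhds ht] with s hs
    exact hm0 s (le_of_lt hs)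
  have hm : ContDiff ℝ 1 m := by
    refine contDiff_iff_contDiffAt.2 fun t => ?_
    rcases lt_or_ge t 1 with ht | ht
    · refine hS.contDiffAt.mul ?_
      exact ContDiffAt.rpow_const_of_ne (by fun_prop) (by linarith)
    · exact contDiffAt_const.congr_of_eventuallyEq (hev t (by linarith))
  have hderiv : ∀ t < 1, deriv m t * (1 - t) = (1 - t) ^ α *
      (-(K * (1 - t) * deriv Real.smoothTransition (K * (1 - t) - 1)) - α * S t) := by
    intro t ht
    have hpos : 0 < 1 - t := by linarith
    have h1 : HasDerivAt S (deriv Real.smoothTransition (K * (1 - t) - 1) * (K * (-1))) t := by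
      have hd : HasDerivAt (fun t => K * (1 - t) - 1) (K * (-1)) t := by
        have := (((hasDerivAt_id t).const_sub 1).const_mul K).sub_const 1
        simpa using this
      exact ((Real.smoothTransition.contDiff (n := 1)).differentiable one_ne_zero
        _).hasDerivAt.comp t hd
    have h2 : HasDerivAt (fun t : ℝ => (1 - t) ^ α) (-1 * α * (1 - t) ^ (α - 1)) t :=
      ((hasDerivAt_id t).const_sub 1).rpow_const (Or.inl hpos.ne')
    have h3 : HasDerivAt m _ t := h1.mul h2
    rw [h3.deriv, Real.rpow_sub_one hpos.ne']
    field_simp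
    ring
  have hzero := integral_divergence_radial hm hm0 hν
  rw [integral_ballMeasure, ← hzero, setIntegral_eq_integral_of_forall_compl_eq_zero]
  · congr 1
    funext x
    rcases lt_or_ge (‖x‖ ^ 2) 1 with hx | hx
    · have := hderiv _ hx
      rw [mul_assoc 2 (deriv m _), this]
      simp only [m, S]
      ring
    · have h1 : m (‖x‖ ^ 2) = 0 := hm0 _ (by linarith)
      have h2 : deriv m (‖x‖ ^ 2) = 0 := by
        rw [(hev _ (by linarith)).deriv_eq]; simp
      have h3 : Real.smoothTransition (K * (1 - ‖x‖ ^ 2) - 1) = 0 := hS0 _ (by linarith)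
      have h4 : deriv Real.smoothTransition (K * (1 - ‖x‖ ^ 2) - 1) = 0 := by
        have : Real.smoothTransition =ᶠ[𝓝 (K * (1 - ‖x‖ ^ 2) - 1)] fun _ => 0 := by
          filter_upwards [Iio_mem_nhds (show K * (1 - ‖x‖ ^ 2) - 1 < 0 by nlinarith)] with z hz
          exact Real.smoothTransition.zero_of_nonpos (le_of_lt hz)
        simp [this.deriv_eq]
      rw [h1, h2, h3, h4]
      ring
  · intro x hx
    have hx' : 1 < ‖x‖ := by simpa [mem_cball_iff] using hx
    have hx2 : 1 < ‖x‖ ^ 2 := by nlinarith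
    have h3 : Real.smoothTransition (K * (1 - ‖x‖ ^ 2) - 1) = 0 := hS0 _ (by linarith)
    have h4 : deriv Real.smoothTransition (K * (1 - ‖x‖ ^ 2) - 1) = 0 := by
      have : Real.smoothTransition =ᶠ[𝓝 (K * (1 - ‖x‖ ^ 2) - 1)] fun _ => 0 := by
        filter_upwards [Iio_mem_nhds (show K * (1 - ‖x‖ ^ 2) - 1 < 0 by nlinarith)] with z hz
        exact Real.smoothTransition.zero_of_nonpos (le_of_lt hz)
      simp [this.deriv_eq]
    rw [h3, h4]
    ring

/-- The integrand times the weight is the divergence of (1-|x|²)^α (ν - x⟨x,ν⟩), whose normal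
component contains (1-|x|²)^(α+1) and vanishes on the sphere. The cutoff in `integral_green_cutoff`
is removed by letting its scale tend to zero under the uniform bound. -/
theorem integral_divergence_weighted {α : ℝ} (hα : -1 < α) {ν : Fin 3 → E3 → ℝ}
    (hν : ∀ i, ContDiff ℝ 1 (ν i)) :
    ∫ x, (∑ i, pd i (ν i) x - ∑ i, ∑ j, x i * x j * pd i (ν j) x
      - (2 * α + 4) * ∑ i, x i * ν i x) ∂(ballMeasure α) = 0 := by
  have := isFiniteMeasure_ballMeasure hα
  set D : E3 → ℝ := fun x => ∑ i, pd i (ν i) x - ∑ i, ∑ j, x i * x j * pd i (ν j) x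
      - (2 * α + 4) * ∑ i, x i * ν i x with hD
  set B : E3 → ℝ := fun x => ∑ i, x i * ν i x with hB
  have hν0 : ∀ i, Continuous (ν i) := fun i => (hν i).continuous
  have hν1 : ∀ i j, Continuous (pd i (ν j)) := fun i j =>
    (contDiff_pd (n := 0) (by simpa using hν j) i).continuous
  have hDc : Continuous D := by fun_prop
  have hBc : Continuous B := by fun_prop
  obtain ⟨CD, hCD⟩ := exists_bound_cball hDc
  obtain ⟨CB, hCB⟩ := exists_bound_cball hBc
  obtain ⟨C, hC⟩ := exists_cutoff_bound
  have hst : Continuous Real.smoothTransition := Real.smoothTransition.continuous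
  have hst' : Continuous (deriv Real.smoothTransition) :=
    (Real.smoothTransition.contDiff (n := 1)).continuous_deriv le_rfl
  let F : ℕ → E3 → ℝ := fun k x =>
    Real.smoothTransition (((k : ℝ) + 1) * (1 - ‖x‖ ^ 2) - 1) * D x
      - 2 * (((k : ℝ) + 1) * (1 - ‖x‖ ^ 2) *
        deriv Real.smoothTransition (((k : ℝ) + 1) * (1 - ‖x‖ ^ 2) - 1)) * B x
  have hF0 : ∀ k, ∫ x, F k x ∂(ballMeasure α) = 0 := fun k =>
    integral_green_cutoff α hν (by positivity)
  have hlim : Filter.Tendsto (fun k => ∫ x, F k x ∂(ballMeasure α)) Filter.atTop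
      (𝓝 (∫ x, D x ∂(ballMeasure α))) := by
    refine tendsto_integral_of_dominated_convergence (fun _ => CD + 2 * C * CB) ?_
      (integrable_const _) ?_ ?_
    · intro k
      refine Continuous.aestronglyMeasurable ?_
      fun_prop
    · intro k
      filter_upwards [ae_mem_oball α] with x hx
      have h1 := hCD x (oball_subset_cball hx)
      have h2 := hCB x (oball_subset_cball hx)
      have h3 := hC (((k : ℝ) + 1) * (1 - ‖x‖ ^ 2))
      have h4 := Real.smoothTransition.nonneg (((k : ℝ) + 1) * (1 - ‖x‖ ^ 2) - 1)
      have h5 := Real.smoothTransition.le_one (((k : ℝ) + 1) * (1 - ‖x‖ ^ 2) - 1)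
      refine (norm_sub_le _ _).trans (add_le_add ?_ ?_)
      · rw [norm_mul, Real.norm_eq_abs, Real.norm_eq_abs, abs_of_nonneg h4]
        calc _ ≤ 1 * |D x| := by gcongr
          _ ≤ CD := by linarith
      · rw [norm_mul, norm_mul, Real.norm_eq_abs, Real.norm_eq_abs, Real.norm_eq_abs, abs_two]
        have hC0 : 0 ≤ C := (abs_nonneg _).trans h3
        gcongr
    · filter_upwards [ae_mem_oball α] with x hx
      have hpos := one_sub_norm_sq_pos hx
      refine tendsto_const_nhds.congr' ?_
      have hlarge : ∀ᶠ k : ℕ in Filter.atTop, 2 < ((k : ℝ) + 1) * (1 - ‖x‖ ^ 2) := by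
        have : Filter.Tendsto (fun k : ℕ => ((k : ℝ) + 1) * (1 - ‖x‖ ^ 2)) Filter.atTop
            Filter.atTop :=
          (Filter.tendsto_atTop_add_const_right _ _
            tendsto_natCast_atTop_atTop).atTop_mul_const hpos
        exact this.eventually_gt_atTop 2
      filter_upwards [hlarge] with k hk
      have h1 : Real.smoothTransition (((k : ℝ) + 1) * (1 - ‖x‖ ^ 2) - 1) = 1 :=
        Real.smoothTransition.one_of_one_le (by linarith)
      have h2 : deriv Real.smoothTransition (((k : ℝ) + 1) * (1 - ‖x‖ ^ 2) - 1) = 0 := by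
        have : Real.smoothTransition =ᶠ[𝓝 (((k : ℝ) + 1) * (1 - ‖x‖ ^ 2) - 1)] fun _ => 1 := by
          filter_upwards [Ioi_mem_nhds
            (show 1 < ((k : ℝ) + 1) * (1 - ‖x‖ ^ 2) - 1 by linarith)] with z hz
          exact Real.smoothTransition.one_of_one_le (le_of_lt hz)
        simp [this.deriv_eq]
      simp only [F, h1, h2]
      ring
  simp only [hF0] at hlim
  exact (tendsto_nhds_unique tendsto_const_nhds hlim).symm

/-- The Sturm-Liouville operator is symmetric for the weighted measure on the ball. -/
theorem integral_expandedSL_mul {α c : ℝ} (hα : -1 < α) {u v : E3 → ℝ} (hu : ContDiff ℝ 2 u)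
    (hv : ContDiff ℝ 2 v) :
    ∫ x, expandedSL α c u x * v x ∂(ballMeasure α) =
      ∫ x, u x * expandedSL α c v x ∂(ballMeasure α) := by
  have hu1 := hu.of_le (show (1 : WithTop ℕ∞) ≤ 2 by norm_num)
  have hv1 := hv.of_le (show (1 : WithTop ℕ∞) ≤ 2 by norm_num)
  have u0 : Differentiable ℝ u := hu.differentiable two_ne_zero
  have v0 : Differentiable ℝ v := hv.differentiable two_ne_zero
  have u1 : ∀ i, Differentiable ℝ (pd i u) := fun i =>
    (contDiff_one_pd hu i).differentiable one_ne_zero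
  have v1 : ∀ i, Differentiable ℝ (pd i v) := fun i =>
    (contDiff_one_pd hv i).differentiable one_ne_zero
  -- For ν = u∇v - v∇u the integrand of the weighted divergence theorem equals (Lu)v - u(Lv); the
  -- zero-order terms cancel.
  have h := integral_divergence_weighted hα (ν := fun i y => u y * pd i v y - v y * pd i u y)
    fun i => (hu1.mul (contDiff_one_pd hv i)).sub (hv1.mul (contDiff_one_pd hu i))
  have hLu := continuous_expandedSL (α := α) (c := c) hu
  have hLv := continuous_expandedSL (α := α) (c := c) hv
  have i1 : Integrable (fun x => expandedSL α c u x * v x) (ballMeasure α) :=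
    integrable_ballMeasure hα (hLu.mul hv.continuous)
  have i2 : Integrable (fun x => u x * expandedSL α c v x) (ballMeasure α) :=
    integrable_ballMeasure hα (hu.continuous.mul hLv)
  rw [← sub_eq_zero, ← integral_sub i1 i2, ← h]
  congr 1
  funext x
  simp only [Fin.sum_univ_three, expandedSL]
  simp (disch := fun_prop) only [pd_mul, pd_sub]
  simp only [pd_comm hu 1 0, pd_comm hu 2 0, pd_comm hu 2 1, pd_comm hv 1 0, pd_comm hv 2 0,
    pd_comm hv 2 1]
  ring

/-! ### Integral transforms with trigonometric kernel -/

/-- The function `a cos (c s) + b sin (c s)`. -/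
noncomputable def trigKernel (a b c s : ℝ) : ℝ := a * Real.cos (c * s) + b * Real.sin (c * s)

theorem hasDerivAt_trigKernel (a b c s : ℝ) :
    HasDerivAt (trigKernel a b c) (trigKernel (b * c) (-(a * c)) c s) s := by
  have h : HasDerivAt (fun s : ℝ => c * s) c s := by simpa using (hasDerivAt_id s).const_mul c
  have := (h.cos.const_mul a).add (h.sin.const_mul b)
  refine this.congr_deriv ?_
  simp only [trigKernel]
  ring

theorem contDiff_trigKernel (a b c : ℝ) : ContDiff ℝ ∞ (trigKernel a b c) := by
  unfold trigKernel
  fun_prop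

theorem continuous_trigKernel (a b c : ℝ) : Continuous (trigKernel a b c) :=
  (contDiff_trigKernel a b c).continuous

theorem abs_trigKernel_le (a b c s : ℝ) : |trigKernel a b c s| ≤ |a| + |b| := by
  unfold trigKernel
  refine (abs_add_le _ _).trans (add_le_add ?_ ?_)
  · rw [abs_mul]; exact mul_le_of_le_one_right (abs_nonneg _) (Real.abs_cos_le_one _)
  · rw [abs_mul]; exact mul_le_of_le_one_right (abs_nonneg _) (Real.abs_sin_le_one _)

theorem trigKernel_second (a b c s : ℝ) :
    trigKernel (-(a * c) * c) (-(b * c * c)) c s = -c ^ 2 * trigKernel a b c s := by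
  unfold trigKernel
  ring

/-- The integral transform with kernel `a cos (c⟨x, τ⟩) + b sin (c⟨x, τ⟩)`. -/
noncomputable def trigTransform (α a b c : ℝ) {G : Type} [NormedAddCommGroup G] [NormedSpace ℝ G]
    (f : E3 → G) (x : E3) : G :=
  ∫ τ, trigKernel a b c (inner ℝ x τ) • f τ ∂(ballMeasure α)

section

variable {α : ℝ} {G : Type} [NormedAddCommGroup G] [NormedSpace ℝ G]

theorem integrable_trigKernel_smul {f : E3 → G} (hf : Integrable f (ballMeasure α)) (a b c : ℝ)
    (x : E3) : Integrable (fun τ => trigKernel a b c (inner ℝ x τ) • f τ) (ballMeasure α) := by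
  refine hf.bdd_smul (|a| + |b|) ?_ (Filter.Eventually.of_forall fun τ => abs_trigKernel_le _ _ _ _)
  have := continuous_trigKernel a b c
  exact Continuous.aestronglyMeasurable (by fun_prop)

theorem integrable_smulRight {f : E3 → G} (hf : Integrable f (ballMeasure α)) :
    Integrable (fun τ => (innerSL ℝ τ).smulRight (f τ)) (ballMeasure α) := by
  refine hf.norm.mono' ?_ ?_
  · exact (ContinuousLinearMap.smulRightL ℝ E3 G).aestronglyMeasurable_comp₂
      ((innerSL ℝ).continuous.aestronglyMeasurable) hf.1
  · filter_upwards [ae_mem_oball α] with τ hτ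
    rw [ContinuousLinearMap.norm_smulRight_apply, innerSL_apply_norm]
    exact mul_le_of_le_one_left (norm_nonneg _) (mem_oball_iff.1 hτ).le

/-- Differentiation under the integral is dominated because |τ| ≤ 1 on the ball. The derivative is
again a trigonometric transform, now of the operator-valued function τ ↦ ⟨τ,·⟩ f(τ). -/
theorem hasFDerivAt_trigTransform {f : E3 → G} (hf : Integrable f (ballMeasure α)) (a b c : ℝ)
    (x : E3) : HasFDerivAt (trigTransform α a b c f)
      (trigTransform α (b * c) (-(a * c)) c (fun τ => (innerSL ℝ τ).smulRight (f τ)) x) x := by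
  unfold trigTransform
  refine hasFDerivAt_integral_of_dominated_of_fderiv_le (s := Set.univ)
    (bound := fun τ => (|b * c| + |-(a * c)|) * ‖f τ‖)
    (F' := fun y τ => trigKernel (b * c) (-(a * c)) c (inner ℝ y τ) •
      (innerSL ℝ τ).smulRight (f τ)) Filter.univ_mem ?_ ?_ ?_ ?_ ?_ ?_
  · exact Filter.Eventually.of_forall fun y => (integrable_trigKernel_smul hf a b c y).1
  · exact integrable_trigKernel_smul hf a b c x
  · exact (integrable_trigKernel_smul (integrable_smulRight hf) _ _ c x).1
  · filter_upwards [ae_mem_oball α] with τ hτ y _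
    rw [norm_smul, ContinuousLinearMap.norm_smulRight_apply, innerSL_apply_norm, Real.norm_eq_abs]
    refine mul_le_mul (abs_trigKernel_le _ _ _ _) ?_ (by positivity) (by positivity)
    exact mul_le_of_le_one_left (norm_nonneg _) (mem_oball_iff.1 hτ).le
  · exact hf.norm.const_mul _
  · refine Filter.Eventually.of_forall fun τ y _ => ?_
    have h1 : HasFDerivAt (fun y : E3 => (inner ℝ y τ : ℝ)) (innerSL ℝ τ) y := by
      have : (fun y : E3 => (inner ℝ y τ : ℝ)) = innerSL ℝ τ := by
        funext y
        rw [innerSL_apply_apply, real_inner_comm]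
      rw [this]
      exact ContinuousLinearMap.hasFDerivAt _
    have h2 := ((hasDerivAt_trigKernel a b c (inner ℝ y τ)).comp_hasFDerivAt y h1).smul_const (f τ)
    refine h2.congr_fderiv ?_
    ext z
    simp [mul_smul]

/-- Each derivative is a transform with values in a larger space of linear maps, so the induction
has to quantify over the target space. -/
theorem contDiff_trigTransform_nat (N : ℕ) : ∀ {G : Type} [NormedAddCommGroup G]
    [NormedSpace ℝ G] {f : E3 → G}, Integrable f (ballMeasure α) → ∀ a b c : ℝ,
    ContDiff ℝ N (trigTransform α a b c f) := by
  induction N with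
  | zero =>
    intro G _ _ f hf a b c
    refine contDiff_zero.2 (continuous_iff_continuousAt.2 fun x => ?_)
    exact (hasFDerivAt_trigTransform hf a b c x).continuousAt
  | succ N ih =>
    intro G _ _ f hf a b c
    have := (contDiff_succ_iff_hasFDerivAt (𝕜 := ℝ) (n := N) (f := trigTransform α a b c f)).2
      ⟨_, ih (integrable_smulRight hf) (b * c) (-(a * c)) c, hasFDerivAt_trigTransform hf a b c⟩
    exact_mod_cast this

theorem contDiff_trigTransform {f : E3 → G} (hf : Integrable f (ballMeasure α)) (a b c : ℝ) :
    ContDiff ℝ ∞ (trigTransform α a b c f) :=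
  contDiff_infty.2 fun N => contDiff_trigTransform_nat N hf a b c

end

theorem integrable_coord_mul {α : ℝ} {f : E3 → ℝ} (hf : Integrable f (ballMeasure α)) (i : Fin 3) :
    Integrable (fun τ => τ i * f τ) (ballMeasure α) := by
  refine hf.bdd_mul (c := 1) (Continuous.aestronglyMeasurable (by fun_prop)) ?_
  filter_upwards [ae_mem_oball α] with τ hτ
  exact (PiLp.norm_apply_le τ i).trans (mem_oball_iff.1 hτ).le

theorem pd_trigTransform {α : ℝ} {f : E3 → ℝ} (hf : Integrable f (ballMeasure α)) (a b c : ℝ)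
    (i : Fin 3) : pd i (trigTransform α a b c f) =
      trigTransform α (b * c) (-(a * c)) c fun τ => τ i * f τ := by
  funext x
  rw [pd, (hasFDerivAt_trigTransform hf a b c x).fderiv]
  unfold trigTransform
  rw [ContinuousLinearMap.integral_apply]
  · congr 1
    funext τ
    simp [EuclideanSpace.inner_single_right]
  · exact integrable_trigKernel_smul (integrable_smulRight hf) _ _ c x

theorem inner_eq (x y : E3) : (inner ℝ x y : ℝ) = x 0 * y 0 + x 1 * y 1 + x 2 * y 2 := by
  simp [PiLp.inner_apply, Fin.sum_univ_three]
  ring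

theorem pd_trigKernel_inner (a b c : ℝ) (x : E3) (i : Fin 3) :
    pd i (fun τ : E3 => trigKernel a b c (inner ℝ x τ)) =
      fun τ => x i * trigKernel (b * c) (-(a * c)) c (inner ℝ x τ) := by
  funext τ
  have h1 : pd i (fun τ : E3 => (inner ℝ x τ : ℝ)) τ = x i := by
    simp only [inner_eq]
    simp (disch := fun_prop) only [pd_add, pd_mul, pd_const, pd_coord]
    fin_cases i <;> simp
  rw [pd_comp (g := fun τ : E3 => (inner ℝ x τ : ℝ)) (hasDerivAt_trigKernel _ _ _ _)
      (innerSL ℝ x).differentiableAt,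
    h1, mul_comm]

/-- The Sturm-Liouville operator commutes with the integral transforms. -/
theorem expandedSL_trigTransform {α : ℝ} (hα : -1 < α) (a b c : ℝ) {f : E3 → ℝ}
    (hf : ContDiff ℝ 2 f) (x : E3) :
    expandedSL α c (trigTransform α a b c f) x =
      trigTransform α a b c (expandedSL α c f) x := by
  have hfc : Continuous f := hf.continuous
  have hfi : Integrable f (ballMeasure α) := integrable_ballMeasure hα hfc
  have hxf : ∀ i, Integrable (fun τ => τ i * f τ) (ballMeasure α) := integrable_coord_mul hfi
  set κ : E3 → ℝ := fun τ => trigKernel a b c (inner ℝ x τ) with hκ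
  set κ' : E3 → ℝ := fun τ => trigKernel (b * c) (-(a * c)) c (inner ℝ x τ) with hκ'
  have hκs : ContDiff ℝ 2 κ := ((contDiff_trigKernel a b c).of_le ENat.LEInfty.out).comp
    (innerSL ℝ x).contDiff
  have hκc : Continuous κ := hκs.continuous
  have hκ'c : Continuous κ' := (continuous_trigKernel _ _ _).comp (by fun_prop)
  have hκ'd : Differentiable ℝ κ' := ((contDiff_trigKernel (b * c) (-(a * c)) c).differentiable
    (by simp)).comp (innerSL ℝ x).differentiable
  have p1 : ∀ i, pd i κ = fun τ => x i * κ' τ := pd_trigKernel_inner a b c x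
  have p2 : ∀ i, pd i κ' = fun τ => x i * (-c ^ 2 * κ τ) := fun i => by
    rw [hκ', pd_trigKernel_inner]
    simp only [trigKernel_second, hκ]
  -- The expression is symmetric in x and τ: -Δ in one variable produces the potential term c²|·|²
  -- of the other. Hence L in τ and L in x act identically on the kernel.
  have hL : ∀ τ, expandedSL α c κ τ = -(‖x‖ ^ 2 * (-c ^ 2 * κ τ))
      + (inner ℝ x τ) ^ 2 * (-c ^ 2 * κ τ) + (2 * α + 4) * ((inner ℝ x τ) * κ' τ)
      + c ^ 2 * ‖τ‖ ^ 2 * κ τ := by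
    intro τ
    simp only [expandedSL, Fin.sum_univ_three, p1]
    simp (disch := fun_prop) only [pd_mul, pd_const, p2]
    simp only [inner_eq, norm_sq_eq]
    ring
  -- Symmetry of L moves it from f onto the kernel; the integrand is then arranged as it arises from
  -- differentiating the transform in x under the integral.
  have hright : trigTransform α a b c (expandedSL α c f) x =
      ∫ τ, (-(∑ i, -c ^ 2 * κ τ * (τ i * (τ i * f τ)))
        + ∑ i, ∑ j, x i * x j * (-c ^ 2 * κ τ * (τ i * (τ j * f τ)))
        + (2 * α + 4) * ∑ i, x i * (κ' τ * (τ i * f τ))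
        + c ^ 2 * ‖x‖ ^ 2 * (κ τ * f τ)) ∂(ballMeasure α) := by
    have : trigTransform α a b c (expandedSL α c f) x =
      ∫ τ, κ τ * expandedSL α c f τ ∂(ballMeasure α) := rfl
    rw [this, ← integral_expandedSL_mul hα hκs hf]
    congr 1
    funext τ
    rw [hL]
    simp only [Fin.sum_univ_three, inner_eq, norm_sq_eq]
    ring
  have hI : ∀ {g : E3 → ℝ}, Continuous g → Integrable g (ballMeasure α) :=
    fun hg => integrable_ballMeasure hα hg
  rw [hright, integral_add (hI (by fun_prop)) (hI (by fun_prop)),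
    integral_add (hI (by fun_prop)) (hI (by fun_prop)),
    integral_add (hI (by fun_prop)) (hI (by fun_prop)), integral_neg,
    integral_finsetSum _ (fun i _ => hI (by fun_prop)),
    integral_finsetSum _ (fun i _ => hI (by fun_prop)), integral_const_mul, integral_const_mul,
    integral_finsetSum _ (fun i _ => hI (by fun_prop))]
  simp only [expandedSL, pd_trigTransform hfi, pd_trigTransform (hxf _)]
  simp only [trigTransform, trigKernel_second, smul_eq_mul]
  have e : ∀ i, ∫ τ, (∑ j, x i * x j * (-c ^ 2 * κ τ * (τ i * (τ j * f τ)))) ∂(ballMeasure α) =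
      ∑ j, x i * x j * ∫ τ, -c ^ 2 * κ τ * (τ i * (τ j * f τ)) ∂(ballMeasure α) := fun i => by
    rw [integral_finsetSum _ (fun j _ => hI (by fun_prop))]
    simp only [integral_const_mul]
  simp only [e]
  simp only [integral_const_mul]
  rfl

/-- Fubini, with the kernel bounded and symmetric in its two arguments. -/
theorem integral_trigTransform_mul {α : ℝ} (hα : -1 < α) (a b c : ℝ) {f g : E3 → ℝ}
    (hf : Integrable f (ballMeasure α)) (hg : Integrable g (ballMeasure α)) :
    ∫ x, trigTransform α a b c f x * g x ∂(ballMeasure α) =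
      ∫ x, f x * trigTransform α a b c g x ∂(ballMeasure α) := by
  have := isFiniteMeasure_ballMeasure hα
  have hintegr : Integrable (Function.uncurry fun x τ : E3 =>
      trigKernel a b c (inner ℝ x τ) * (g x * f τ)) ((ballMeasure α).prod (ballMeasure α)) := by
    refine (hg.mul_prod hf).bdd_mul (c := |a| + |b|) ?_
      (Filter.Eventually.of_forall fun p => abs_trigKernel_le _ _ _ _)
    have := continuous_trigKernel a b c
    exact Continuous.aestronglyMeasurable (by fun_prop)
  have h := integral_integral_swap hintegr
  calc _ = ∫ x, ∫ τ, trigKernel a b c (inner ℝ x τ) * (g x * f τ) ∂(ballMeasure α)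
        ∂(ballMeasure α) := by
        congr 1
        funext x
        rw [trigTransform, ← integral_mul_const]
        congr 1
        funext τ
        rw [smul_eq_mul]
        ring
    _ = _ := h
    _ = _ := by
        congr 1
        funext τ
        rw [trigTransform, ← integral_const_mul]
        congr 1
        funext x
        rw [smul_eq_mul, real_inner_comm]
        ring

/-- The real part of iⁿ e^(-ics) is Re(iⁿ) cos(cs) + Im(iⁿ) sin(cs). The factor iⁿ turns the
eigenvalues (-i)^(n+2k) λ into the real numbers (-1)^k λ, so everything can be done with a real
symmetric transform. -/
theorem trigTransform_eq_re {α : ℝ} (n : ℕ) (c : ℝ) {f : E3 → ℝ}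
    (hf : Integrable f (ballMeasure α)) (x : E3) :
    trigTransform α (Complex.I ^ n).re (Complex.I ^ n).im c f x =
      (Complex.I ^ n * finiteFourier α c f x).re := by
  have hintegr : Integrable (fun τ => Complex.I ^ n *
      (Complex.exp (-Complex.I * c * (inner ℝ x τ : ℝ)) * (f τ : ℂ))) (ballMeasure α) := by
    refine Integrable.const_mul ?_ _
    refine hf.ofReal.bdd_mul (c := 1) (Continuous.aestronglyMeasurable (by fun_prop)) ?_
    refine Filter.Eventually.of_forall fun τ => ?_
    have : -Complex.I * c * (inner ℝ x τ : ℝ) = ((-(c * inner ℝ x τ) : ℝ) : ℂ) * Complex.I := by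
      push_cast; ring
    rw [this, Complex.norm_exp_ofReal_mul_I]
  rw [finiteFourier, ← integral_const_mul]
  have := Complex.reCLM.integral_comp_comm hintegr
  simp only [Complex.reCLM_apply] at this
  rw [← this, trigTransform]
  congr 1
  funext τ
  have : -Complex.I * c * (inner ℝ x τ : ℝ) = ((-(c * inner ℝ x τ) : ℝ) : ℂ) * Complex.I := by
    push_cast; ring
  rw [this, Complex.exp_mul_I, ← Complex.ofReal_cos, ← Complex.ofReal_sin, Real.cos_neg,
    Real.sin_neg, trigKernel]
  generalize Real.cos (c * inner ℝ x τ) = C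
  generalize Real.sin (c * inner ℝ x τ) = S
  simp
  ring

theorem trigTransform_eigen {α c : ℝ} {n k : ℕ} {lam : ℝ} {f : E3 → ℝ}
    (hf : Integrable f (ballMeasure α)) {x : E3}
    (h : finiteFourier α c f x = (-Complex.I) ^ (n + 2 * k) * (lam : ℂ) * (f x : ℂ)) :
    trigTransform α (Complex.I ^ n).re (Complex.I ^ n).im c f x = (-1) ^ k * lam * f x := by
  rw [trigTransform_eq_re n c hf, h]
  have : Complex.I ^ n * ((-Complex.I) ^ (n + 2 * k) * (lam : ℂ) * (f x : ℂ)) =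
      (((-1) ^ k * lam * f x : ℝ) : ℂ) := by
    have h1 : Complex.I ^ n * (-Complex.I) ^ (n + 2 * k) = (-1) ^ k := by
      rw [pow_add, pow_mul, ← mul_assoc, ← mul_pow]
      simp
    rw [← mul_assoc, ← mul_assoc, h1]
    push_cast
    ring
  rw [this, Complex.ofReal_re]

/-! ### The radial equation -/

/-- The Sturm-Liouville operator on functions `p(|x|) Y(x/|x|)`, with `N` the eigenvalue of
`-Δ₀` belonging to `Y`. -/
noncomputable def radialSL (α c N : ℝ) (p : ℝ → ℝ) (r : ℝ) : ℝ :=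
  -(1 - r ^ 2) * deriv (deriv p) r - 2 / r * deriv p r + (2 * α + 4) * r * deriv p r
    + (N / r ^ 2 + c ^ 2 * r ^ 2) * p r

/-- A radial eigenfunction: regular up to the endpoints and not identically zero. -/
structure IsRadialEigenfunction (α c N χ : ℝ) (p : ℝ → ℝ) : Prop where
  contDiff : ContDiff ℝ 2 p
  eq : ∀ r ∈ Set.Ioo (0 : ℝ) 1, radialSL α c N p r = χ * p r
  ne_zero : ∃ r ∈ Set.Ioo (0 : ℝ) 1, p r ≠ 0

/-- The coefficient `r² (1 - r²)^(α+1)` of the radial equation. -/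
noncomputable def fluxWeight (α r : ℝ) : ℝ := r ^ 2 * (1 - r ^ 2) ^ (α + 1)

theorem continuous_fluxWeight {α : ℝ} (hα : -1 < α) : Continuous (fluxWeight α) := by
  have : Continuous fun s : ℝ => s ^ (α + 1) := Real.continuous_rpow_const (by linarith)
  unfold fluxWeight
  fun_prop

theorem one_sub_sq_pos {r : ℝ} (hr : r ∈ Set.Ioo (0 : ℝ) 1) : 0 < 1 - r ^ 2 := by
  nlinarith [hr.1, hr.2]

theorem weight_nonneg (α : ℝ) {r : ℝ} (h0 : 0 ≤ r) (h1 : r ≤ 1) : 0 ≤ (1 - r ^ 2) ^ α :=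
  Real.rpow_nonneg (by nlinarith) _

/-- Multiplying the radial operator by r²(1-r²)^α brings it into self-adjoint form. -/
theorem hasDerivAt_fluxWeight_mul {α c N : ℝ} {p : ℝ → ℝ} (hp : ContDiff ℝ 2 p) {r : ℝ}
    (hr : r ∈ Set.Ioo (0 : ℝ) 1) :
    HasDerivAt (fun r => fluxWeight α r * deriv p r)
      ((1 - r ^ 2) ^ α * ((N + c ^ 2 * r ^ 4) * p r - r ^ 2 * radialSL α c N p r)) r := by
  have hpos := one_sub_sq_pos hr
  have hr0 : r ≠ 0 := hr.1.ne'
  have h1 : HasDerivAt (fun r : ℝ => r ^ 2) (2 * r) r := by simpa using hasDerivAt_pow 2 r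
  have h2 : HasDerivAt (fun r : ℝ => (1 - r ^ 2) ^ (α + 1))
      (-(2 * r) * (α + 1) * (1 - r ^ 2) ^ (α + 1 - 1)) r :=
    (h1.const_sub 1).rpow_const (Or.inl hpos.ne')
  have hp1 : ContDiff ℝ 1 (deriv p) := ((contDiff_succ_iff_deriv (n := 1)).1
    (by norm_num; exact hp)).2.2
  have h3 : HasDerivAt (deriv p) (deriv (deriv p) r) r :=
    (hp1.differentiable one_ne_zero r).hasDerivAt
  have h := (h1.mul h2).mul h3
  refine (h.congr_deriv ?_)
  simp only [radialSL, Pi.mul_apply]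
  rw [add_sub_cancel_right, Real.rpow_add hpos, Real.rpow_one]
  field_simp
  ring

theorem intervalIntegrable_weight_mul {α : ℝ} (hα : -1 < α) {g : ℝ → ℝ} (hg : Continuous g)
    {a b : ℝ} (ha : 0 ≤ a) (hab : a ≤ b) (hb : b ≤ 1) :
    IntervalIntegrable (fun r => (1 - r ^ 2) ^ α * g r) volume a b := by
  refine ((intervalIntegrable_weight hα).mul_continuousOn hg.continuousOn).mono_set ?_
  rw [Set.uIcc_of_le hab, Set.uIcc_of_le zero_le_one]
  exact Set.Icc_subset_Icc ha hb

/-- The weak form of the radial equation. -/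
theorem IsRadialEigenfunction.weak_form {α c N χ : ℝ} (hα : -1 < α) {p : ℝ → ℝ}
    (hp : IsRadialEigenfunction α c N χ p) {f : ℝ → ℝ} (hf : ContDiff ℝ 1 f) :
    (∫ r in (0 : ℝ)..1, fluxWeight α r * (deriv f r * deriv p r))
      + (∫ r in (0 : ℝ)..1, (1 - r ^ 2) ^ α * ((N + c ^ 2 * r ^ 4) * (f r * p r)))
      = χ * ∫ r in (0 : ℝ)..1, (1 - r ^ 2) ^ α * (r ^ 2 * (f r * p r)) := by
  have hW := continuous_fluxWeight hα
  have hfc := hf.continuous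
  have hpc := hp.contDiff.continuous
  have hf1 : Continuous (deriv f) := hf.continuous_deriv le_rfl
  have hp1 : Continuous (deriv p) := hp.contDiff.continuous_deriv (by norm_num)
  have i1 : IntervalIntegrable (fun r => fluxWeight α r * (deriv f r * deriv p r)) volume 0 1 :=
    (by fun_prop : Continuous _).intervalIntegrable _ _
  have i2 : IntervalIntegrable (fun r => (1 - r ^ 2) ^ α * ((N + c ^ 2 * r ^ 4) * (f r * p r)))
      volume 0 1 :=
    intervalIntegrable_weight_mul hα (g := fun r => (N + c ^ 2 * r ^ 4) * (f r * p r))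
      (by fun_prop) le_rfl zero_le_one le_rfl
  have i3 : IntervalIntegrable (fun r => (1 - r ^ 2) ^ α * (r ^ 2 * (f r * p r))) volume 0 1 :=
    intervalIntegrable_weight_mul hα (g := fun r => r ^ 2 * (f r * p r))
      (by fun_prop) le_rfl zero_le_one le_rfl
  have key := intervalIntegral.integral_eq_sub_of_hasDerivAt_of_le zero_le_one
    (f := fun r => f r * (fluxWeight α r * deriv p r))
    (f' := fun r => fluxWeight α r * (deriv f r * deriv p r)
      + (1 - r ^ 2) ^ α * ((N + c ^ 2 * r ^ 4) * (f r * p r))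
      - χ * ((1 - r ^ 2) ^ α * (r ^ 2 * (f r * p r))))
    (by fun_prop) ?_ ((i1.add i2).sub (i3.const_mul χ))
  · rw [intervalIntegral.integral_sub (i1.add i2) (i3.const_mul χ),
      intervalIntegral.integral_add i1 i2, intervalIntegral.integral_const_mul] at key
    -- The flux weight vanishes at both endpoints, at 1 because α + 1 > 0, so no boundary terms
    -- arise.
    have e0 : fluxWeight α 0 = 0 := by simp [fluxWeight]
    have e1 : fluxWeight α 1 = 0 := by simp [fluxWeight, Real.zero_rpow (by linarith : α + 1 ≠ 0)]
    simp only [e0, e1] at key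
    linarith
  · intro r hr
    have h1 : HasDerivAt f (deriv f r) r := (hf.differentiable one_ne_zero r).hasDerivAt
    have h2 := hasDerivAt_fluxWeight_mul (α := α) (c := c) (N := N) hp.contDiff hr
    rw [hp.eq r hr] at h2
    refine (h1.mul h2).congr_deriv ?_
    ring

theorem integral_weight_sq_pos {α : ℝ} (hα : -1 < α) {f : ℝ → ℝ} (hf : Continuous f)
    (h : ∃ r ∈ Set.Ioo (0 : ℝ) 1, f r ≠ 0) :
    0 < ∫ r in (0 : ℝ)..1, (1 - r ^ 2) ^ α * (r ^ 2 * (f r * f r)) := by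
  obtain ⟨r, hr, hfr⟩ := h
  have hopen : {s | f s ≠ 0} ∩ Set.Ioo 0 1 ∈ 𝓝 r :=
    Filter.inter_mem ((isOpen_ne.preimage hf).mem_nhds hfr) (Ioo_mem_nhds hr.1 hr.2)
  obtain ⟨ε, hε, hball⟩ := Metric.mem_nhds_iff.1 hopen
  have hsub : ∀ s ∈ Set.Ioo (r - ε) (r + ε), f s ≠ 0 ∧ s ∈ Set.Ioo (0 : ℝ) 1 := fun s hs =>
    hball (by rw [Real.ball_eq_Ioo]; exact hs)
  have hsub' : ∀ s ∈ Set.Icc (r - ε / 2) (r + ε / 2), f s ≠ 0 ∧ s ∈ Set.Ioo (0 : ℝ) 1 :=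
    fun s hs => hsub s ⟨by linarith [hs.1], by linarith [hs.2]⟩
  have ha := (hsub' (r - ε / 2) ⟨le_rfl, by linarith⟩).2
  have hb := (hsub' (r + ε / 2) ⟨by linarith, le_rfl⟩).2
  have hc : Continuous fun s : ℝ => s ^ 2 * (f s * f s) := by fun_prop
  have hlt : 0 < ∫ s in (r - ε / 2)..(r + ε / 2), (1 - s ^ 2) ^ α * (s ^ 2 * (f s * f s)) := by
    refine intervalIntegral.intervalIntegral_pos_of_pos_on
      (intervalIntegrable_weight_mul hα hc ha.1.le (by linarith) hb.2.le) ?_ (by linarith)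
    intro s hs
    obtain ⟨h1, h2⟩ := hsub' s (Set.Ioo_subset_Icc_self hs)
    have h3 := Real.rpow_pos_of_pos (one_sub_sq_pos h2) α
    have h4 : 0 < f s * f s := mul_self_pos.2 h1
    have := h2.1
    positivity
  refine hlt.trans_le (intervalIntegral.integral_mono_interval ha.1.le (by linarith) hb.2.le ?_
    (intervalIntegrable_weight_mul hα hc le_rfl zero_le_one le_rfl))
  filter_upwards [ae_restrict_mem measurableSet_Ioc] with s hs
  exact mul_nonneg (weight_nonneg α hs.1.le hs.2)
    (mul_nonneg (sq_nonneg _) (mul_self_nonneg _))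

/-- Test the weak form with p itself. Since r² ≤ 1, the potential term already dominates N times the
weighted norm, so in fact χ ≥ N. -/
theorem IsRadialEigenfunction.pos {α c N χ : ℝ} (hα : -1 < α) (hN : 0 < N) {p : ℝ → ℝ}
    (hp : IsRadialEigenfunction α c N χ p) : 0 < χ := by
  have hpc := hp.contDiff.continuous
  have hA := integral_weight_sq_pos hα hpc hp.ne_zero
  have hw := hp.weak_form hα (hp.contDiff.of_le (by norm_num : (1 : WithTop ℕ∞) ≤ 2))
  have h1 : 0 ≤ ∫ r in (0 : ℝ)..1, fluxWeight α r * (deriv p r * deriv p r) := by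
    refine intervalIntegral.integral_nonneg zero_le_one fun r hr => ?_
    exact mul_nonneg (mul_nonneg (sq_nonneg _) (weight_nonneg _ hr.1 hr.2)) (mul_self_nonneg _)
  have h2 : N * (∫ r in (0 : ℝ)..1, (1 - r ^ 2) ^ α * (r ^ 2 * (p r * p r))) ≤
      ∫ r in (0 : ℝ)..1, (1 - r ^ 2) ^ α * ((N + c ^ 2 * r ^ 4) * (p r * p r)) := by
    rw [← intervalIntegral.integral_const_mul]
    refine intervalIntegral.integral_mono_on zero_le_one
      ((intervalIntegrable_weight_mul hα (g := fun r => r ^ 2 * (p r * p r)) (by fun_prop)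
        le_rfl zero_le_one le_rfl).const_mul N)
      (intervalIntegrable_weight_mul hα (g := fun r => (N + c ^ 2 * r ^ 4) * (p r * p r))
        (by fun_prop) le_rfl zero_le_one le_rfl) fun r hr => ?_
    have hw := weight_nonneg α hr.1 hr.2
    have hr2 : r ^ 2 ≤ 1 := by nlinarith [hr.1, hr.2]
    have : N * r ^ 2 ≤ N + c ^ 2 * r ^ 4 := by
      nlinarith [mul_nonneg (sq_nonneg c) (sq_nonneg (r ^ 2))]
    have h3 := mul_le_mul_of_nonneg_right this (mul_nonneg hw (mul_self_nonneg (p r)))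
    linarith
  have h3 : 0 < χ * ∫ r in (0 : ℝ)..1, (1 - r ^ 2) ^ α * (r ^ 2 * (p r * p r)) := by
    rw [← hw]
    have := mul_pos hN hA
    linarith
  exact (pos_iff_pos_of_mul_pos h3).2 hA

/-- The left side of the weak form is symmetric in the eigenfunction and the test function. -/
theorem IsRadialEigenfunction.orthogonal {α c N χ χ' : ℝ} (hα : -1 < α) {p q : ℝ → ℝ}
    (hp : IsRadialEigenfunction α c N χ p) (hq : IsRadialEigenfunction α c N χ' q) (h : χ ≠ χ') :
    ∫ r in (0 : ℝ)..1, (1 - r ^ 2) ^ α * (r ^ 2 * (p r * q r)) = 0 := by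
  have h1 := hp.weak_form hα (hq.contDiff.of_le (by norm_num : (1 : WithTop ℕ∞) ≤ 2))
  have h2 := hq.weak_form hα (hp.contDiff.of_le (by norm_num : (1 : WithTop ℕ∞) ≤ 2))
  simp only [mul_comm (q _), mul_comm (deriv q _)] at h1
  rw [h1] at h2
  have : (χ - χ') * ∫ r in (0 : ℝ)..1, (1 - r ^ 2) ^ α * (r ^ 2 * (p r * q r)) = 0 := by
    linarith
  exact (mul_eq_zero.1 this).resolve_left (sub_ne_zero.2 h)

/-- Uniqueness for the initial value problem of the radial equation inside the interval. -/
theorem eq_zero_of_radialSL {α c N χ : ℝ} {d : ℝ → ℝ} (hd : ContDiff ℝ 2 d)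
    (heq : ∀ r ∈ Set.Ioo (0 : ℝ) 1, radialSL α c N d r = χ * d r) {r₀ : ℝ}
    (hr₀ : r₀ ∈ Set.Ioo (0 : ℝ) 1) (h0 : d r₀ = 0) (h1 : deriv d r₀ = 0) :
    ∀ r ∈ Set.Ioo (0 : ℝ) 1, d r = 0 := by
  intro r hr
  obtain ⟨a, ha0, ha⟩ := exists_between (lt_min hr.1 hr₀.1)
  obtain ⟨b, hb, hb1⟩ := exists_between (max_lt hr.2 hr₀.2)
  have har := ha.trans_le (min_le_left _ _)
  have har₀ := ha.trans_le (min_le_right _ _)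
  have hbr := (le_max_left _ _).trans_lt hb
  have hbr₀ := (le_max_right _ _).trans_lt hb
  have hsub : ∀ t ∈ Set.Icc a b, t ∈ Set.Ioo (0 : ℝ) 1 := fun t ht =>
    ⟨ha0.trans_le ht.1, ht.2.trans_lt hb1⟩
  let A : ℝ → ℝ := fun t => (-(2 / t) + (2 * α + 4) * t) / (1 - t ^ 2)
  let B : ℝ → ℝ := fun t => (N / t ^ 2 + c ^ 2 * t ^ 2 - χ) / (1 - t ^ 2)
  have hA : ContinuousOn A (Set.Icc a b) := by
    refine ContinuousOn.div (.add (.neg (.div (by fun_prop) (by fun_prop) fun t ht => ?_))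
      (by fun_prop)) (by fun_prop) fun t ht => ?_
    · exact (hsub t ht).1.ne'
    · exact (one_sub_sq_pos (hsub t ht)).ne'
  have hB : ContinuousOn B (Set.Icc a b) := by
    refine ContinuousOn.div (.sub (.add (.div (by fun_prop) (by fun_prop) fun t ht => ?_)
      (by fun_prop)) (by fun_prop)) (by fun_prop) fun t ht => ?_
    · exact pow_ne_zero 2 (hsub t ht).1.ne'
    · exact (one_sub_sq_pos (hsub t ht)).ne'
  obtain ⟨CA, hCA⟩ := isCompact_Icc.exists_bound_of_continuousOn hA
  obtain ⟨CB, hCB⟩ := isCompact_Icc.exists_bound_of_continuousOn hB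
  -- First-order system for (d, d'). On [a,b] ⊂ (0,1) the coefficients are bounded, which gives the
  -- Lipschitz condition; the singular endpoints are avoided.
  let v : ℝ → ℝ × ℝ → ℝ × ℝ := fun t y => (y.2, A t * y.2 + B t * y.1)
  have hCA0 : 0 ≤ CA := (norm_nonneg _).trans (hCA a ⟨le_rfl, by linarith⟩)
  have hCB0 : 0 ≤ CB := (norm_nonneg _).trans (hCB a ⟨le_rfl, by linarith⟩)
  have hlip : ∀ t ∈ Set.Ioo a b, LipschitzOnWith (Real.toNNReal (1 + CA + CB)) (v t) Set.univ := by
    intro t ht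
    refine LipschitzOnWith.of_dist_le_mul fun y _ z _ => ?_
    rw [Real.coe_toNNReal _ (by positivity), dist_eq_norm, dist_eq_norm]
    have e : v t y - v t z = ((y - z).2, A t * (y - z).2 + B t * (y - z).1) := by
      simp only [v, Prod.mk_sub_mk, Prod.snd_sub, Prod.fst_sub]
      congr 1
      ring
    rw [e]
    set w := y - z
    have hw1 : ‖w.1‖ ≤ ‖w‖ := norm_fst_le w
    have hw2 : ‖w.2‖ ≤ ‖w‖ := norm_snd_le w
    have hA' := hCA t (Set.Ioo_subset_Icc_self ht)
    have hB' := hCB t (Set.Ioo_subset_Icc_self ht)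
    rw [Prod.norm_def]
    refine max_le ?_ ?_
    · have := mul_nonneg (add_nonneg hCA0 hCB0) (norm_nonneg w)
      simp only
      linarith
    · simp only
      calc ‖A t * w.2 + B t * w.1‖ ≤ ‖A t‖ * ‖w.2‖ + ‖B t‖ * ‖w.1‖ := by
            refine (norm_add_le _ _).trans ?_
            rw [norm_mul, norm_mul]
        _ ≤ CA * ‖w‖ + CB * ‖w‖ := by gcongr
        _ ≤ (1 + CA + CB) * ‖w‖ := by nlinarith [norm_nonneg w]
  have hd1 : ContDiff ℝ 1 (deriv d) := ((contDiff_succ_iff_deriv (n := 1)).1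
    (by norm_num; exact hd)).2.2
  have hdc := hd.continuous
  have hd1c := hd1.continuous
  have huniq := ODE_solution_unique_of_mem_Icc (v := v) (s := fun _ => Set.univ)
    (f := fun t => (d t, deriv d t)) (g := fun _ => (0, 0)) (a := a) (b := b) (t₀ := r₀)
    hlip ⟨har₀, hbr₀⟩ (by fun_prop) ?_ (by simp) (by fun_prop) ?_ (by simp) (by simp [h0, h1])
  · exact congrArg Prod.fst (huniq ⟨har.le, hbr.le⟩)
  · intro t ht
    have hti := hsub t (Set.Ioo_subset_Icc_self ht)
    have e := heq t hti
    have hpos := one_sub_sq_pos hti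
    have ht0 := hti.1.ne'
    have g1 : HasDerivAt d (deriv d t) t := (hd.differentiable two_ne_zero t).hasDerivAt
    have g2 : HasDerivAt (deriv d) (deriv (deriv d) t) t :=
      (hd1.differentiable one_ne_zero t).hasDerivAt
    refine (g1.prodMk g2).congr_deriv ?_
    simp only [v, A, B, Prod.mk.injEq, true_and]
    rw [radialSL] at e
    rw [div_mul_eq_mul_div, div_mul_eq_mul_div, ← add_div, eq_div_iff hpos.ne']
    linarith
  · intro t _
    exact (hasDerivAt_const t ((0 : ℝ), (0 : ℝ))).congr_deriv (by simp [v]; rfl)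

/-- Radial eigenfunctions with the same eigenvalue are proportional. -/
theorem IsRadialEigenfunction.proportional {α c N χ : ℝ} (hα : -1 < α) {p q : ℝ → ℝ}
    (hp : IsRadialEigenfunction α c N χ p) (hq : IsRadialEigenfunction α c N χ q) :
    ∃ C : ℝ, ∀ r ∈ Set.Ioo (0 : ℝ) 1, q r = C * p r := by
  have hW := continuous_fluxWeight hα
  have hpc := hp.contDiff.continuous
  have hqc := hq.contDiff.continuous
  have hp1 : Continuous (deriv p) := hp.contDiff.continuous_deriv (by norm_num)
  have hq1 : Continuous (deriv q) := hq.contDiff.continuous_deriv (by norm_num)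
  have hpd := hp.contDiff.differentiable two_ne_zero
  have hqd := hq.contDiff.differentiable two_ne_zero
  -- The Wronskian times the flux weight. It is constant for two solutions with the same χ and zero
  -- at r = 0, so the Wronskian vanishes inside the interval.
  let V : ℝ → ℝ := fun r => p r * (fluxWeight α r * deriv q r) - q r * (fluxWeight α r * deriv p r)
  have hVc : Continuous V := by fun_prop
  have hV : ∀ r ∈ Set.Ioo (0 : ℝ) 1, HasDerivAt V 0 r := by
    intro r hr
    have h1 := hasDerivAt_fluxWeight_mul (α := α) (c := c) (N := N) hp.contDiff hr
    have h2 := hasDerivAt_fluxWeight_mul (α := α) (c := c) (N := N) hq.contDiff hr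
    rw [hp.eq r hr] at h1
    rw [hq.eq r hr] at h2
    refine (((hpd r).hasDerivAt.mul h2).sub ((hqd r).hasDerivAt.mul h1)).congr_deriv ?_
    ring
  have hV0 : ∀ r ∈ Set.Icc (0 : ℝ) 1, V r = V 0 := by
    intro r hr
    have := intervalIntegral.integral_eq_sub_of_hasDerivAt_of_le hr.1 hVc.continuousOn
      (f' := fun _ => 0) (fun s hs => hV s ⟨hs.1, hs.2.trans_le hr.2⟩) (by simp)
    simp only [intervalIntegral.integral_zero] at this
    linarith
  have hwr : ∀ r ∈ Set.Ioo (0 : ℝ) 1, p r * deriv q r = q r * deriv p r := by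
    intro r hr
    have h := hV0 r (Set.Ioo_subset_Icc_self hr)
    have e0 : fluxWeight α 0 = 0 := by simp [fluxWeight]
    have hWr : fluxWeight α r ≠ 0 := mul_ne_zero (pow_ne_zero 2 hr.1.ne')
      (Real.rpow_pos_of_pos (one_sub_sq_pos hr) _).ne'
    simp only [V, e0] at h
    have : fluxWeight α r * (p r * deriv q r - q r * deriv p r) = 0 := by linarith
    have := (mul_eq_zero.1 this).resolve_left hWr
    linarith
  obtain ⟨r₀, hr₀, hpr₀⟩ := hp.ne_zero
  refine ⟨q r₀ / p r₀, fun r hr => ?_⟩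
  -- This constant makes q - Cp vanish at r₀. Since the Wronskian is zero, its derivative vanishes
  -- there too, and uniqueness for the initial value problem applies.
  set C := q r₀ / p r₀ with hC
  have hCp : C * p r₀ = q r₀ := div_mul_cancel₀ _ hpr₀
  have hdd : deriv (fun r => q r - C * p r) = fun r => deriv q r - C * deriv p r := by
    funext s
    exact ((hqd s).hasDerivAt.sub ((hpd s).hasDerivAt.const_mul C)).deriv
  have hp2 : Differentiable ℝ (deriv p) := (((contDiff_succ_iff_deriv (n := 1)).1
    (by norm_num; exact hp.contDiff)).2.2).differentiable one_ne_zero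
  have hq2 : Differentiable ℝ (deriv q) := (((contDiff_succ_iff_deriv (n := 1)).1
    (by norm_num; exact hq.contDiff)).2.2).differentiable one_ne_zero
  have hddd : deriv (fun r => deriv q r - C * deriv p r) =
      fun r => deriv (deriv q) r - C * deriv (deriv p) r := by
    funext s
    exact ((hq2 s).hasDerivAt.sub ((hp2 s).hasDerivAt.const_mul C)).deriv
  have hd0 := eq_zero_of_radialSL (α := α) (c := c) (N := N) (χ := χ)
    (d := fun r => q r - C * p r) (hq.contDiff.sub (contDiff_const.mul hp.contDiff)) ?_ hr₀
    (by simp [hCp]) ?_ r hr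
  · linarith
  · intro s hs
    have h1 := hp.eq s hs
    have h2 := hq.eq s hs
    simp only [radialSL, hdd, hddd] at h1 h2 ⊢
    linear_combination h2 - C * h1
  · rw [hdd]
    have := hwr r₀ hr₀
    rw [← hCp] at this
    have : p r₀ * (deriv q r₀ - C * deriv p r₀) = 0 := by linarith
    exact (mul_eq_zero.1 this).resolve_left hpr₀

/-! ### Discreteness of the radial spectrum -/

/-- A weighted Hardy inequality on an interval at whose left endpoint the function vanishes. -/
theorem hardy_interval {α : ℝ} (hα : -1 < α) {δ ε θ a b : ℝ} (hδ : 0 < δ) (hδa : δ ≤ a)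
    (hab : a < b) (hb : b ≤ 1) (hθ1 : θ ≤ 1)
    (hθ : (1 - θ) * (1 - a ^ 2) ^ (α + 1) ≤ (1 - b ^ 2) ^ (α + 1))
    (hε : θ ^ 2 * (1 - a ^ 2) ≤ ε * (α + 1) ^ 2 * δ ^ 3) {f : ℝ → ℝ} (hf : ContDiff ℝ 1 f)
    (hfa : f a = 0) :
    ∫ r in a..b, (1 - r ^ 2) ^ α * (r ^ 2 * (f r * f r)) ≤
      ε * ∫ r in a..b, fluxWeight α r * (deriv f r * deriv f r) := by
  have ha : 0 < a := hδ.trans_le hδa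
  have hβ : 0 < α + 1 := by linarith
  have hW := continuous_fluxWeight hα
  have hfc := hf.continuous
  have hf1 : Continuous (deriv f) := hf.continuous_deriv le_rfl
  have hfd := hf.differentiable one_ne_zero
  have hΦ : Continuous fun s : ℝ => s ^ (α + 1) := Real.continuous_rpow_const hβ.le
  -- S is an antiderivative of -2(α+1) r (1-r²)^α that vanishes at b. As f(a) = 0, the product S f²
  -- vanishes at both ends, and the inequality follows by bounding its derivative from above.
  let S : ℝ → ℝ := fun r => (1 - r ^ 2) ^ (α + 1) - (1 - b ^ 2) ^ (α + 1)
  have hSc : Continuous S := by fun_prop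
  have i1 : IntervalIntegrable (fun r => (1 - r ^ 2) ^ α * (r ^ 2 * (f r * f r))) volume a b :=
    intervalIntegrable_weight_mul hα (g := fun r => r ^ 2 * (f r * f r)) (by fun_prop) ha.le hab.le
      hb
  have i2 : IntervalIntegrable (fun r => fluxWeight α r * (deriv f r * deriv f r)) volume a b :=
    (by fun_prop : Continuous _).intervalIntegrable _ _
  have key := intervalIntegral.sub_le_integral_of_hasDeriv_right_of_le hab.le
    (g := fun r => S r * (f r * f r))
    (g' := fun r => -(2 * r) * (α + 1) * (1 - r ^ 2) ^ α * (f r * f r)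
      + S r * (2 * (f r * deriv f r)))
    (φ := fun r => (α + 1) * (ε * (fluxWeight α r * (deriv f r * deriv f r))
      - (1 - r ^ 2) ^ α * (r ^ 2 * (f r * f r)))) (by fun_prop) ?_ ?_ ?_
  · have hb0 : S b = 0 := by simp [S]
    simp only [hb0, hfa, zero_mul, mul_zero, sub_zero] at key
    rw [intervalIntegral.integral_const_mul, intervalIntegral.integral_sub (i2.const_mul ε) i1,
      intervalIntegral.integral_const_mul] at key
    have := nonneg_of_mul_nonneg_right key hβ
    linarith
  · intro r hr
    have hr01 : r ∈ Set.Ioo (0 : ℝ) 1 := ⟨ha.trans hr.1, hr.2.trans_le hb⟩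
    have hpos := one_sub_sq_pos hr01
    have h1 : HasDerivAt (fun r : ℝ => r ^ 2) (2 * r) r := by simpa using hasDerivAt_pow 2 r
    have h2 : HasDerivAt S (-(2 * r) * (α + 1) * (1 - r ^ 2) ^ (α + 1 - 1)) r :=
      ((h1.const_sub 1).rpow_const (Or.inl hpos.ne')).sub_const _
    rw [add_sub_cancel_right] at h2
    have h3 := (hfd r).hasDerivAt
    refine HasDerivAt.hasDerivWithinAt ((h2.mul (h3.mul h3)).congr_deriv ?_)
    simp only [Pi.mul_apply]
    ring
  · rw [← intervalIntegrable_iff_integrableOn_Icc_of_le hab.le]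
    exact ((i2.const_mul ε).sub i1).const_mul _
  · intro r hr
    have hr01 : r ∈ Set.Ioo (0 : ℝ) 1 := ⟨ha.trans hr.1, hr.2.trans_le hb⟩
    have hpos := one_sub_sq_pos hr01
    have hr0 := hr01.1
    set w := (1 - r ^ 2) ^ α with hw
    have hwpos : 0 < w := Real.rpow_pos_of_pos hpos α
    have hΦr : (1 - r ^ 2) ^ (α + 1) = w * (1 - r ^ 2) := by
      rw [Real.rpow_add hpos, Real.rpow_one]
    have har : (1 - r ^ 2) ≤ 1 - a ^ 2 := by nlinarith [hr.1]
    have hmono : (1 - r ^ 2) ^ (α + 1) ≤ (1 - a ^ 2) ^ (α + 1) :=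
      Real.rpow_le_rpow hpos.le har hβ.le
    have hbr : (1 - b ^ 2) ^ (α + 1) ≤ (1 - r ^ 2) ^ (α + 1) :=
      Real.rpow_le_rpow (by nlinarith) (by nlinarith [hr.2]) hβ.le
    have hS0 : 0 ≤ S r := by simp only [S]; linarith
    have hS1 : S r ≤ θ * (w * (1 - r ^ 2)) := by
      have : (1 - θ) * (1 - r ^ 2) ^ (α + 1) ≤ (1 - b ^ 2) ^ (α + 1) :=
        (mul_le_mul_of_nonneg_left hmono (by linarith)).trans hθ
      rw [hΦr] at this
      simp only [S, hΦr]
      linarith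
    have hSS : S r ^ 2 ≤ ε * (α + 1) ^ 2 * r ^ 3 * (w * (w * (1 - r ^ 2))) := by
      have h1 : S r ^ 2 ≤ (θ * (w * (1 - r ^ 2))) ^ 2 := by gcongr
      have h2 : θ ^ 2 * (1 - r ^ 2) ≤ ε * (α + 1) ^ 2 * r ^ 3 := by
        have h3 : θ ^ 2 * (1 - r ^ 2) ≤ θ ^ 2 * (1 - a ^ 2) := by gcongr
        have h0 : 0 ≤ ε * (α + 1) ^ 2 * δ ^ 3 :=
          le_trans (mul_nonneg (sq_nonneg _) (hpos.le.trans har)) hε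
        have hεn : 0 ≤ ε * (α + 1) ^ 2 := nonneg_of_mul_nonneg_left h0 (by positivity)
        have h4 : ε * (α + 1) ^ 2 * δ ^ 3 ≤ ε * (α + 1) ^ 2 * r ^ 3 := by
          have : δ ≤ r := hδa.trans hr.1.le
          gcongr
        linarith
      have h5 : (θ ^ 2 * (1 - r ^ 2)) * (w * (w * (1 - r ^ 2))) ≤
          (ε * (α + 1) ^ 2 * r ^ 3) * (w * (w * (1 - r ^ 2))) :=
        mul_le_mul_of_nonneg_right h2 (by positivity)
      nlinarith
    have hrw : 0 < (α + 1) * (r * w) := by positivity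
    -- The split absorbs half of the negative term -2(α+1) r w f² coming from S' and puts the rest
    -- on f'², where the hypothesis on ε applies.
    have hAMGM : S r * (2 * (f r * deriv f r)) ≤ (α + 1) * (r * w) * (f r * f r)
        + S r ^ 2 / ((α + 1) * (r * w)) * (deriv f r * deriv f r) := by
      have e : (α + 1) * (r * w) * (f r * f r)
        + S r ^ 2 / ((α + 1) * (r * w)) * (deriv f r * deriv f r)
        - S r * (2 * (f r * deriv f r)) =
        ((α + 1) * (r * w) * f r - S r * deriv f r) ^ 2 / ((α + 1) * (r * w)) := by
        field_simp
        ring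
      have : 0 ≤ ((α + 1) * (r * w) * f r - S r * deriv f r) ^ 2 / ((α + 1) * (r * w)) := by
        positivity
      linarith
    have hq : S r ^ 2 / ((α + 1) * (r * w)) ≤ (α + 1) * (ε * fluxWeight α r) := by
      rw [div_le_iff₀ hrw, fluxWeight, hΦr]
      linarith
    have hq' := mul_le_mul_of_nonneg_right hq (mul_self_nonneg (deriv f r))
    have hrr : r ^ 2 ≤ r := by nlinarith [hr01.2]
    have hlast : (α + 1) * (w * (r ^ 2 * (f r * f r))) ≤ (α + 1) * (w * (r * (f r * f r))) := by
      gcongr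
      exact mul_self_nonneg _
    linarith

/-- A function vanishing on a suitable finite set satisfies a Poincaré inequality with a small
constant, away from the origin. -/
theorem exists_finset_poincare {α : ℝ} (hα : -1 < α) {δ ε : ℝ} (hδ : 0 < δ) (hδ1 : δ < 1)
    (hε : 0 < ε) : ∃ s : Finset ℝ, ∀ f : ℝ → ℝ, ContDiff ℝ 1 f → (∀ x ∈ s, f x = 0) →
      ∫ r in δ..1, (1 - r ^ 2) ^ α * (r ^ 2 * (f r * f r)) ≤
        ε * ∫ r in δ..1, fluxWeight α r * (deriv f r * deriv f r) := by
  have hβ : 0 < α + 1 := by linarith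
  set E := ε * (α + 1) ^ 2 * δ ^ 3 with hE
  have hEpos : 0 < E := by positivity
  -- From θ < E and θ < 1 it follows that θ² ≤ E, the smallness required on every interval between
  -- nodes.
  obtain ⟨θ, hθ0, hθ⟩ := exists_between (lt_min hEpos (show (0 : ℝ) < 1 by norm_num))
  have hθE := hθ.trans_le (min_le_left _ _)
  have hθ1 := hθ.trans_le (min_le_right _ _)
  -- The nodes satisfy 1 - R i ² = q^i (1-δ²), so from one node to the next (1-r²)^(α+1) shrinks by
  -- exactly 1-θ.
  set q : ℝ := (1 - θ) ^ (1 / (α + 1)) with hq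
  have hq0 : 0 < q := Real.rpow_pos_of_pos (by linarith) _
  have hq1 : q < 1 := Real.rpow_lt_one (by linarith) (by linarith) (by positivity)
  have hqβ : q ^ (α + 1) = 1 - θ := by
    rw [hq, ← Real.rpow_mul (by linarith), one_div_mul_cancel hβ.ne', Real.rpow_one]
  have hD : 0 < 1 - δ ^ 2 := by nlinarith
  have hqi : ∀ i : ℕ, q ^ i ≤ 1 := fun i => pow_le_one₀ hq0.le hq1.le
  let R : ℕ → ℝ := fun i => √(1 - q ^ i * (1 - δ ^ 2))
  have hnn : ∀ i : ℕ, δ ^ 2 ≤ 1 - q ^ i * (1 - δ ^ 2) := fun i => by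
    have := mul_le_mul_of_nonneg_right (hqi i) hD.le
    linarith
  have hR2 : ∀ i, R i ^ 2 = 1 - q ^ i * (1 - δ ^ 2) := fun i =>
    Real.sq_sqrt ((sq_nonneg δ).trans (hnn i))
  have hR0 : R 0 = δ := by simp [R, Real.sqrt_sq hδ.le]
  have hRδ : ∀ i, δ ≤ R i := fun i => Real.le_sqrt_of_sq_le (hnn i)
  have hRlt : ∀ i, R i < R (i + 1) := fun i => by
    refine Real.sqrt_lt_sqrt ((sq_nonneg δ).trans (hnn i)) ?_
    have : q ^ (i + 1) < q ^ i := pow_lt_pow_right_of_lt_one₀ hq0 hq1 (Nat.lt_succ_self i)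
    have := mul_lt_mul_of_pos_right this hD
    linarith
  have hR1 : ∀ i, R i < 1 := fun i => by
    have h1 : R i ^ 2 < 1 := by
      rw [hR2]
      have : 0 < q ^ i * (1 - δ ^ 2) := by positivity
      linarith
    nlinarith [hδ.trans_le (hRδ i)]
  -- Once 1 - R m ² < E, the remaining interval up to 1 can be handled with θ = 1.
  obtain ⟨m, hm⟩ := exists_pow_lt_of_lt_one hEpos hq1
  refine ⟨(Finset.range (m + 1)).image R, fun f hf hf0 => ?_⟩
  have hz : ∀ i ≤ m, f (R i) = 0 := fun i hi =>
    hf0 _ (Finset.mem_image_of_mem R (Finset.mem_range.2 (Nat.lt_succ_of_le hi)))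
  have hfc := hf.continuous
  have hf1 : Continuous (deriv f) := hf.continuous_deriv le_rfl
  have hW := continuous_fluxWeight hα
  have i1 : ∀ {a b : ℝ}, 0 ≤ a → a ≤ b → b ≤ 1 →
      IntervalIntegrable (fun r => (1 - r ^ 2) ^ α * (r ^ 2 * (f r * f r))) volume a b :=
    fun h1 h2 h3 => intervalIntegrable_weight_mul hα (g := fun r => r ^ 2 * (f r * f r))
      (by fun_prop) h1 h2 h3
  have i2 : ∀ a b : ℝ,
      IntervalIntegrable (fun r => fluxWeight α r * (deriv f r * deriv f r)) volume a b :=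
    fun a b => (by fun_prop : Continuous _).intervalIntegrable _ _
  have hind : ∀ j ≤ m, ∫ r in δ..(R j), (1 - r ^ 2) ^ α * (r ^ 2 * (f r * f r)) ≤
        ε * ∫ r in δ..(R j), fluxWeight α r * (deriv f r * deriv f r) := by
    intro j
    induction j with
    | zero => intro _; rw [hR0]; simp
    | succ j ih =>
      intro hj
      have hj' : j ≤ m := (Nat.le_succ j).trans hj
      have h1 := ih hj'
      have h2 := hardy_interval hα (θ := θ) (ε := ε) hδ (hRδ j) (hRlt j) (hR1 (j + 1)).le hθ1.le (by
          rw [hR2, hR2, ← hqβ, ← Real.mul_rpow hq0.le (by rw [sub_sub_cancel]; positivity)]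
          refine le_of_eq ?_
          congr 1
          ring) (by
          rw [← hE]
          have : 1 - R j ^ 2 ≤ 1 := by nlinarith [sq_nonneg (R j)]
          have h3 : θ ^ 2 * (1 - R j ^ 2) ≤ θ ^ 2 * 1 := by gcongr
          nlinarith) hf (hz j hj')
      rw [← intervalIntegral.integral_add_adjacent_intervals (i1 hδ.le (hRδ j) (hR1 j).le)
        (i1 (hδ.le.trans (hRδ j)) (hRlt j).le (hR1 (j + 1)).le),
        ← intervalIntegral.integral_add_adjacent_intervals (i2 δ (R j)) (i2 (R j) (R (j + 1)))]
      linarith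
  have h1 := hind m le_rfl
  have h2 := hardy_interval hα (θ := 1) (ε := ε) hδ (hRδ m) (hR1 m) le_rfl le_rfl
    (by simp [Real.zero_rpow hβ.ne']) (by
      rw [← hE, hR2]
      have : q ^ m * (1 - δ ^ 2) ≤ q ^ m * 1 := by
        have := sq_nonneg δ
        gcongr
        linarith
      linarith) hf (hz m le_rfl)
  rw [← intervalIntegral.integral_add_adjacent_intervals (i1 hδ.le (hRδ m) (hR1 m).le)
    (i1 (hδ.le.trans (hRδ m)) (hR1 m).le le_rfl),
    ← intervalIntegral.integral_add_adjacent_intervals (i2 δ (R m)) (i2 (R m) 1)]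
  linarith

/-- Energy estimate for linear combinations of radial eigenfunctions. -/
theorem energy_sum_le {α c N M : ℝ} (hα : -1 < α) {p : ℕ → ℝ → ℝ} {χ : ℕ → ℝ}
    (hp : ∀ k, IsRadialEigenfunction α c N (χ k) (p k)) (hχ : Function.Injective χ)
    {S : Finset ℕ} (hS : ∀ k ∈ S, χ k ≤ M) (a : ℕ → ℝ) {f : ℝ → ℝ}
    (hf : f = fun r => ∑ k ∈ S, a k * p k r) :
    (∫ r in (0 : ℝ)..1, fluxWeight α r * (deriv f r * deriv f r))
      + (∫ r in (0 : ℝ)..1, (1 - r ^ 2) ^ α * ((N + c ^ 2 * r ^ 4) * (f r * f r)))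
      ≤ M * ∫ r in (0 : ℝ)..1, (1 - r ^ 2) ^ α * (r ^ 2 * (f r * f r)) := by
  have hpc : ∀ k, Continuous (p k) := fun k => (hp k).contDiff.continuous
  have hpd : ∀ k, Differentiable ℝ (p k) := fun k => (hp k).contDiff.differentiable two_ne_zero
  have hp1 : ∀ k, Continuous (deriv (p k)) := fun k =>
    (hp k).contDiff.continuous_deriv (by norm_num)
  have hW := continuous_fluxWeight hα
  have hfs : ContDiff ℝ 1 f := by
    rw [hf]
    exact ContDiff.sum fun k _ => contDiff_const.mul ((hp k).contDiff.of_le (by norm_num))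
  have hfc := hfs.continuous
  have hf1 : Continuous (deriv f) := hfs.continuous_deriv le_rfl
  have hderiv : ∀ r, deriv f r = ∑ k ∈ S, a k * deriv (p k) r := fun r => by
    rw [hf]
    exact (HasDerivAt.fun_sum fun k _ => ((hpd k r).hasDerivAt.const_mul (a k))).deriv
  have hI : ∀ {g : ℝ → ℝ}, Continuous g →
      IntervalIntegrable (fun r => (1 - r ^ 2) ^ α * g r) volume 0 1 := fun hg =>
    intervalIntegrable_weight_mul hα hg le_rfl zero_le_one le_rfl
  have e1 : ∫ r in (0 : ℝ)..1, fluxWeight α r * (deriv f r * deriv f r) =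
      ∑ k ∈ S, a k * ∫ r in (0 : ℝ)..1, fluxWeight α r * (deriv f r * deriv (p k) r) := by
    simp only [← intervalIntegral.integral_const_mul]
    rw [← intervalIntegral.integral_finsetSum fun k _ =>
      (by fun_prop : Continuous _).intervalIntegrable _ _]
    refine intervalIntegral.integral_congr fun r _ => ?_
    nth_rw 2 [hderiv]
    rw [Finset.mul_sum, Finset.mul_sum]
    exact Finset.sum_congr rfl fun k _ => by ring
  have e2 : ∀ g : ℝ → ℝ, Continuous g →
      ∫ r in (0 : ℝ)..1, (1 - r ^ 2) ^ α * (g r * (f r * f r)) =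
      ∑ k ∈ S, a k * ∫ r in (0 : ℝ)..1, (1 - r ^ 2) ^ α * (g r * (f r * p k r)) := by
    intro g hg
    simp only [← intervalIntegral.integral_const_mul]
    rw [← intervalIntegral.integral_finsetSum fun k _ => ?_]
    · refine intervalIntegral.integral_congr fun r _ => ?_
      have : f r * f r = ∑ k ∈ S, a k * (f r * p k r) := by
        nth_rw 2 [hf]
        simp only [Finset.mul_sum]
        exact Finset.sum_congr rfl fun k _ => by ring
      rw [this, Finset.mul_sum, Finset.mul_sum]
      exact Finset.sum_congr rfl fun k _ => by ring
    · exact (hI (g := fun r => g r * (f r * p k r)) (by fun_prop)).const_mul _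
  -- Orthogonality leaves only the diagonal term, so the energy of f becomes a sum of χ k times
  -- squared norms.
  have e3 : ∀ k ∈ S, ∫ r in (0 : ℝ)..1, (1 - r ^ 2) ^ α * (r ^ 2 * (f r * p k r)) =
      a k * ∫ r in (0 : ℝ)..1, (1 - r ^ 2) ^ α * (r ^ 2 * (p k r * p k r)) := by
    intro k hk
    have : ∫ r in (0 : ℝ)..1, (1 - r ^ 2) ^ α * (r ^ 2 * (f r * p k r)) =
        ∑ j ∈ S, a j * ∫ r in (0 : ℝ)..1, (1 - r ^ 2) ^ α * (r ^ 2 * (p j r * p k r)) := by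
      simp only [← intervalIntegral.integral_const_mul]
      rw [← intervalIntegral.integral_finsetSum fun j _ => ?_]
      · refine intervalIntegral.integral_congr fun r _ => ?_
        simp only [hf, Finset.sum_mul, Finset.mul_sum]
        exact Finset.sum_congr rfl fun j _ => by ring
      · exact (hI (g := fun r => r ^ 2 * (p j r * p k r)) (by
          have := hpc j
          have := hpc k
          fun_prop)).const_mul _
    rw [this, Finset.sum_eq_single_of_mem k hk]
    intro j _ hjk
    rw [(hp j).orthogonal hα (hp k) (hχ.ne hjk), mul_zero]
  rw [e1, e2 (fun r => N + c ^ 2 * r ^ 4) (by fun_prop), e2 (fun r => r ^ 2) (by fun_prop),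
    ← Finset.sum_add_distrib, Finset.mul_sum]
  refine Finset.sum_le_sum fun k hk => ?_
  rw [← mul_add, (hp k).weak_form hα hfs, e3 k hk]
  have hnn := integral_weight_sq_pos hα (hpc k) (hp k).ne_zero
  have h1 : 0 ≤ a k ^ 2 * ∫ r in (0 : ℝ)..1, (1 - r ^ 2) ^ α * (r ^ 2 * (p k r * p k r)) := by
    positivity
  have h2 := mul_le_mul_of_nonneg_right (hS k hk) h1
  linarith

theorem sum_ne_zero_of_orthogonal {α c N : ℝ} (hα : -1 < α) {p : ℕ → ℝ → ℝ} {χ : ℕ → ℝ}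
    (hp : ∀ k, IsRadialEigenfunction α c N (χ k) (p k)) (hχ : Function.Injective χ)
    {S : Finset ℕ} {a : ℕ → ℝ} {k : ℕ} (hk : k ∈ S) (hak : a k ≠ 0) :
    ∃ r ∈ Set.Ioo (0 : ℝ) 1, ∑ j ∈ S, a j * p j r ≠ 0 := by
  by_contra! hcon
  have hpc : ∀ k, Continuous (p k) := fun k => (hp k).contDiff.continuous
  have h0 : ∫ r in (0 : ℝ)..1, (1 - r ^ 2) ^ α * (r ^ 2 *
      ((∑ j ∈ S, a j * p j r) * p k r)) = 0 := by
    rw [intervalIntegral.integral_of_le zero_le_one, integral_Ioc_eq_integral_Ioo]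
    refine setIntegral_eq_zero_of_forall_eq_zero fun r hr => ?_
    simp [hcon r hr]
  have h1 : ∫ r in (0 : ℝ)..1, (1 - r ^ 2) ^ α * (r ^ 2 * ((∑ j ∈ S, a j * p j r) * p k r)) =
      ∑ j ∈ S, a j * ∫ r in (0 : ℝ)..1, (1 - r ^ 2) ^ α * (r ^ 2 * (p j r * p k r)) := by
    simp only [← intervalIntegral.integral_const_mul]
    rw [← intervalIntegral.integral_finsetSum fun j _ => ?_]
    · refine intervalIntegral.integral_congr fun r _ => ?_
      simp only [Finset.sum_mul, Finset.mul_sum]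
      exact Finset.sum_congr rfl fun j _ => by ring
    · exact (intervalIntegrable_weight_mul hα (g := fun r => r ^ 2 * (p j r * p k r)) (by
        have := hpc j
        have := hpc k
        fun_prop) le_rfl zero_le_one le_rfl).const_mul _
  rw [h0, Finset.sum_eq_single_of_mem k hk fun j _ hjk => by
    rw [(hp j).orthogonal hα (hp k) (hχ.ne hjk), mul_zero]] at h1
  exact mul_ne_zero hak (integral_weight_sq_pos hα (hpc k) (hp k).ne_zero).ne' h1.symm

/-- Dimension count: evaluation at the points maps the coefficient space to a space of smaller
dimension and has a kernel. -/
theorem exists_combination_vanishing (p : ℕ → ℝ → ℝ) (s : Finset ℝ) {S : Finset ℕ}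
    (hS : s.card < S.card) :
    ∃ a : ℕ → ℝ, (∃ k ∈ S, a k ≠ 0) ∧ ∀ x ∈ s, ∑ k ∈ S, a k * p k x = 0 := by
  let T : (S → ℝ) →ₗ[ℝ] (s → ℝ) :=
    LinearMap.pi fun x => ∑ k : S, p k x • LinearMap.proj k
  have hker : LinearMap.ker T ≠ ⊥ := LinearMap.ker_ne_bot_of_finrank_lt (by simpa using hS)
  obtain ⟨v, hv, hv0⟩ := (Submodule.ne_bot_iff _).1 hker
  obtain ⟨k, hk⟩ := Function.ne_iff.1 hv0
  refine ⟨fun j => if h : j ∈ S then v ⟨j, h⟩ else 0, ⟨k, k.2, by simpa using hk⟩, fun x hx => ?_⟩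
  have := congrFun (LinearMap.mem_ker.1 hv) ⟨x, hx⟩
  rw [← Finset.sum_coe_sort S]
  simpa [T, mul_comm] using this

/-- Only finitely many radial eigenvalues lie below a given bound. -/
theorem finite_setOf_radial_eigenvalue_le {α c N : ℝ} (hα : -1 < α) (hN : 0 < N)
    {p : ℕ → ℝ → ℝ} {χ : ℕ → ℝ} (hp : ∀ k, IsRadialEigenfunction α c N (χ k) (p k))
    (hχ : Function.Injective χ) (M : ℝ) : {k | χ k ≤ M}.Finite := by
  by_contra hinf
  set M' := max M 1 with hM'
  have hM1 : 0 < M' := lt_of_lt_of_le one_pos (le_max_right _ _)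
  -- On [0,δ] one has r² ≤ δ < N/(2M'), so the potential term alone bounds the norm there; the
  -- Poincaré inequality is needed only on [δ,1].
  obtain ⟨δ, hδ0, hδ⟩ := exists_between
    (lt_min (show 0 < N / (2 * M') by positivity) (show (0 : ℝ) < 1 by norm_num))
  have hδN := hδ.trans_le (min_le_left _ _)
  have hδ1 := hδ.trans_le (min_le_right _ _)
  obtain ⟨s, hs⟩ := exists_finset_poincare hα hδ0 hδ1 (show 0 < 1 / (2 * M') by positivity)
  -- One eigenfunction more than there are nodes. The combination f vanishing at the nodes has norm²
  -- at most energy/(2M'), hence at most norm²/2, which is absurd.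
  obtain ⟨S, hSsub, hScard⟩ := Set.Infinite.exists_subset_card_eq hinf (s.card + 1)
  have hSM : ∀ k ∈ S, χ k ≤ M' := fun k hk => (hSsub hk).trans (le_max_left _ _)
  obtain ⟨a, ⟨k, hk, hak⟩, ha⟩ := exists_combination_vanishing p s (S := S) (by omega)
  set f : ℝ → ℝ := fun r => ∑ k ∈ S, a k * p k r with hf
  have hfs : ContDiff ℝ 1 f :=
    ContDiff.sum fun k _ => contDiff_const.mul ((hp k).contDiff.of_le (by norm_num))
  have hfc := hfs.continuous
  have hf1 : Continuous (deriv f) := hfs.continuous_deriv le_rfl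
  have hW := continuous_fluxWeight hα
  have hpos := integral_weight_sq_pos hα hfc (sum_ne_zero_of_orthogonal hα hp hχ hk hak)
  have henergy := energy_sum_le hα hp hχ hSM a hf
  have hpoin := hs f hfs ha
  have hI : ∀ {g : ℝ → ℝ}, Continuous g → ∀ {x y : ℝ}, 0 ≤ x → x ≤ y → y ≤ 1 →
      IntervalIntegrable (fun r => (1 - r ^ 2) ^ α * g r) volume x y := fun hg _ _ h1 h2 h3 =>
    intervalIntegrable_weight_mul hα hg h1 h2 h3
  have c1 : Continuous fun r => r ^ 2 * (f r * f r) := by fun_prop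
  have c2 : Continuous fun r => (N + c ^ 2 * r ^ 4) * (f r * f r) := by fun_prop
  have hsplit := intervalIntegral.integral_add_adjacent_intervals (hI c1 le_rfl hδ0.le hδ1.le)
    (hI c1 hδ0.le hδ1.le le_rfl)
  have hpart1 : ∫ r in (0 : ℝ)..δ, (1 - r ^ 2) ^ α * (r ^ 2 * (f r * f r)) ≤
      1 / (2 * M') *
        ∫ r in (0 : ℝ)..δ, (1 - r ^ 2) ^ α * ((N + c ^ 2 * r ^ 4) * (f r * f r)) := by
    rw [← intervalIntegral.integral_const_mul]
    refine intervalIntegral.integral_mono_on hδ0.le (hI c1 le_rfl hδ0.le hδ1.le)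
      ((hI c2 le_rfl hδ0.le hδ1.le).const_mul _) fun r hr => ?_
    have hw := weight_nonneg α hr.1 (hr.2.trans hδ1.le)
    have h1 : r ^ 2 ≤ 1 / (2 * M') * (N + c ^ 2 * r ^ 4) := by
      have h2 : r ^ 2 ≤ δ := by nlinarith [hr.1, hr.2]
      have h3 : N / (2 * M') = 1 / (2 * M') * N := by ring
      have h4 : 0 ≤ 1 / (2 * M') * (c ^ 2 * r ^ 4) := by positivity
      rw [mul_add]
      linarith
    have h2 := mul_le_mul_of_nonneg_right h1 (mul_nonneg hw (mul_self_nonneg (f r)))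
    linarith
  have hmono1 : ∫ r in (0 : ℝ)..δ, (1 - r ^ 2) ^ α * ((N + c ^ 2 * r ^ 4) * (f r * f r)) ≤
      ∫ r in (0 : ℝ)..1, (1 - r ^ 2) ^ α * ((N + c ^ 2 * r ^ 4) * (f r * f r)) := by
    refine intervalIntegral.integral_mono_interval le_rfl hδ0.le hδ1.le ?_
      (hI c2 le_rfl zero_le_one le_rfl)
    filter_upwards [ae_restrict_mem measurableSet_Ioc] with r hr
    exact mul_nonneg (weight_nonneg α hr.1.le hr.2)
      (mul_nonneg (by positivity) (mul_self_nonneg _))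
  have hmono2 : ∫ r in δ..1, fluxWeight α r * (deriv f r * deriv f r) ≤
      ∫ r in (0 : ℝ)..1, fluxWeight α r * (deriv f r * deriv f r) := by
    refine intervalIntegral.integral_mono_interval hδ0.le hδ1.le le_rfl ?_
      ((by fun_prop : Continuous _).intervalIntegrable _ _)
    filter_upwards [ae_restrict_mem measurableSet_Ioc] with r hr
    exact mul_nonneg (mul_nonneg (sq_nonneg _) (weight_nonneg _ hr.1.le hr.2))
      (mul_self_nonneg _)
  have hM2 : 0 < 1 / (2 * M') := by positivity
  have h1 := mul_le_mul_of_nonneg_left hmono1 hM2.le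
  have h2 := mul_le_mul_of_nonneg_left hmono2 hM2.le
  have h3 := mul_le_mul_of_nonneg_left henergy hM2.le
  have h4 : 1 / (2 * M') * (M' * ∫ r in (0 : ℝ)..1, (1 - r ^ 2) ^ α * (r ^ 2 * (f r * f r))) =
      1 / 2 * ∫ r in (0 : ℝ)..1, (1 - r ^ 2) ^ α * (r ^ 2 * (f r * f r)) := by
    field_simp
  rw [h4, mul_add] at h3
  linarith

/-- An injective real sequence with finite sublevel sets can be arranged increasingly. -/
theorem exists_perm_strictMono {χ : ℕ → ℝ} (hχ : Function.Injective χ)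
    (hfin : ∀ M, {k | χ k ≤ M}.Finite) : ∃ σ : Equiv.Perm ℕ, StrictMono fun j => χ (σ j) := by
  have hlt : ∀ k, {j | χ j < χ k}.Finite := fun k => (hfin (χ k)).subset fun j hj => by
    simp only [Set.mem_ofPred_eq] at hj ⊢
    exact hj.le
  -- The rank counts the smaller values. Its range is closed under predecessors and infinite, hence
  -- all of ℕ, and its inverse is the required permutation.
  let rk : ℕ → ℕ := fun k => (hlt k).toFinset.card
  have hmono : ∀ j k, χ j < χ k → rk j < rk k := by
    intro j k hjk
    refine Finset.card_lt_card (Finset.ssubset_iff_subset_ne.2 ⟨fun i hi => ?_, fun h => ?_⟩)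
    · simp only [Set.Finite.mem_toFinset, Set.mem_ofPred_eq] at hi ⊢
      exact hi.trans hjk
    · have : j ∈ (hlt j).toFinset := by rw [h]; simpa using hjk
      simp at this
  have hinj : Function.Injective rk := by
    intro j k h
    rcases lt_trichotomy (χ j) (χ k) with h1 | h1 | h1
    · exact absurd h (hmono j k h1).ne
    · exact hχ h1
    · exact absurd h (hmono k j h1).ne'
  have hdown : ∀ m k, rk k = m + 1 → ∃ j, rk j = m := by
    intro m k hk
    have hne : (hlt k).toFinset.Nonempty := Finset.card_pos.1 (by change 0 < rk k; omega)
    obtain ⟨j, hj, hjmax⟩ := Finset.exists_max_image _ χ hne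
    refine ⟨j, ?_⟩
    have : (hlt k).toFinset = insert j (hlt j).toFinset := by
      ext i
      simp only [Set.Finite.mem_toFinset, Set.mem_ofPred_eq, Finset.mem_insert] at hj hjmax ⊢
      constructor
      · intro hi
        rcases (hjmax i hi).lt_or_eq with h | h
        · exact Or.inr h
        · exact Or.inl (hχ h)
      · rintro (rfl | h)
        · exact hj
        · exact h.trans hj
    have hc : rk k = rk j + 1 := by
      change (hlt k).toFinset.card = _
      rw [this, Finset.card_insert_of_notMem (by simp)]
    omega
  have hdown' : ∀ d m, (∃ k, rk k = m + d) → ∃ j, rk j = m := by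
    intro d
    induction d with
    | zero => intro m h; exact h
    | succ d ih =>
      rintro m ⟨k, hk⟩
      exact ih m (hdown _ k (by omega))
  have hsurj : Function.Surjective rk := by
    intro m
    obtain ⟨k, hk⟩ : ∃ k, m ≤ rk k := by
      by_contra! hcon
      exact Set.infinite_of_injective_forall_mem (s := Set.Iio m) hinj (fun k => hcon k)
        (Set.finite_Iio m)
    exact hdown' (rk k - m) m ⟨k, by omega⟩
  let e : ℕ ≃ ℕ := Equiv.ofBijective rk ⟨hinj, hsurj⟩
  refine ⟨e.symm, fun i j hij => ?_⟩
  by_contra! hcon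
  have hi : rk (e.symm i) = i := e.apply_symm_apply i
  have hj : rk (e.symm j) = j := e.apply_symm_apply j
  rcases hcon.lt_or_eq with h | h
  · have := hmono _ _ h
    omega
  · have := hχ h
    rw [this] at hj
    omega

/-! ### Spherical harmonics and separated functions -/

theorem evalAt_add (p q : MvPolynomial (Fin 3) ℝ) :
    evalAt (p + q) = fun x => evalAt p x + evalAt q x := by
  funext x; simp [evalAt]

theorem evalAt_mul (p q : MvPolynomial (Fin 3) ℝ) :
    evalAt (p * q) = fun x => evalAt p x * evalAt q x := by
  funext x; simp [evalAt]

theorem evalAt_X (i : Fin 3) : evalAt (MvPolynomial.X i) = fun x => x i := by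
  funext x; simp [evalAt]

theorem evalAt_C (a : ℝ) : evalAt (MvPolynomial.C a) = fun _ => a := by
  funext x; simp [evalAt]

theorem contDiff_evalAt (p : MvPolynomial (Fin 3) ℝ) : ContDiff ℝ ∞ (evalAt p) := by
  induction p using MvPolynomial.induction_on with
  | C a => rw [evalAt_C]; exact contDiff_const
  | add p q hp hq => rw [evalAt_add]; exact hp.add hq
  | mul_X p i hp => rw [evalAt_mul, evalAt_X]; exact hp.mul (by fun_prop)

theorem differentiable_evalAt (p : MvPolynomial (Fin 3) ℝ) : Differentiable ℝ (evalAt p) :=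
  (contDiff_evalAt p).differentiable (by simp)

theorem pd_evalAt (p : MvPolynomial (Fin 3) ℝ) (i : Fin 3) :
    pd i (evalAt p) = evalAt (MvPolynomial.pderiv i p) := by
  induction p using MvPolynomial.induction_on with
  | C a => rw [evalAt_C, pd_const]; funext x; simp [evalAt]
  | add p q hp hq =>
    have h1 := differentiable_evalAt p
    have h2 := differentiable_evalAt q
    rw [evalAt_add, pd_add h1 h2, hp, hq, map_add, evalAt_add]
  | mul_X p j hp =>
    have h1 := differentiable_evalAt p
    rw [evalAt_mul, evalAt_X, pd_mul h1 (by fun_prop), hp, pd_coord]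
    funext x
    rw [Derivation.leibniz, MvPolynomial.pderiv_X]
    simp only [evalAt, smul_eq_mul, map_add, map_mul, MvPolynomial.eval_X]
    by_cases hij : j = i
    · subst hij; simp; ring
    · simp [hij, mul_comm]

theorem evalAt_smul {n : ℕ} {Y : MvPolynomial (Fin 3) ℝ} (hY : Y.IsHomogeneous n) (t : ℝ)
    (x : E3) : evalAt Y (t • x) = t ^ n * evalAt Y x := by
  simp only [evalAt, MvPolynomial.eval_eq', Finset.mul_sum]
  refine Finset.sum_congr rfl fun d hd => ?_
  have hdeg : ∑ i, d i = n := by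
    have := hY (MvPolynomial.mem_support_iff.1 hd)
    rw [Finsupp.weight_apply, Finsupp.sum_fintype _ _ (by simp)] at this
    simpa using this
  simp only [PiLp.smul_apply, smul_eq_mul, mul_pow, Finset.prod_mul_distrib,
    Finset.prod_pow_eq_pow_sum, hdeg]
  ring

theorem euler_evalAt {n : ℕ} {Y : MvPolynomial (Fin 3) ℝ} (hY : Y.IsHomogeneous n) (x : E3) :
    ∑ i, x i * evalAt (MvPolynomial.pderiv i Y) x = n * evalAt Y x := by
  have := congrArg (fun p => evalAt p x) hY.sum_X_mul_pderiv
  simpa [evalAt] using this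

/-- With ΔY = 0, Euler's identity for Y and for its partial derivatives turns the remaining terms
into -n(n-1) - 2n. -/
theorem laplaceBeltrami_evalAt {n : ℕ} {Y : MvPolynomial (Fin 3) ℝ} (hY : Y.IsHomogeneous n)
    (hharm : ∑ i, MvPolynomial.pderiv i (MvPolynomial.pderiv i Y) = 0) (x : E3) :
    laplaceBeltrami (evalAt Y) x = -(n * (n + 1)) * evalAt Y x := by
  rw [laplaceBeltrami_eq ((contDiff_evalAt Y).of_le ENat.LEInfty.out)]
  simp only [pd_evalAt]
  have h1 : ∑ i, evalAt (MvPolynomial.pderiv i (MvPolynomial.pderiv i Y)) x = 0 := by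
    have := congrArg (fun p => evalAt p x) hharm
    simpa [evalAt] using this
  have h2 : ∑ i, ∑ j, x i * x j * evalAt (MvPolynomial.pderiv i (MvPolynomial.pderiv j Y)) x =
      ((n - 1 : ℕ) : ℝ) * (n * evalAt Y x) := by
    rw [Finset.sum_comm, ← euler_evalAt hY, Finset.mul_sum]
    refine Finset.sum_congr rfl fun j _ => ?_
    rw [← mul_left_comm, ← euler_evalAt (hY.pderiv (i := j)), Finset.mul_sum]
    exact Finset.sum_congr rfl fun i _ => by ring
  rw [h1, h2, euler_evalAt hY]
  rcases n with _ | n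
  · simp
  · push_cast
    simp
    ring

/-- The function `Ψ` has the form `p(|x|) Y(x/|x|)` on the closed ball. -/
structure IsSeparated (n : ℕ) (Y : MvPolynomial (Fin 3) ℝ) (p : ℝ → ℝ) (Ψ : E3 → ℝ) : Prop where
  homogeneous : Y.IsHomogeneous n
  harmonic : ∑ i, MvPolynomial.pderiv i (MvPolynomial.pderiv i Y) = 0
  contDiff_radial : ContDiff ℝ ∞ p
  contDiff : ContDiff ℝ ∞ Ψ
  eq : ∀ x ∈ cball, Ψ x * ‖x‖ ^ n = p ‖x‖ * evalAt Y x

theorem crossGrad_mul_apply {f g : E3 → ℝ} {x : E3} (hf : DifferentiableAt ℝ f x)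
    (hg : DifferentiableAt ℝ g x) (i : Fin 3) :
    crossGrad (fun y => f y * g y) x i = crossGrad f x i * g x + f x * crossGrad g x i := by
  fin_cases i
  all_goals
    simp only [Fin.zero_eta, Fin.mk_one, Fin.reduceFinMk, crossGrad_zero, crossGrad_one,
      crossGrad_two, pd_mul_apply hf hg]
    ring

section

variable {n : ℕ} {Y : MvPolynomial (Fin 3) ℝ} {p : ℝ → ℝ} {Ψ : E3 → ℝ}

/-- Away from the origin Ψ is a radial function times Y. Rotation fields annihilate the radial
factor, so Δ₀ acts on Y alone. -/
theorem IsSeparated.laplaceBeltrami (h : IsSeparated n Y p Ψ) {x : E3} (hx : x ∈ oball)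
    (hx0 : x ≠ 0) : laplaceBeltrami Ψ x = -(n * (n + 1)) * Ψ x := by
  let q : ℝ → ℝ := fun u => p (√u) / √u ^ n
  let H : E3 → ℝ := fun y => q (‖y‖ ^ 2)
  have hq : ∀ u, 0 < u → DifferentiableAt ℝ q u := by
    intro u hu
    have h1 : DifferentiableAt ℝ (fun u => √u) u := DifferentiableAt.sqrt (by fun_prop) hu.ne'
    have h2 : DifferentiableAt ℝ p (√u) := h.contDiff_radial.differentiable (by simp) _
    exact (h2.comp u h1).div (h1.pow n) (pow_ne_zero n (Real.sqrt_pos.2 hu).ne')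
  have hH : ∀ y : E3, y ≠ 0 → DifferentiableAt ℝ H y := fun y hy =>
    (hq _ (by positivity)).comp y (differentiable_norm_sq y)
  have hHX : ∀ y : E3, y ≠ 0 → ∀ i, crossGrad H y i = 0 := fun y hy i =>
    crossGrad_radial (hq _ (by positivity)) i
  have hev : ∀ y ∈ oball, y ≠ 0 → Ψ =ᶠ[𝓝 y] fun z => H z * evalAt Y z := by
    intro y hy hy0
    filter_upwards [isOpen_oball.mem_nhds hy, isOpen_ne.mem_nhds hy0] with z hz hz0
    have h1 := h.eq z (oball_subset_cball hz)
    have h2 : ‖z‖ ^ n ≠ 0 := pow_ne_zero n (norm_ne_zero_iff.2 hz0)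
    simp only [H, q, Real.sqrt_sq (norm_nonneg z)]
    field_simp
    exact h1
  have hY := differentiable_evalAt Y
  have hXY : ∀ i, Differentiable ℝ fun y => crossGrad (evalAt Y) y i := fun i =>
    (contDiff_crossGrad (n := 1)
      (by norm_num; exact (contDiff_evalAt Y).of_le ENat.LEInfty.out) i).differentiable
      one_ne_zero
  have hX : ∀ i, (fun y => crossGrad Ψ y i) =ᶠ[𝓝 x] fun y => H y * crossGrad (evalAt Y) y i := by
    intro i
    filter_upwards [isOpen_oball.mem_nhds hx, isOpen_ne.mem_nhds hx0] with y hy hy0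
    rw [(crossGrad_eventuallyEq (hev y hy hy0)).self_of_nhds,
      crossGrad_mul_apply (hH y hy0) (hY y), hHX y hy0]
    ring
  have hXX : ∀ i, crossGrad (fun y => crossGrad Ψ y i) x i =
      H x * crossGrad (fun y => crossGrad (evalAt Y) y i) x i := by
    intro i
    rw [(crossGrad_eventuallyEq (hX i)).self_of_nhds,
      crossGrad_mul_apply (hH x hx0) (hXY i x), hHX x hx0]
    ring
  have hLB := laplaceBeltrami_evalAt h.homogeneous h.harmonic x
  rw [BallPSWF.laplaceBeltrami] at hLB ⊢
  simp only [hXX]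
  rw [← Finset.mul_sum, hLB, (hev x hx hx0).self_of_nhds]
  ring

theorem hasDerivAt_ray {F : E3 → ℝ} (hF : Differentiable ℝ F) (ξ : E3) (r : ℝ) :
    HasDerivAt (fun r : ℝ => F (r • ξ)) (∑ i, ξ i * pd i F (r • ξ)) r := by
  have h1 : HasDerivAt (fun r : ℝ => r • ξ) ξ r := by
    simpa using (hasDerivAt_id r).smul_const ξ
  have h2 := (hF (r • ξ)).hasFDerivAt.comp_hasDerivAt r h1
  refine h2.congr_deriv ?_
  have : ξ = ∑ i, ξ i • EuclideanSpace.single i (1 : ℝ) := by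
    ext j
    fin_cases j <;> simp [Fin.sum_univ_three]
  calc fderiv ℝ F (r • ξ) ξ
      = fderiv ℝ F (r • ξ) (∑ i, ξ i • EuclideanSpace.single i (1 : ℝ)) := by rw [← this]
    _ = _ := by simp only [map_sum, map_smul, smul_eq_mul, pd]

theorem IsSeparated.ray (h : IsSeparated n Y p Ψ) {ξ : E3} (hξ : ‖ξ‖ = 1) {r : ℝ}
    (hr : r ∈ Set.Ioc (0 : ℝ) 1) : Ψ (r • ξ) = p r * evalAt Y ξ := by
  have hn : ‖r • ξ‖ = r := by rw [norm_smul, hξ, mul_one, Real.norm_of_nonneg hr.1.le]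
  have h1 := h.eq (r • ξ) (mem_cball_iff.2 (by rw [hn]; exact hr.2))
  rw [hn, evalAt_smul h.homogeneous] at h1
  have : r ^ n ≠ 0 := pow_ne_zero n hr.1.ne'
  have h2 : r ^ n * Ψ (r • ξ) = r ^ n * (p r * evalAt Y ξ) := by linarith
  exact mul_left_cancel₀ this h2

/-- The Sturm-Liouville operator on a separated function, along a ray. -/
theorem IsSeparated.expandedSL_ray (h : IsSeparated n Y p Ψ) (α c : ℝ) {ξ : E3} (hξ : ‖ξ‖ = 1)
    {r : ℝ} (hr : r ∈ Set.Ioo (0 : ℝ) 1) :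
    expandedSL α c Ψ (r • ξ) = radialSL α c (n * (n + 1)) p r * evalAt Y ξ := by
  have hr0 : r ≠ 0 := hr.1.ne'
  have hn : ‖r • ξ‖ = r := by rw [norm_smul, hξ, mul_one, Real.norm_of_nonneg hr.1.le]
  have hb : r • ξ ∈ oball := mem_oball_iff.2 (by rw [hn]; exact hr.2)
  have hne : r • ξ ≠ 0 := norm_ne_zero_iff.1 (by rw [hn]; exact hr0)
  have hΨd : Differentiable ℝ Ψ := h.contDiff.differentiable (by simp)
  have hΨ1 : ∀ i, Differentiable ℝ (pd i Ψ) := fun i =>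
    (contDiff_top_pd h.contDiff i).differentiable (by simp)
  have hp1 : ContDiff ℝ ∞ (deriv p) := (contDiff_infty_iff_deriv.1 h.contDiff_radial).2
  have hev : (fun s : ℝ => Ψ (s • ξ)) =ᶠ[𝓝 r] fun s => p s * evalAt Y ξ := by
    filter_upwards [Ioo_mem_nhds hr.1 hr.2] with s hs
    exact h.ray hξ ⟨hs.1, hs.2.le⟩
  have h1 : ∀ s, ∑ i, ξ i * pd i Ψ (s • ξ) = deriv (fun s : ℝ => Ψ (s • ξ)) s := fun s =>
    (hasDerivAt_ray hΨd ξ s).deriv.symm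
  have g1 : (fun s : ℝ => ∑ i, ξ i * pd i Ψ (s • ξ)) =ᶠ[𝓝 r] fun s => deriv p s * evalAt Y ξ := by
    filter_upwards [hev.eventuallyEq_nhds] with s hs
    rw [h1, hs.deriv_eq]
    exact deriv_mul_const (h.contDiff_radial.differentiable (by simp) _) _
  have g1r : ∑ i, ξ i * pd i Ψ (r • ξ) = deriv p r * evalAt Y ξ := g1.self_of_nhds
  have g2r : ∑ i, ∑ j, ξ i * ξ j * pd i (pd j Ψ) (r • ξ) = deriv (deriv p) r * evalAt Y ξ := by
    have e1 : deriv (fun s : ℝ => ∑ i, ξ i * pd i Ψ (s • ξ)) r =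
        deriv (deriv p) r * evalAt Y ξ := by
      rw [g1.deriv_eq]
      exact deriv_mul_const (hp1.differentiable (by simp) _) _
    rw [← e1, (HasDerivAt.fun_sum fun i _ =>
      (hasDerivAt_ray (hΨ1 i) ξ r).const_mul (ξ i)).deriv, Finset.sum_comm]
    simp only [Finset.mul_sum, mul_assoc, mul_left_comm]
  have hLB := h.laplaceBeltrami hb hne
  rw [laplaceBeltrami_eq (h.contDiff.of_le ENat.LEInfty.out), hn] at hLB
  have k1 : ∑ i, (r • ξ) i * pd i Ψ (r • ξ) = r * (deriv p r * evalAt Y ξ) := by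
    rw [← g1r, Finset.mul_sum]
    exact Finset.sum_congr rfl fun i _ => by simp [mul_assoc]
  have k2 : ∑ i, ∑ j, (r • ξ) i * (r • ξ) j * pd i (pd j Ψ) (r • ξ) =
      r ^ 2 * (deriv (deriv p) r * evalAt Y ξ) := by
    rw [← g2r, Finset.mul_sum]
    refine Finset.sum_congr rfl fun i _ => ?_
    rw [Finset.mul_sum]
    exact Finset.sum_congr rfl fun j _ => by simp; ring
  rw [k1, k2, h.ray hξ ⟨hr.1, hr.2.le⟩] at hLB
  -- The Laplacian is recovered by solving the formula for Δ₀, whose eigenvalue is known, using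
  -- first and second derivatives along the ray.
  have hΔ : ∑ i, pd i (pd i Ψ) (r • ξ) = (deriv (deriv p) r + 2 / r * deriv p r
      - n * (n + 1) / r ^ 2 * p r) * evalAt Y ξ := by
    field_simp
    linarith
  rw [expandedSL, k1, k2, hΔ, hn, h.ray hξ ⟨hr.1, hr.2.le⟩, radialSL]
  ring

theorem exists_ray {x : E3} (hx : x ∈ oball) (hx0 : x ≠ 0) :
    ∃ ξ : E3, ‖ξ‖ = 1 ∧ ‖x‖ ∈ Set.Ioo (0 : ℝ) 1 ∧ x = ‖x‖ • ξ := by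
  have h := norm_pos_iff.2 hx0
  refine ⟨‖x‖⁻¹ • x, ?_, ⟨h, mem_oball_iff.1 hx⟩, ?_⟩
  · rw [norm_smul, norm_inv, norm_norm, inv_mul_cancel₀ h.ne']
  · rw [smul_smul, mul_inv_cancel₀ h.ne', one_smul]

/-- Ray formulas say nothing at the origin, which is a null set; continuity fills it in. The weight
exponent 0 is an arbitrary choice. -/
theorem eq_zero_of_punctured {F : E3 → ℝ} (hF : Continuous F)
    (h : ∀ x ∈ oball, x ≠ 0 → F x = 0) : ∀ x ∈ oball, F x = 0 := by
  refine eqOn_zero_of_ae_eq_zero (α := 0) hF ?_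
  filter_upwards [ae_mem_oball 0, ae_ne_zero 0] with x hx hx0
  exact h x hx hx0

/-- Nonvanishing of an eigenfunction is known only at some point of the closed ball, possibly on the
sphere; this transfers it to the interior. -/
theorem eq_zero_on_cball {F : E3 → ℝ} (hF : Continuous F) (h : ∀ x ∈ oball, F x = 0) :
    ∀ x ∈ cball, F x = 0 := by
  have : cball = closure oball := (closure_ball (0 : E3) one_ne_zero).symm
  intro x hx
  rw [this] at hx
  exact (isClosed_eq hF continuous_const).closure_subset_iff.2 (fun y hy => h y hy) hx

theorem IsSeparated.expandedSL_eq (h : IsSeparated n Y p Ψ) {α c χ : ℝ}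
    (hp : ∀ r ∈ Set.Ioo (0 : ℝ) 1, radialSL α c (n * (n + 1)) p r = χ * p r) :
    ∀ x ∈ oball, expandedSL α c Ψ x = χ * Ψ x := by
  have hc : Continuous fun x => expandedSL α c Ψ x - χ * Ψ x :=
    (continuous_expandedSL (h.contDiff.of_le ENat.LEInfty.out)).sub
      (continuous_const.mul h.contDiff.continuous)
  intro x hx
  refine sub_eq_zero.1 (eq_zero_of_punctured hc (fun y hy hy0 => ?_) x hx)
  obtain ⟨ξ, hξ, hr, hyξ⟩ := exists_ray hy hy0
  rw [hyξ, h.expandedSL_ray α c hξ hr, h.ray hξ ⟨hr.1, hr.2.le⟩, hp _ hr]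
  ring

theorem IsSeparated.radialSL_eq (h : IsSeparated n Y p Ψ) {α c χ : ℝ} {ξ : E3} (hξ : ‖ξ‖ = 1)
    (hYξ : evalAt Y ξ ≠ 0) (hΨ : ∀ x ∈ oball, expandedSL α c Ψ x = χ * Ψ x) :
    ∀ r ∈ Set.Ioo (0 : ℝ) 1, radialSL α c (n * (n + 1)) p r = χ * p r := by
  intro r hr
  have hb : r • ξ ∈ oball := mem_oball_iff.2 (by
    rw [norm_smul, hξ, mul_one, Real.norm_of_nonneg hr.1.le]; exact hr.2)
  have := hΨ _ hb
  rw [h.expandedSL_ray α c hξ hr, h.ray hξ ⟨hr.1, hr.2.le⟩, ← mul_assoc] at this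
  exact mul_right_cancel₀ hYξ this

theorem IsSeparated.radial_ne_zero (h : IsSeparated n Y p Ψ) (hne : ∃ x ∈ cball, Ψ x ≠ 0) :
    ∃ r ∈ Set.Ioo (0 : ℝ) 1, p r ≠ 0 := by
  by_contra! hcon
  obtain ⟨x, hx, hxne⟩ := hne
  refine hxne (eq_zero_on_cball h.contDiff.continuous
    (eq_zero_of_punctured h.contDiff.continuous fun y hy hy0 => ?_) x hx)
  obtain ⟨ξ, hξ, hr, hyξ⟩ := exists_ray hy hy0
  rw [hyξ, h.ray hξ ⟨hr.1, hr.2.le⟩, hcon _ hr, zero_mul]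

/-- The conclusions about scalar and solenoidal eigenfunctions, for a separated function. -/
theorem IsSeparated.eigenfunction (h : IsSeparated n Y p Ψ) (hn : 1 ≤ n)
    (hne : ∃ x ∈ cball, Ψ x ≠ 0) {α c χ : ℝ}
    (hp : ∀ r ∈ Set.Ioo (0 : ℝ) 1, radialSL α c (n * (n + 1)) p r = χ * p r) {ψ : E3 → ℝ}
    (hψ : ∀ x ∈ cball, ψ x = Ψ x) :
    ContDiffOn ℝ ∞ ψ oball ∧
    (∀ x ∈ oball, sturmLiouville α c ψ x = χ * ψ x) ∧
    (∀ x ∈ oball, divergence (divFreePSWF ψ) x = 0) ∧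
    (∃ x ∈ oball, divFreePSWF ψ x ≠ 0) ∧
    ∀ x ∈ oball, vecSturmLiouville α c (divFreePSWF ψ) x = χ • divFreePSWF ψ x := by
  have hev : ∀ x ∈ oball, ψ =ᶠ[𝓝 x] Ψ := fun x hx => by
    filter_upwards [isOpen_oball.mem_nhds hx] with y hy
    exact hψ y (oball_subset_cball hy)
  have hΨ2 : ContDiff ℝ 2 Ψ := h.contDiff.of_le ENat.LEInfty.out
  have hΨ3 : ContDiff ℝ 3 Ψ := h.contDiff.of_le ENat.LEInfty.out
  have heig := h.expandedSL_eq hp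
  refine ⟨?_, ?_, ?_, ?_, ?_⟩
  · exact h.contDiff.contDiffOn.congr fun x hx => hψ x (oball_subset_cball hx)
  · intro x hx
    rw [sturmLiouville_congr (hev x hx), sturmLiouville_eq hΨ2 hx, heig x hx,
      hψ x (oball_subset_cball hx)]
  · intro x hx
    rw [divFreePSWF, divergence_congr (crossGrad_eventuallyEq (hev x hx)),
      divergence_crossGrad hΨ2]
  -- If x × ∇Ψ vanished identically, so would Δ₀Ψ = -n(n+1)Ψ, and n ≥ 1 would give Ψ = 0.
  · by_contra! hcon
    have hX : ∀ x ∈ oball, crossGrad Ψ x = 0 := fun x hx => by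
      rw [← (crossGrad_eventuallyEq (hev x hx)).self_of_nhds]
      exact hcon x hx
    have hc := h.contDiff.continuous
    obtain ⟨x, hx, hxne⟩ := hne
    refine hxne (eq_zero_on_cball hc (eq_zero_of_punctured hc fun y hy hy0 => ?_) x hx)
    have hLB := h.laplaceBeltrami hy hy0
    have h0 : BallPSWF.laplaceBeltrami Ψ y = 0 := by
      rw [BallPSWF.laplaceBeltrami]
      refine Finset.sum_eq_zero fun i _ => ?_
      have hev0 : (fun z => crossGrad Ψ z i) =ᶠ[𝓝 y] fun _ => 0 := by
        filter_upwards [isOpen_oball.mem_nhds hy] with z hz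
        rw [hX z hz]
        rfl
      rw [(crossGrad_eventuallyEq hev0).self_of_nhds]
      fin_cases i <;> simp [crossGrad_zero, crossGrad_one, crossGrad_two, pd_const]
    rw [h0] at hLB
    have hnpos : (0 : ℝ) < n := by exact_mod_cast hn
    have : -((n : ℝ) * (n + 1)) ≠ 0 := neg_ne_zero.2 (by positivity)
    exact (mul_eq_zero.1 hLB.symm).resolve_left this
  · intro x hx
    ext i
    have hX2 : ContDiff ℝ 2 fun y => crossGrad Ψ y i :=
      contDiff_crossGrad (n := 2) (by norm_num; exact hΨ3) i
    have hevL : expandedSL α c Ψ =ᶠ[𝓝 x] fun y => χ * Ψ y := by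
      filter_upwards [isOpen_oball.mem_nhds hx] with y hy
      exact heig y hy
    rw [vecSturmLiouville, divFreePSWF, sturmLiouville_congr
      (crossGrad_apply_eventuallyEq (hev x hx) i), sturmLiouville_eq hX2 hx,
      expandedSL_crossGrad hΨ3, (crossGrad_eventuallyEq hevL).self_of_nhds,
      crossGrad_mul_apply (by fun_prop) (hΨ2.differentiable two_ne_zero x),
      (crossGrad_eventuallyEq (hev x hx)).self_of_nhds]
    have : crossGrad (fun _ : E3 => χ) x i = 0 := by
      fin_cases i <;> simp [crossGrad_zero, crossGrad_one, crossGrad_two, pd_const]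
    rw [this]
    simp

end

theorem IsSphericalHarmonics.exists_ne_zero
    {Y : (n : ℕ) → Fin (2 * n + 1) → MvPolynomial (Fin 3) ℝ} (hY : IsSphericalHarmonics Y) (n : ℕ)
    (ℓ : Fin (2 * n + 1)) : ∃ ξ : E3, ‖ξ‖ = 1 ∧ evalAt (Y n ℓ) ξ ≠ 0 := by
  by_contra! hcon
  have h := hY.orthonormal n ℓ ℓ
  have : ∀ s : Metric.sphere (0 : E3) 1, evalAt (Y n ℓ) s = 0 := fun s => hcon s (by simp)
  simp [this] at h

/-- A smooth function `φ(2|x|²-1) Y(x)` is separated with a smooth radial part. -/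
theorem exists_radial_part {n : ℕ} {Y : MvPolynomial (Fin 3) ℝ} (hY : Y.IsHomogeneous n)
    {φ : ℝ → ℝ} {Ψ : E3 → ℝ} (hΨ : ContDiff ℝ ∞ Ψ)
    (heq : ∀ x ∈ cball, Ψ x = φ (2 * ‖x‖ ^ 2 - 1) * evalAt Y x) {ξ : E3} (hξ : ‖ξ‖ = 1)
    (hYξ : evalAt Y ξ ≠ 0) :
    ∃ p : ℝ → ℝ, ContDiff ℝ ∞ p ∧ ∀ r ∈ Set.Icc (0 : ℝ) 1, p r = φ (2 * r ^ 2 - 1) * r ^ n := by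
  refine ⟨fun r => Ψ (r • ξ) / evalAt Y ξ, ?_, fun r hr => ?_⟩
  · exact (hΨ.comp (by fun_prop)).div_const _
  · have hn : ‖r • ξ‖ = r := by rw [norm_smul, hξ, mul_one, Real.norm_of_nonneg hr.1]
    simp only
    rw [heq _ (mem_cball_iff.2 (by rw [hn]; exact hr.2)), hn, evalAt_smul hY]
    field_simp

theorem isSeparated_of_radial_part {n : ℕ} {Y : MvPolynomial (Fin 3) ℝ} (hY : Y.IsHomogeneous n)
    (hharm : ∑ i, MvPolynomial.pderiv i (MvPolynomial.pderiv i Y) = 0)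
    {φ : ℝ → ℝ} {Ψ : E3 → ℝ} (hΨ : ContDiff ℝ ∞ Ψ)
    (heq : ∀ x ∈ cball, Ψ x = φ (2 * ‖x‖ ^ 2 - 1) * evalAt Y x) {p : ℝ → ℝ} (hp : ContDiff ℝ ∞ p)
    (hpφ : ∀ r ∈ Set.Icc (0 : ℝ) 1, p r = φ (2 * r ^ 2 - 1) * r ^ n) : IsSeparated n Y p Ψ where
  homogeneous := hY
  harmonic := hharm
  contDiff_radial := hp
  contDiff := hΨ
  eq x hx := by
    rw [heq x hx, hpφ _ ⟨norm_nonneg x, mem_cball_iff.1 hx⟩]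
    ring

/-! ### Eigenfunctions of the finite Fourier transform -/

theorem expandedSL_const_mul {α c : ℝ} {f : E3 → ℝ} (hf : ContDiff ℝ 2 f) (a : ℝ) (x : E3) :
    expandedSL α c (fun y => a * f y) x = a * expandedSL α c f x := by
  have h0 : Differentiable ℝ f := hf.differentiable two_ne_zero
  have h1 : ∀ i, Differentiable ℝ (pd i f) := fun i =>
    (contDiff_one_pd hf i).differentiable one_ne_zero
  simp only [expandedSL, Fin.sum_univ_three]
  simp (disch := fun_prop) only [pd_add, pd_mul, pd_const]
  ring

section

variable {α c : ℝ} {Y : (n : ℕ) → Fin (2 * n + 1) → MvPolynomial (Fin 3) ℝ}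
  {lam : ℕ → ℕ → ℝ} {ψ : (n : ℕ) → ℕ → Fin (2 * n + 1) → E3 → ℝ}

/-- The smooth extension of an eigenfunction of the finite Fourier transform. -/
noncomputable def extension (α c : ℝ) (lam : ℕ → ℕ → ℝ)
    (ψ : (n : ℕ) → ℕ → Fin (2 * n + 1) → E3 → ℝ) (n k : ℕ) (ℓ : Fin (2 * n + 1)) (x : E3) : ℝ :=
  ((-1) ^ k * lam n k)⁻¹ *
    trigTransform α (Complex.I ^ n).re (Complex.I ^ n).im c (ψ n k ℓ) x

theorem IsFourierEigensystem.eigenvalue_ne_zero (h : IsFourierEigensystem α c Y lam ψ) (n k : ℕ) :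
    (-1) ^ k * lam n k ≠ 0 :=
  mul_ne_zero (pow_ne_zero _ (by norm_num)) (h.lam_pos n k).ne'

theorem IsFourierEigensystem.integrable (h : IsFourierEigensystem α c Y lam ψ) (hα : -1 < α)
    (n k : ℕ) (ℓ : Fin (2 * n + 1)) : Integrable (ψ n k ℓ) (ballMeasure α) := by
  have := isFiniteMeasure_ballMeasure hα
  exact (h.memLp n k ℓ).integrable (by norm_num)

theorem IsFourierEigensystem.contDiff_extension (h : IsFourierEigensystem α c Y lam ψ)
    (hα : -1 < α) (n k : ℕ) (ℓ : Fin (2 * n + 1)) : ContDiff ℝ ∞ (extension α c lam ψ n k ℓ) :=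
  contDiff_const.mul (contDiff_trigTransform (h.integrable hα n k ℓ) _ _ _)

theorem IsFourierEigensystem.extension_eq (h : IsFourierEigensystem α c Y lam ψ)
    (hα : -1 < α) (n k : ℕ) (ℓ : Fin (2 * n + 1)) :
    ∀ x ∈ cball, ψ n k ℓ x = extension α c lam ψ n k ℓ x := by
  intro x hx
  rw [extension, trigTransform_eigen (h.integrable hα n k ℓ) (h.eigen n k ℓ x hx), ← mul_assoc,
    inv_mul_cancel₀ (h.eigenvalue_ne_zero n k), one_mul]

theorem IsFourierEigensystem.extension_ae_eq (h : IsFourierEigensystem α c Y lam ψ)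
    (hα : -1 < α) (n k : ℕ) (ℓ : Fin (2 * n + 1)) :
    ψ n k ℓ =ᵐ[ballMeasure α] extension α c lam ψ n k ℓ := by
  filter_upwards [ae_mem_oball α] with x hx
  exact h.extension_eq hα n k ℓ x (oball_subset_cball hx)

theorem IsFourierEigensystem.trigTransform_extension (h : IsFourierEigensystem α c Y lam ψ)
    (hα : -1 < α) (n k : ℕ) (ℓ : Fin (2 * n + 1)) (x : E3) :
    trigTransform α (Complex.I ^ n).re (Complex.I ^ n).im c (extension α c lam ψ n k ℓ) x =
      (-1) ^ k * lam n k * extension α c lam ψ n k ℓ x := by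
  have h1 : trigTransform α (Complex.I ^ n).re (Complex.I ^ n).im c
      (extension α c lam ψ n k ℓ) x =
      trigTransform α (Complex.I ^ n).re (Complex.I ^ n).im c (ψ n k ℓ) x := by
    refine integral_congr_ae ?_
    filter_upwards [h.extension_ae_eq hα n k ℓ] with τ hτ
    rw [hτ]
  rw [h1, extension, ← mul_assoc, mul_inv_cancel₀ (h.eigenvalue_ne_zero n k), one_mul]

/-- A continuous eigenfunction of the transform is orthogonal to the eigenfunctions belonging to
other eigenvalues. -/
theorem IsFourierEigensystem.orthogonal (h : IsFourierEigensystem α c Y lam ψ)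
    (hα : -1 < α) {n k j : ℕ} (hjk : j ≠ k) (ℓ : Fin (2 * n + 1)) {g : E3 → ℝ} (hg : Continuous g)
    (hT : ∀ x, trigTransform α (Complex.I ^ n).re (Complex.I ^ n).im c g x =
      (-1) ^ k * lam n k * g x) :
    ∫ x, g x * extension α c lam ψ n j ℓ x ∂(ballMeasure α) = 0 := by
  have hsym := integral_trigTransform_mul hα (Complex.I ^ n).re (Complex.I ^ n).im c
    (integrable_ballMeasure hα hg)
    (integrable_ballMeasure hα (h.contDiff_extension hα n j ℓ).continuous)
  simp only [hT, h.trigTransform_extension hα n j ℓ] at hsym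
  have e1 : ∀ x, (-1) ^ k * lam n k * g x * extension α c lam ψ n j ℓ x =
      (-1) ^ k * lam n k * (g x * extension α c lam ψ n j ℓ x) := fun x => by ring
  have e2 : ∀ x, g x * ((-1) ^ j * lam n j * extension α c lam ψ n j ℓ x) =
      (-1) ^ j * lam n j * (g x * extension α c lam ψ n j ℓ x) := fun x => by ring
  simp only [e1, e2, integral_const_mul] at hsym
  have hne : (-1) ^ k * lam n k - (-1) ^ j * lam n j ≠ 0 :=
    sub_ne_zero.2 ((h.distinct n).ne hjk.symm)
  have : ((-1) ^ k * lam n k - (-1) ^ j * lam n j) *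
      ∫ x, g x * extension α c lam ψ n j ℓ x ∂(ballMeasure α) = 0 := by linarith
  exact (mul_eq_zero.1 this).resolve_left hne

theorem IsFourierEigensystem.extension_ne_zero (h : IsFourierEigensystem α c Y lam ψ)
    (hα : -1 < α) (n k : ℕ) (ℓ : Fin (2 * n + 1)) :
    ∃ x ∈ cball, extension α c lam ψ n k ℓ x ≠ 0 := by
  obtain ⟨x, hx, hne⟩ := h.ne_zero n k ℓ
  exact ⟨x, hx, by rwa [← h.extension_eq hα n k ℓ x hx]⟩

/-- The eigenfunctions of the transform are eigenfunctions of the Sturm-Liouville operator. -/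
theorem IsFourierEigensystem.exists_eigenvalue (h : IsFourierEigensystem α c Y lam ψ)
    (hα : -1 < α) {n k : ℕ} {ℓ : Fin (2 * n + 1)} {p : ℝ → ℝ}
    (hsep : IsSeparated n (Y n ℓ) p (extension α c lam ψ n k ℓ)) :
    ∃ χ : ℝ, ∀ x ∈ oball, expandedSL α c (extension α c lam ψ n k ℓ) x =
      χ * extension α c lam ψ n k ℓ x := by
  set Ψ := extension α c lam ψ n k ℓ with hΨdef
  have hΨ2 : ContDiff ℝ 2 Ψ := hsep.contDiff.of_le ENat.LEInfty.out
  have hΨc : Continuous Ψ := hsep.contDiff.continuous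
  set g := expandedSL α c Ψ with hg
  have hgc : Continuous g := continuous_expandedSL hΨ2
  have hTg : ∀ x, trigTransform α (Complex.I ^ n).re (Complex.I ^ n).im c g x =
      (-1) ^ k * lam n k * g x := by
    intro x
    rw [hg, ← expandedSL_trigTransform hα _ _ _ hΨ2]
    have : trigTransform α (Complex.I ^ n).re (Complex.I ^ n).im c Ψ =
        fun y => (-1) ^ k * lam n k * Ψ y := funext (h.trigTransform_extension hα n k ℓ)
    rw [this, expandedSL_const_mul hΨ2]
  have hA : ∫ x, Ψ x * Ψ x ∂(ballMeasure α) ≠ 0 := by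
    intro h0
    have hnn : (0 : E3 → ℝ) ≤ fun x => Ψ x * Ψ x := fun x => mul_self_nonneg _
    have hc : Continuous fun x => Ψ x * Ψ x := hΨc.mul hΨc
    rw [integral_eq_zero_iff_of_nonneg hnn (integrable_ballMeasure hα hc)] at h0
    obtain ⟨x, hx, hne⟩ := h.extension_ne_zero hα n k ℓ
    have := eq_zero_on_cball hc (eqOn_zero_of_ae_eq_zero hc h0) x hx
    exact hne (mul_self_eq_zero.1 this)
  -- The Rayleigh quotient: it makes d = LΨ - χΨ orthogonal to Ψ as well as to all other
  -- eigenfunctions.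
  set χ := (∫ x, g x * Ψ x ∂(ballMeasure α)) / ∫ x, Ψ x * Ψ x ∂(ballMeasure α) with hχ
  refine ⟨χ, ?_⟩
  let d : E3 → ℝ := fun x => g x - χ * Ψ x
  have hdc : Continuous d := hgc.sub (continuous_const.mul hΨc)
  have hd : ∀ j, ∫ x, d x * extension α c lam ψ n j ℓ x ∂(ballMeasure α) = 0 := by
    intro j
    have hjc := (h.contDiff_extension hα n j ℓ).continuous
    have e : ∀ x, d x * extension α c lam ψ n j ℓ x = g x * extension α c lam ψ n j ℓ x
        - χ * (Ψ x * extension α c lam ψ n j ℓ x) := fun x => by simp only [d]; ring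
    simp only [e]
    have i1 : Integrable (fun x => g x * extension α c lam ψ n j ℓ x) (ballMeasure α) :=
      integrable_ballMeasure hα (hgc.mul hjc)
    have i2 : Integrable (fun x => χ * (Ψ x * extension α c lam ψ n j ℓ x)) (ballMeasure α) :=
      integrable_ballMeasure hα (continuous_const.mul (hΨc.mul hjc))
    rw [integral_sub i1 i2, integral_const_mul]
    rcases eq_or_ne j k with rfl | hjk
    · rw [← hΨdef, hχ, div_mul_cancel₀ _ hA, sub_self]
    · rw [h.orthogonal hα hjk ℓ hgc hTg,
        h.orthogonal hα hjk ℓ hΨc (h.trigTransform_extension hα n k ℓ)]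
      ring
  -- Completeness applies to functions f(2|x|²-1)Y, so d is rewritten with r = √((η+1)/2); dividing
  -- by rⁿ turns Y(x/|x|) into Y(x).
  let f : ℝ → ℝ := fun η =>
    (radialSL α c (n * (n + 1)) p (√((η + 1) / 2)) - χ * p (√((η + 1) / 2))) / √((η + 1) / 2) ^ n
  have hfd : (fun x => f (2 * ‖x‖ ^ 2 - 1) * evalAt (Y n ℓ) x) =ᵐ[ballMeasure α] d := by
    filter_upwards [ae_mem_oball α, ae_ne_zero α] with x hx hx0
    obtain ⟨ξ, hξ, hr, hxξ⟩ := exists_ray hx hx0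
    have hsq : √((2 * ‖x‖ ^ 2 - 1 + 1) / 2) = ‖x‖ := by
      rw [sub_add_cancel, mul_div_cancel_left₀ _ two_ne_zero, Real.sqrt_sq (norm_nonneg x)]
    have hY : evalAt (Y n ℓ) x = ‖x‖ ^ n * evalAt (Y n ℓ) ξ := by
      conv_lhs => rw [hxξ]
      exact evalAt_smul hsep.homogeneous _ _
    have h1 : g x = radialSL α c (n * (n + 1)) p ‖x‖ * evalAt (Y n ℓ) ξ := by
      conv_lhs => rw [hxξ]
      exact hsep.expandedSL_ray α c hξ hr
    have h2 : Ψ x = p ‖x‖ * evalAt (Y n ℓ) ξ := by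
      conv_lhs => rw [hxξ]
      exact hsep.ray hξ ⟨hr.1, hr.2.le⟩
    have hn : ‖x‖ ^ n ≠ 0 := pow_ne_zero n hr.1.ne'
    simp only [f, d, hsq, hY, h1, h2]
    field_simp
  have hzero := h.complete n ℓ f ((memLp_congr_ae hfd).2 (memLp_ballMeasure hα hdc 2)) fun j => by
    rw [← hd j]
    refine integral_congr_ae ?_
    filter_upwards [hfd, h.extension_ae_eq hα n j ℓ] with x h1 h2
    rw [h1, h2]
  intro x hx
  exact sub_eq_zero.1 (eqOn_zero_of_ae_eq_zero hdc (hfd.symm.trans hzero) x hx)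

/-- The radial description of the eigenfunctions of the finite Fourier transform. -/
theorem IsFourierEigensystem.exists_radial (h : IsFourierEigensystem α c Y lam ψ)
    (hα : -1 < α) (hY : IsSphericalHarmonics Y) (n : ℕ) :
    ∃ (p : ℕ → ℝ → ℝ) (χ : ℕ → ℝ),
      (∀ k, IsRadialEigenfunction α c (n * (n + 1)) (χ k) (p k)) ∧ Function.Injective χ ∧
      ∀ k ℓ, IsSeparated n (Y n ℓ) (p k) (extension α c lam ψ n k ℓ) := by
  obtain ⟨ξ, hξ, hYξ⟩ := hY.exists_ne_zero n 0
  choose φ hφ using h.separated n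
  have hφ' : ∀ k ℓ, ∀ x ∈ cball, extension α c lam ψ n k ℓ x =
      φ k (2 * ‖x‖ ^ 2 - 1) * evalAt (Y n ℓ) x := fun k ℓ x hx => by
    rw [← h.extension_eq hα n k ℓ x hx, hφ k ℓ x hx]
  -- The radial part is extracted with ℓ = 0, but φ is common to all ℓ, so p and the eigenvalue χ do
  -- not depend on ℓ.
  choose p hps hpφ using fun k => exists_radial_part (hY.homogeneous n 0)
    (h.contDiff_extension hα n k 0) (hφ' k 0) hξ hYξ
  have hsep : ∀ k ℓ, IsSeparated n (Y n ℓ) (p k) (extension α c lam ψ n k ℓ) := fun k ℓ =>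
    isSeparated_of_radial_part (hY.homogeneous n ℓ) (hY.harmonic n ℓ)
      (h.contDiff_extension hα n k ℓ) (hφ' k ℓ) (hps k) (hpφ k)
  choose χ hχ using fun k => h.exists_eigenvalue hα (hsep k 0)
  have hrad : ∀ k, IsRadialEigenfunction α c (n * (n + 1)) (χ k) (p k) := fun k =>
    { contDiff := (hps k).of_le ENat.LEInfty.out
      eq := (hsep k 0).radialSL_eq hξ hYξ (hχ k)
      ne_zero := (hsep k 0).radial_ne_zero (h.extension_ne_zero hα n k 0) }
  refine ⟨p, χ, hrad, fun j k hjk => ?_, hsep⟩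
  -- Equal eigenvalues of L give proportional eigenfunctions, hence equal eigenvalues of the
  -- transform, which are distinct by assumption.
  obtain ⟨C, hC⟩ := (hrad j).proportional hα (hjk ▸ hrad k)
  have hprop : ∀ x ∈ oball, extension α c lam ψ n k 0 x = C * extension α c lam ψ n j 0 x := by
    have hcont : Continuous fun x =>
        extension α c lam ψ n k 0 x - C * extension α c lam ψ n j 0 x :=
      (hsep k 0).contDiff.continuous.sub (continuous_const.mul (hsep j 0).contDiff.continuous)
    intro x hx
    refine sub_eq_zero.1 (eq_zero_of_punctured hcont (fun y hy hy0 => ?_) x hx)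
    obtain ⟨ζ, hζ, hr, hyζ⟩ := exists_ray hy hy0
    rw [hyζ, (hsep k 0).ray hζ ⟨hr.1, hr.2.le⟩, (hsep j 0).ray hζ ⟨hr.1, hr.2.le⟩, hC _ hr]
    ring
  by_contra hne
  have hTk : ∀ x, (-1) ^ k * lam n k * extension α c lam ψ n k 0 x =
      C * ((-1) ^ j * lam n j * extension α c lam ψ n j 0 x) := by
    intro x
    rw [← h.trigTransform_extension hα n k 0, ← h.trigTransform_extension hα n j 0, trigTransform,
      trigTransform, ← integral_const_mul]
    refine integral_congr_ae ?_
    filter_upwards [ae_mem_oball α] with τ hτ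
    rw [hprop τ hτ, smul_eq_mul, smul_eq_mul]
    ring
  obtain ⟨x, hx, hxne⟩ := h.extension_ne_zero hα n k 0
  refine hxne (eq_zero_on_cball (hsep k 0).contDiff.continuous (fun y hy => ?_) x hx)
  have h1 := hTk y
  have h2 : ((-1) ^ k * lam n k - (-1) ^ j * lam n j) * extension α c lam ψ n k 0 y = 0 := by
    linear_combination h1 - (-1) ^ j * lam n j * hprop y hy
  exact (mul_eq_zero.1 h2).resolve_left (sub_ne_zero.2 ((h.distinct n).ne (Ne.symm hne)))

end

/-! ### Jacobi polynomials and the case `c = 0` -/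

section

open Polynomial

variable {k : ℕ} {a b : ℝ}

/-- The coefficients of the Jacobi polynomial in powers of `(η - 1) / 2`, up to a constant. -/
noncomputable def jacobiCoeff (k : ℕ) (a b : ℝ) (s : ℕ) : ℝ :=
  (k.choose s : ℝ) * (Real.Gamma (k + a + b + s + 1) / Real.Gamma (a + s + 1))

/-- The Jacobi polynomial in the variable `(η - 1) / 2`, up to a constant. -/
noncomputable def jacobiPoly (k : ℕ) (a b : ℝ) : ℝ[X] :=
  ∑ s ∈ Finset.range (k + 1), C (jacobiCoeff k a b s) * X ^ s

theorem coeff_jacobiPoly (s : ℕ) : (jacobiPoly k a b).coeff s = jacobiCoeff k a b s := by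
  simp only [jacobiPoly, finsetSum_coeff, coeff_C_mul, coeff_X_pow, mul_ite, mul_one, mul_zero,
    Finset.sum_ite_eq, Finset.mem_range]
  split_ifs with h
  · rfl
  · rw [jacobiCoeff, Nat.choose_eq_zero_of_lt (by omega), Nat.cast_zero, zero_mul]

/-- The two-term recurrence is Jacobi's equation read coefficientwise in z = (η-1)/2; it follows
from Γ(x+1) = xΓ(x) and the ratio of consecutive binomial coefficients. -/
theorem jacobiCoeff_succ (ha : -1 < a) (hab : 0 < a + b + 1) (s : ℕ) :
    (s + 1) * (s + a + 1) * jacobiCoeff k a b (s + 1) =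
      (k - s) * (k + s + a + b + 1) * jacobiCoeff k a b s := by
  have hs : (0 : ℝ) ≤ s := s.cast_nonneg
  have hk : (0 : ℝ) ≤ k := k.cast_nonneg
  have h1 : Real.Gamma (k + a + b + (s + 1 : ℕ) + 1) =
      (k + a + b + s + 1) * Real.Gamma (k + a + b + s + 1) := by
    rw [← Real.Gamma_add_one (by linarith)]
    push_cast
    ring_nf
  have h2 : Real.Gamma (a + (s + 1 : ℕ) + 1) = (a + s + 1) * Real.Gamma (a + s + 1) := by
    rw [← Real.Gamma_add_one (by linarith)]
    push_cast
    ring_nf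
  have h3 : (k.choose (s + 1) : ℝ) * (s + 1) = k.choose s * (k - s) := by
    rcases le_or_gt s k with h | h
    · have := Nat.choose_succ_right_eq k s
      rw [← Nat.cast_sub h]
      exact_mod_cast this
    · rw [Nat.choose_eq_zero_of_lt h, Nat.choose_eq_zero_of_lt (by omega)]
      simp
  have h4 : a + s + 1 ≠ 0 := by linarith
  have h5 : Real.Gamma (a + s + 1) ≠ 0 := (Real.Gamma_pos_of_pos (by linarith)).ne'
  rw [jacobiCoeff, jacobiCoeff, h1, h2]
  field_simp
  linear_combination (s + a + 1) * (k + a + b + s + 1) * Real.Gamma (k + a + b + s + 1) * h3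

/-- Jacobi's differential equation. -/
theorem jacobiPoly_ode (ha : -1 < a) (hab : 0 < a + b + 1) :
    X * derivative (derivative (jacobiPoly k a b)) +
      X * (X * derivative (derivative (jacobiPoly k a b))) +
      C (a + 1) * derivative (jacobiPoly k a b) +
      C (a + b + 2) * (X * derivative (jacobiPoly k a b)) =
      C (k * (k + a + b + 1)) * jacobiPoly k a b := by
  ext s
  have h := jacobiCoeff_succ (k := k) ha hab s
  rcases s with _ | _ | s
  all_goals
    simp only [coeff_add, coeff_C_mul, coeff_X_mul, coeff_X_mul_zero, coeff_derivative,
      coeff_jacobiPoly]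
    push_cast at h ⊢
    linear_combination h

theorem eval_jacobiPoly_ode (ha : -1 < a) (hab : 0 < a + b + 1) (z : ℝ) :
    z * (1 + z) * (derivative (derivative (jacobiPoly k a b))).eval z +
      (a + 1 + (a + b + 2) * z) * (derivative (jacobiPoly k a b)).eval z =
      k * (k + a + b + 1) * (jacobiPoly k a b).eval z := by
  have h := congrArg (eval z) (jacobiPoly_ode (k := k) ha hab)
  simp only [eval_add, eval_mul, eval_X, eval_C] at h
  linear_combination h

theorem exists_normalizedJacobi_eq (ha : -1 < a) (hb : -1 < b) (hab : 0 < a + b + 1) (k : ℕ) :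
    ∃ C : ℝ, C ≠ 0 ∧ ∀ η, normalizedJacobi k a b η = C * (jacobiPoly k a b).eval ((η - 1) / 2) := by
  have hk : (0 : ℝ) ≤ k := k.cast_nonneg
  have g1 : 0 < Real.Gamma (k + a + 1) := Real.Gamma_pos_of_pos (by linarith)
  have g2 : 0 < Real.Gamma (k + b + 1) := Real.Gamma_pos_of_pos (by linarith)
  have g3 : 0 < Real.Gamma (k + 1) := Real.Gamma_pos_of_pos (by linarith)
  have g4 : 0 < Real.Gamma (k + a + b + 1) := Real.Gamma_pos_of_pos (by linarith)
  have g5 : 0 < 2 * k + a + b + 1 := by linarith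
  have g6 : (0 : ℝ) < k.factorial := by exact_mod_cast k.factorial_pos
  refine ⟨Real.Gamma (k + a + 1) / (k.factorial * Real.Gamma (k + a + b + 1)) /
    √(Real.Gamma (k + a + 1) * Real.Gamma (k + b + 1) /
      (2 * (2 * k + a + b + 1) * Real.Gamma (k + 1) * Real.Gamma (k + a + b + 1))), ?_, fun η => ?_⟩
  · have : 0 < Real.Gamma (k + a + 1) * Real.Gamma (k + b + 1) /
      (2 * (2 * k + a + b + 1) * Real.Gamma (k + 1) * Real.Gamma (k + a + b + 1)) := by positivity
    have := Real.sqrt_pos.2 this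
    positivity
  · simp only [normalizedJacobi, classicalJacobi, jacobiPoly, jacobiCoeff, eval_finsetSum,
      eval_mul, eval_C, eval_pow, eval_X]
    ring

/-- The value 0 corresponds to η = 1, that is |x| = 1, so a ball polynomial is nonzero wherever Y is
nonzero on the sphere. -/
theorem eval_zero_jacobiPoly_ne_zero (ha : -1 < a) (hab : 0 < a + b + 1) :
    (jacobiPoly k a b).eval 0 ≠ 0 := by
  have hk : (0 : ℝ) ≤ k := k.cast_nonneg
  rw [← coeff_zero_eq_eval_zero, coeff_jacobiPoly, jacobiCoeff]
  have g1 : 0 < Real.Gamma (k + a + b + (0 : ℕ) + 1) :=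
    Real.Gamma_pos_of_pos (by push_cast; linarith)
  have g2 : 0 < Real.Gamma (a + (0 : ℕ) + 1) := Real.Gamma_pos_of_pos (by push_cast; linarith)
  rw [Nat.choose_zero_right, Nat.cast_one, one_mul]
  exact (div_pos g1 g2).ne'

/-- Writing n/r · rⁿ instead of n rⁿ⁻¹ keeps the derivative in terms of functions of the same shape,
so the formula can be iterated. -/
theorem hasDerivAt_pow_mul_eval (n : ℕ) (P : ℝ[X]) {r : ℝ} (hr : 0 < r) :
    HasDerivAt (fun r => r ^ n * P.eval (r ^ 2 - 1))
      (n / r * (r ^ n * P.eval (r ^ 2 - 1)) +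
        2 * r * (r ^ n * (derivative P).eval (r ^ 2 - 1))) r := by
  have h1 : HasDerivAt (fun r : ℝ => r ^ 2 - 1) (2 * r) r := by
    simpa using (hasDerivAt_pow 2 r).sub_const 1
  have h2 := (hasDerivAt_pow n r).mul ((P.hasDerivAt (r ^ 2 - 1)).comp r h1)
  refine h2.congr_deriv ?_
  have h3 : (n : ℝ) * r ^ (n - 1) = n / r * r ^ n := by
    rcases n with _ | n
    · simp
    · simp only [Nat.add_sub_cancel, pow_succ]
      field_simp
  simp only [Function.comp]
  rw [h3]
  ring

/-- The radial parts of the ball polynomials are eigenfunctions of the radial operator. -/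
theorem radialSL_jacobiPoly (hα : -1 < a) (n k : ℕ) (C : ℝ) {r : ℝ} (hr : r ∈ Set.Ioo (0 : ℝ) 1) :
    radialSL a 0 (n * (n + 1))
      (fun r => C * (r ^ n * (jacobiPoly k a (n + 1 / 2)).eval (r ^ 2 - 1))) r = (n + 2 * k) * (n + 2 * k + 2 * a + 3) *
        (C * (r ^ n * (jacobiPoly k a (n + 1 / 2)).eval (r ^ 2 - 1))) := by
  set P := jacobiPoly k a (n + 1 / 2) with hP
  have hn : (0 : ℝ) ≤ n := n.cast_nonneg
  have hr0 : r ≠ 0 := hr.1.ne'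
  have h1 : ∀ t : ℝ, 0 < t → deriv (fun r => C * (r ^ n * P.eval (r ^ 2 - 1))) t =
      C * (n / t * (t ^ n * P.eval (t ^ 2 - 1)) +
        2 * t * (t ^ n * (derivative P).eval (t ^ 2 - 1))) := fun t ht =>
    ((hasDerivAt_pow_mul_eval n P ht).const_mul C).deriv
  have h2 : deriv (deriv fun r => C * (r ^ n * P.eval (r ^ 2 - 1))) r =
      C * (-n / r ^ 2 * (r ^ n * P.eval (r ^ 2 - 1)) +
        n / r * (n / r * (r ^ n * P.eval (r ^ 2 - 1)) +
          2 * r * (r ^ n * (derivative P).eval (r ^ 2 - 1))) +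
        (2 * (r ^ n * (derivative P).eval (r ^ 2 - 1)) +
          2 * r * (n / r * (r ^ n * (derivative P).eval (r ^ 2 - 1)) +
            2 * r * (r ^ n * (derivative (derivative P)).eval (r ^ 2 - 1))))) := by
    have hev : deriv (fun r => C * (r ^ n * P.eval (r ^ 2 - 1))) =ᶠ[𝓝 r] fun t =>
        C * (n / t * (t ^ n * P.eval (t ^ 2 - 1)) +
          2 * t * (t ^ n * (derivative P).eval (t ^ 2 - 1))) := by
      filter_upwards [lt_mem_nhds hr.1] with t ht using h1 t ht
    rw [hev.deriv_eq]
    have d1 : HasDerivAt (fun t : ℝ => (n : ℝ) / t) (-n / r ^ 2) r := by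
      simpa [div_eq_mul_inv] using (hasDerivAt_inv hr0).const_mul (n : ℝ)
    have d2 : HasDerivAt (fun t : ℝ => 2 * t) 2 r := by
      simpa using (hasDerivAt_id r).const_mul (2 : ℝ)
    exact (((d1.mul (hasDerivAt_pow_mul_eval n P hr.1)).add
      (d2.mul (hasDerivAt_pow_mul_eval n (derivative P) hr.1))).const_mul C).deriv
  have hode := eval_jacobiPoly_ode (k := k) (b := n + 1 / 2) hα (by linarith) (r ^ 2 - 1)
  rw [← hP] at hode
  rw [radialSL, h2, h1 r hr.1]
  field_simp
  -- Substituting z = r² - 1 reduces the claim to Jacobi's equation with b = n + 1/2, since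
  -- (n+2k)(n+2k+2a+3) = n(n+2a+3) + 4k(k+a+b+1).
  linear_combination 4 * r ^ 2 * C * hode

end

theorem IsSphericalHarmonics.exists_radial_ballPolynomial
    {Y : (n : ℕ) → Fin (2 * n + 1) → MvPolynomial (Fin 3) ℝ} (hY : IsSphericalHarmonics Y)
    {α : ℝ} (hα : -1 < α) (n k : ℕ) :
    ∃ p : ℝ → ℝ,
      (∀ r ∈ Set.Ioo (0 : ℝ) 1, radialSL α 0 (n * (n + 1)) p r =
        (n + 2 * k) * (n + 2 * k + 2 * α + 3) * p r) ∧
      ∀ ℓ, IsSeparated n (Y n ℓ) p (ballPolynomial α n k (Y n ℓ)) ∧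
        ∃ x ∈ cball, ballPolynomial α n k (Y n ℓ) x ≠ 0 := by
  have hn : (0 : ℝ) ≤ n := n.cast_nonneg
  obtain ⟨C, hC, hJ⟩ := exists_normalizedJacobi_eq (b := n + 1 / 2) hα (by linarith)
    (by linarith) k
  have hz : ∀ t : ℝ, (2 * t ^ 2 - 1 - 1) / 2 = t ^ 2 - 1 := fun t => by ring
  have hpoly : ContDiff ℝ ∞ fun t => (jacobiPoly k α (n + 1 / 2)).eval t :=
    by simpa using (jacobiPoly k α (n + 1 / 2)).contDiff_aeval (𝕜 := ℝ) ∞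
  refine ⟨_, fun r hr => radialSL_jacobiPoly hα n k C hr, fun ℓ =>
    ⟨isSeparated_of_radial_part (φ := normalizedJacobi k α (n + 1 / 2)) (hY.homogeneous n ℓ)
      (hY.harmonic n ℓ) ?_ (fun x _ => rfl) ?_ fun r _ => ?_, ?_⟩⟩
  · simp only [hJ, hz]
    exact (contDiff_const.mul (hpoly.comp ((contDiff_norm_sq ℝ).sub contDiff_const))).mul
      (contDiff_evalAt _)
  · exact contDiff_const.mul ((contDiff_id.pow n).mul
      (hpoly.comp ((contDiff_id.pow 2).sub contDiff_const)))
  · rw [hJ, hz]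
    ring
  · obtain ⟨ξ, hξ, hne⟩ := hY.exists_ne_zero n ℓ
    refine ⟨ξ, by simp [cball, hξ], ?_⟩
    rw [ballPolynomial, hJ, hz, hξ, one_pow, sub_self]
    exact mul_ne_zero (mul_ne_zero hC (eval_zero_jacobiPoly_ne_zero hα (by linarith))) hne

end BallPSWF

theorem theorem4p3 (α c : ℝ) (hα : -1 < α) (hc : 0 ≤ c)
    (Y : (n : ℕ) → Fin (2 * n + 1) → MvPolynomial (Fin 3) ℝ)
    (hY : BallPSWF.IsSphericalHarmonics Y)
    (lam : ℕ → ℕ → ℝ) (ψ : (n : ℕ) → ℕ → Fin (2 * n + 1) → BallPSWF.E3 → ℝ)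
    (hψ : BallPSWF.IsBallPSWF α c Y lam ψ) :
    (∃ χ : ℕ → ℕ → ℝ,
      -- the eigenvalues are positive and, for fixed `n`, form a strictly increasing sequence
      -- when suitably arranged
      (∀ n, 1 ≤ n → (∀ k, 0 < χ n k) ∧
        ∃ σ : Equiv.Perm ℕ, StrictMono fun j => χ n (σ j)) ∧
      ∀ n, 1 ≤ n → ∀ (k : ℕ) (ℓ : Fin (2 * n + 1)),
        -- the scalar ball PSWF is a smooth eigenfunction with eigenvalue `χ n k`
        ContDiffOn ℝ ∞ (ψ n k ℓ) BallPSWF.oball ∧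
        (∀ x ∈ BallPSWF.oball,
          BallPSWF.sturmLiouville α c (ψ n k ℓ) x = χ n k * ψ n k ℓ x) ∧
        -- the vectorial one is divergence free, nonzero, and an eigenfunction with the same
        -- eigenvalue
        (∀ x ∈ BallPSWF.oball,
          BallPSWF.divergence (BallPSWF.divFreePSWF (ψ n k ℓ)) x = 0) ∧
        (∃ x ∈ BallPSWF.oball, BallPSWF.divFreePSWF (ψ n k ℓ) x ≠ 0) ∧
        ∀ x ∈ BallPSWF.oball,
          BallPSWF.vecSturmLiouville α c (BallPSWF.divFreePSWF (ψ n k ℓ)) x =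
            χ n k • BallPSWF.divFreePSWF (ψ n k ℓ) x) ∧
    -- no nonzero eigenfunction has the form `∇ × (x × ∇)E`
    (0 < c → ∀ (E : BallPSWF.E3 → ℝ) (μ : ℝ), ContDiffOn ℝ 5 E BallPSWF.oball →
      (∀ x ∈ BallPSWF.oball,
        BallPSWF.vecSturmLiouville α c (BallPSWF.curl (BallPSWF.crossGrad E)) x =
          μ • BallPSWF.curl (BallPSWF.crossGrad E) x) →
      ∀ x ∈ BallPSWF.oball, BallPSWF.curl (BallPSWF.crossGrad E) x = 0) := by
  refine ⟨?_, fun hc0 E μ hE heig => BallPSWF.curl_crossGrad_eq_zero hc0.ne' hE heig⟩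
  rcases hc.eq_or_lt with rfl | hc0
  · choose p hp hsep using BallPSWF.IsSphericalHarmonics.exists_radial_ballPolynomial hY hα
    refine ⟨fun n k => (n + 2 * k) * (n + 2 * k + 2 * α + 3), fun n hn => ?_,
      fun n hn k ℓ => (hsep n k ℓ).1.eigenfunction hn (hsep n k ℓ).2 (hp n k) (hψ.2 rfl n k ℓ)⟩
    have hn' : (1 : ℝ) ≤ n := by exact_mod_cast hn
    refine ⟨fun k => ?_, Equiv.refl ℕ, fun j k hjk => ?_⟩
    · have hk : (0 : ℝ) ≤ k := k.cast_nonneg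
      exact mul_pos (by linarith) (by linarith)
    · have hj : (0 : ℝ) ≤ j := j.cast_nonneg
      have hjk' : (j : ℝ) < k := by exact_mod_cast hjk
      exact mul_lt_mul'' (by simpa using hjk') (by simpa using hjk')
        (by simp only [Equiv.refl_apply]; linarith) (by simp only [Equiv.refl_apply]; linarith)
  · have h := hψ.1 hc0
    choose p χ hrad hinj hsep using h.exists_radial hα hY
    refine ⟨χ, fun n hn => ?_, fun n hn k ℓ => (hsep n k ℓ).eigenfunction hn
      (h.extension_ne_zero hα n k ℓ) (hrad n k).eq (h.extension_eq hα n k ℓ)⟩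
    have hN : (0 : ℝ) < n * (n + 1) := by
      have : (1 : ℝ) ≤ n := by exact_mod_cast hn
      positivity
    exact ⟨fun k => (hrad n k).pos hα hN, BallPSWF.exists_perm_strictMono (hinj n)
      (BallPSWF.finite_setOf_radial_eigenvalue_le hα hN (hrad n) (hinj n))⟩
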